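/- **Theorem.** Consider time-inhomogeneous Markov decision processes $M$ with horizon $H\ge 1$, states $\{1,\dots,S\}$, actions $\{1,\dots,A\}$, fixed initial state $s_1$, transition probabilities $P_{h,s,a}(\cdot)$ and random rewards in $[0,1]$ with means $R_{h,s,a}$. For a deterministic policy $\pi$, let $V^\pi_h$ be its value function, $V^\pi_{H+1}=0$, $V^\pi_h(s)=R_{h,s,\pi_h(s)}+\sum_{s'}P_{h,s,\pi_h(s)}(s')V^\pi_{h+1}(s')$, and let $V^*_h(s)=\max_\pi V^\pi_h(s)$. *Algorithm (Single Seed Randomization, Bernstein-type noise).* In episode $k=1,2,\dots$, let $n_k(h,s,a)$ and $n_k(h,s,a,s')$ be the numbers of earlier episodes in which action $a$ was taken in state $s$ at stage $h$, respectively in which moreover the next state was $s'$; let $\hat R^k_{h,s,a}$ be the sum of the rewards observed at $(h,s,a)$ divided by $n_k(h,s,a)+1$, and $$\hat P^k_{h,s,a}(s')=\frac{n_k(h,s,a,s')}{n_k(h,s,a)+1},\qquad \tilde P^k_{h,s,a}(s')=\frac{n_k(h,s,a,s')}{\max\{n_k(h,s,a),1\}}.$$ Draw one $\hat z_k\sim\mathcal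 N(0,1)$, independent of the past, put $\overline V_{H+1,k}=0$ and, for $h=H,\dots,1$, $$\overline Q_{h,k}(s,a)=\hat R^k_{h,s,a}+\langle\hat P^k_{h,s,a},\overline V_{h+1,k}\rangle+\sigma^k(h,s,a)\,\hat z_k,\qquad \overline V_{h,k}(s)=\mathrm{clip}_{2(H-h+1)}\Big(\max_a\overline Q_{h,k}(s,a)\Big),$$ where $\mathrm{clip}_c(x)=\max\{-c,\min\{c,x\}\}$, $\mathbb V(D,V)=\sum_sD(s)(V(s)-\langle D,V\rangle)^2$, $L_k=\log(2HSAk^2)$ and $$\sigma^k(h,s,a)=\sqrt{\frac{16\,\mathbb V(\tilde P^k_{h,s,a},\overline V_{h+1,k})\,L_k}{n_k(h,s,a)+1}}+\frac{65HL_k}{n_k(h,s,a)+1}+\sqrt{\frac{L_k}{n_k(h,s,a)+1}}.$$ Then play the policy $\pi^k_h(s)\in\arg\max_a\overline Q_{h,k}(s,a)$ from $s_1$ (ties broken by any fixed measurable rule). Let $T=HK$ and $\mathrm{Reg}(M,K)=\sum_{k=1}^K\big(V_1^*(s_1)-V_1^{\pi^k}(s_1)\big)$. *Claim.* For every integer $m\ge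 0$ there are constants $C>0$ and $p\in\mathbb N$, depending only on $m$, such that the following holds for all $H,S,A,K\ge1$ and all $\delta\in(0,1)$ with $\delta\ge T^{-m}$. Put $\ell=1+\log(HSAT/\delta)$. If $T\ge C\ell^p\,H^5S^2A$, then for every such $M$, with probability at least $1-\delta$, $$\mathrm{Reg}(M,K)\le C\ell^p\big(H\sqrt{SAT}+H^4S^2A\big).$$ If moreover $T\ge C\ell^p\,H^6S^3A$, then, with probability at least $1-\delta$, $\mathrm{Reg}(M,K)\le C\ell^p\,H\sqrt{SAT}$. -/

import Mathlib

open MeasureTheory ProbabilityTheory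

noncomputable section

namespace SSR

/-! Stages are indexed by `h : Fin H`, so that `h` is the stage called `h + 1` when stages are
counted from `1`.  Value functions are indexed by `Fin (H + 1)`, the last index being the terminal
one.  Episodes are counted from `0` in the code. -/

/-- A time-inhomogeneous finite-horizon Markov decision process with horizon `H`, `S` states and
`A` actions.  `outcome h s a` is the joint law of the reward (in `[0, 1]`) and of the next state
when action `a` is taken in state `s` at stage `h`. -/
structure MDP (H S A : ℕ) where
  outcome : Fin H → Fin S → Fin A → Measure (ℝ × Fin S)
  prob : ∀ h s a, IsProbabilityMeasure (outcome h s a)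
  reward_mem : ∀ h s a, ∀ᵐ x ∂(outcome h s a), x.1 ∈ Set.Icc (0 : ℝ) 1
  init : Fin S

instance {H S A : ℕ} (M : MDP H S A) (h : Fin H) (s : Fin S) (a : Fin A) :
    IsProbabilityMeasure (M.outcome h s a) := M.prob h s a

/-- A deterministic policy. -/
abbrev Policy (H S A : ℕ) : Type := Fin H → Fin S → Fin A

namespace MDP

variable {H S A : ℕ}

/-- Transition probability `P_{h,s,a}(s')`. -/
def P (M : MDP H S A) (h : Fin H) (s : Fin S) (a : Fin A) (s' : Fin S) : ℝ :=
  (M.outcome h s a).real {x | x.2 = s'}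

/-- Mean reward `R_{h,s,a}`. -/
def R (M : MDP H S A) (h : Fin H) (s : Fin S) (a : Fin A) : ℝ :=
  ∫ x, x.1 ∂(M.outcome h s a)

/-- Value function of a policy: zero at the terminal index, and the Bellman recursion. -/
def value (M : MDP H S A) (π : Policy H S A) (i : Fin (H + 1)) : Fin S → ℝ :=
  Fin.reverseInduction (motive := fun _ => Fin S → ℝ) (fun _ => 0)
    (fun h V s => M.R h s (π h s) + ∑ s', M.P h s (π h s) s' * V s') i

/-- Optimal value function: the maximum over all deterministic policies. -/
def optValue (M : MDP H S A) (i : Fin (H + 1)) (s : Fin S) : ℝ :=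
  ⨆ π : Policy H S A, M.value π i s

end MDP

/-- `clip_c (x) = max {-c, min {c, x}}`. -/
def clip (c x : ℝ) : ℝ := max (-c) (min c x)

/-- Variance of `V` under the weights `D`. -/
def wvar {S : ℕ} (D V : Fin S → ℝ) : ℝ :=
  ∑ s, D s * (V s - ∑ s', D s' * V s') ^ 2

/-- What is observed at one stage: state, action, reward, next state. -/
structure Obs (S A : ℕ) where
  state : Fin S
  action : Fin A
  reward : ℝ
  next : Fin S

/-- The observations of the first `k` episodes. -/
abbrev History (H S A k : ℕ) : Type := Fin k → Fin H → Obs S A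

section Algorithm

variable {H S A k : ℕ}

/-- Number of visits of `(s, a)` at stage `h` in the past episodes. -/
def visits (D : History H S A k) (h : Fin H) (s : Fin S) (a : Fin A) : ℕ :=
  ∑ l, if (D l h).state = s ∧ (D l h).action = a then 1 else 0

/-- Number of observed transitions from `(s, a)` to `s'` at stage `h`. -/
def transCount (D : History H S A k) (h : Fin H) (s : Fin S) (a : Fin A) (s' : Fin S) : ℕ :=
  ∑ l, if (D l h).state = s ∧ (D l h).action = a ∧ (D l h).next = s' then 1 else 0

/-- Estimated reward, with denominator `n + 1`. -/
def rHat (D : History H S A k) (h : Fin H) (s : Fin S) (a : Fin A) : ℝ :=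
  (∑ l, if (D l h).state = s ∧ (D l h).action = a then (D l h).reward else 0) /
    ((visits D h s a : ℝ) + 1)

/-- Estimated transition weights, with denominator `n + 1`. -/
def pHat (D : History H S A k) (h : Fin H) (s : Fin S) (a : Fin A) (s' : Fin S) : ℝ :=
  (transCount D h s a s' : ℝ) / ((visits D h s a : ℝ) + 1)

/-- Estimated transition weights, with denominator `max {n, 1}`. -/
def pTilde (D : History H S A k) (h : Fin H) (s : Fin S) (a : Fin A) (s' : Fin S) : ℝ :=
  (transCount D h s a s' : ℝ) / max (visits D h s a : ℝ) 1

/-- The factor `log (2 H S A k ^ 2)` used in the episode that follows `k` past episodes, which is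
episode `k + 1` when episodes are counted from `1`. -/
def logFactor (H S A k : ℕ) : ℝ :=
  Real.log (2 * (H : ℝ) * (S : ℝ) * (A : ℝ) * ((k : ℝ) + 1) ^ 2)

/-- The Bernstein-type noise magnitude, given the estimated next-stage value `V`. -/
def sigmaBe (D : History H S A k) (h : Fin H) (s : Fin S) (a : Fin A) (V : Fin S → ℝ) : ℝ :=
  Real.sqrt (16 * wvar (pTilde D h s a) V * logFactor H S A k / ((visits D h s a : ℝ) + 1))
    + 65 * (H : ℝ) * logFactor H S A k / ((visits D h s a : ℝ) + 1)
    + Real.sqrt (logFactor H S A k / ((visits D h s a : ℝ) + 1))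

/-- The perturbed action values at stage `h`, given the estimated next-stage value `V` and the
single seed `z` of the episode. -/
def qStep (D : History H S A k) (z : ℝ) (h : Fin H) (V : Fin S → ℝ) (s : Fin S) (a : Fin A) : ℝ :=
  rHat D h s a + ∑ s', pHat D h s a s' * V s' + sigmaBe D h s a V * z

/-- The estimated value functions.  At stage `h : Fin H` there are `H - h` remaining stages and
the clipping level is `2 (H - h)`. -/
def vBar (D : History H S A k) (z : ℝ) (i : Fin (H + 1)) : Fin S → ℝ :=
  Fin.reverseInduction (motive := fun _ => Fin S → ℝ) (fun _ => 0)
    (fun h V s => clip (2 * ((H : ℝ) - (h : ℝ))) (⨆ a, qStep D z h V s a)) i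

/-- The estimated action-value functions. -/
def qBar (D : History H S A k) (z : ℝ) (h : Fin H) (s : Fin S) (a : Fin A) : ℝ :=
  qStep D z h (vBar D z h.succ) s a

end Algorithm

/-- A rule for selecting an action in each episode, stage and state from the vector of action
values. -/
abbrev Selector (H S A : ℕ) : Type := ℕ → Fin H → Fin S → (Fin A → ℝ) → Fin A

/-- The rule is measurable and always selects a maximizer; ties are broken in any way. -/
def Selector.IsArgmax {H S A : ℕ} (sel : Selector H S A) : Prop :=
  ∀ k h s, Measurable (sel k h s) ∧ ∀ (q : Fin A → ℝ) (a : Fin A), q a ≤ q (sel k h s q)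

/-- The randomness of one episode: the seed `z`, and for each `(h, s, a)` the reward and next state
that are produced if the agent takes action `a` in state `s` at stage `h`. -/
abbrev Seed (H S A : ℕ) : Type := ℝ × (Fin H → Fin S → Fin A → ℝ × Fin S)

section Run

variable {H S A : ℕ}

/-- The greedy policy for the perturbed action values. -/
def greedy (sel : Selector H S A) {k : ℕ} (D : History H S A k) (z : ℝ) : Policy H S A :=
  fun h s => sel k h s (qBar D z h s)

/-- The states visited when `π` is run from `s₁` with the outcome table `y`. -/
def path (s₁ : Fin S) (π : Policy H S A) (y : Fin H → Fin S → Fin A → ℝ × Fin S)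
    (i : Fin (H + 1)) : Fin S :=
  Fin.induction (motive := fun _ => Fin S) s₁ (fun h s => (y h s (π h s)).2) i

/-- The observations of an episode in which `π` is run from `s₁` with the outcome table `y`. -/
def rollout (s₁ : Fin S) (π : Policy H S A) (y : Fin H → Fin S → Fin A → ℝ × Fin S)
    (h : Fin H) : Obs S A where
  state := path s₁ π y h.castSucc
  action := π h (path s₁ π y h.castSucc)
  reward := (y h (path s₁ π y h.castSucc) (π h (path s₁ π y h.castSucc))).1
  next := path s₁ π y h.succ

/-- The observations of the first `k` episodes of the algorithm. -/
def history (M : MDP H S A) (sel : Selector H S A) (ω : ℕ → Seed H S A) :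
    (k : ℕ) → History H S A k
  | 0 => Fin.elim0
  | k + 1 => Fin.snoc (α := fun _ => Fin H → Obs S A) (history M sel ω k)
      (rollout M.init (greedy sel (history M sel ω k) (ω k).1) (ω k).2)

/-- The policy played after `k` episodes. -/
def playedPolicy (M : MDP H S A) (sel : Selector H S A) (ω : ℕ → Seed H S A) (k : ℕ) :
    Policy H S A :=
  greedy sel (history M sel ω k) (ω k).1

/-- The regret of the first `K` episodes. -/
def regret (M : MDP H S A) (sel : Selector H S A) (K : ℕ) (ω : ℕ → Seed H S A) : ℝ :=
  ∑ k ∈ Finset.range K, (M.optValue 0 M.init - M.value (playedPolicy M sel ω k) 0 M.init)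

/-- The law of the randomness of one episode: a standard Gaussian seed, and independent outcomes.
An episode reads only one entry of the table per stage, at the visited state and chosen action,
so the resulting trajectories have the law of the interaction with the decision process. -/
def seedLaw (M : MDP H S A) : Measure (Seed H S A) :=
  (gaussianReal 0 1).prod
    (Measure.pi fun h => Measure.pi fun s => Measure.pi fun a => M.outcome h s a)

instance (M : MDP H S A) : IsProbabilityMeasure (seedLaw M) := by
  unfold seedLaw; infer_instance

/-- The law of the whole run: the episodes use independent randomness. -/
def runLaw (M : MDP H S A) : Measure (ℕ → Seed H S A) :=
  Measure.infinitePi fun _ => seedLaw M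

instance (M : MDP H S A) : IsProbabilityMeasure (runLaw M) := by
  unfold runLaw; infer_instance

end Run

/-- The quantity whose powers are the poly-logarithmic factors: `1 + log (H S A T / δ)`, where
`T = H K`. -/
def polylogBase (H S A K : ℕ) (δ : ℝ) : ℝ :=
  1 + Real.log ((H : ℝ) * (S : ℝ) * (A : ℝ) * ((H : ℝ) * (K : ℝ)) / δ)

end SSR

end

/-! The regret is reduced to the sum of the reciprocals `1 / (n + 1)` over visited triples, which is
harmonic. Write `x` for this reciprocal at a given triple.

Estimation. Four Bernstein bounds (rewards, `P V*`, the variance of `V*`, single transition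
probabilities) hold for all triples and episodes with the required probability; this is `Accurate`.
Since `V*` is a fixed function, its estimation costs no factor `S`. The random difference `V̄ - V*`
is treated entry by entry, with a factor `S`, but AM-GM turns its contribution into `Var (V̄ - V*) /
(100 H)` plus a multiple of `x`. Thus `Accurate.abs_residual_le` bounds the Bellman residual of the
perturbed values by `width`: a `bonus` consisting of `θ (1 + Var V*)` and `x / θ + S H x`, up to
logarithms, plus that small variance.

Total variance. Telescoping squares along a trajectory (`MDP.expSum_wvar_le`) bounds the expected
sum of one-step variances of `U` by `sup |U|` times the sum of its Bellman residuals. For `V*` this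
gives `2 H ^ 2` instead of `H ^ 3`. For `V̄ - V*` the residuals are again controlled by widths and
regrets, and the factor `1 / (100 H)` makes this recursion a contraction
(`WidthValid.expSum_width_le`).

Optimism and one seed. If the seed `z'` is at least a constant `4 c`, then `V* ≤ V̄` at all stages
and states simultaneously (`Accurate.optValue_le_vBar`): one common Gaussian compensates every
error, so optimism has a probability `q > 0` depending only on `m`. For any other bounded seed `z`,
with greedy policies `π` for `z` and `π'` for `z'`, the regret is `(V* - V̄') + (V̄' - V^π') + (V^π'
- V̄) + (V̄ - V^π)`. The first term is nonpositive and the others are sums of widths, so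
`WidthValid.regret_le_bonus` bounds the regret by the bonuses of `π` and `π'`. Choosing `z'` no
worse than the average over the optimistic interval replaces the bonus of `π'` by `1 / q` times the
mean over all seeds (`integral_regret_le`).

Summation. Exponential supermartingales (`measure_sum_gt_le`, `measure_sum_mean_gt_le`) exchange
realized sums and sums of conditional means at the cost of a factor two. The realized reciprocals
sum to at most `H S A (1 + log K)`. With `θ = √(S A / T)` both main terms equal `H √(S A T)` up to
logarithms, and the remainder is `H ^ 2 S ^ 2 A`, which is below the `H ^ 4 S ^ 2 A` of the theorem.

The noise contains `log k` while accuracy needs `log (T / δ)`. These are comparable when `δ ≥ T ^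
(-m)` and `(k + 1) ^ 2 ≥ K`; the fewer than `√K` earlier episodes are charged `H` each. -/

noncomputable section

namespace SSR

/-! ### Finite-horizon Markov decision processes -/

namespace MDP

variable {H S A : ℕ} (M : MDP H S A)

lemma P_eq_map (h : Fin H) (s : Fin S) (a : Fin A) (s' : Fin S) :
    M.P h s a s' = ((M.outcome h s a).map Prod.snd).real {s'} := by
  rw [map_measureReal_apply measurable_snd (measurableSet_singleton _)]
  rfl

lemma integral_next (h : Fin H) (s : Fin S) (a : Fin A) (g : Fin S → ℝ) :
    ∫ x, g x.2 ∂(M.outcome h s a) = ∑ s', M.P h s a s' * g s' := by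
  have h1 : ∫ x, g x.2 ∂(M.outcome h s a) = ∫ y, g y ∂((M.outcome h s a).map Prod.snd) := by
    rw [integral_map measurable_snd.aemeasurable]
    exact (measurable_of_countable g).aestronglyMeasurable
  have : IsProbabilityMeasure ((M.outcome h s a).map Prod.snd) :=
    Measure.isProbabilityMeasure_map measurable_snd.aemeasurable
  rw [h1, integral_fintype Integrable.of_finite]
  simp [P_eq_map, smul_eq_mul]

lemma P_nonneg (h : Fin H) (s : Fin S) (a : Fin A) (s' : Fin S) : 0 ≤ M.P h s a s' :=
  measureReal_nonneg

lemma P_sum (h : Fin H) (s : Fin S) (a : Fin A) : ∑ s', M.P h s a s' = 1 := by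
  have := M.integral_next h s a (fun _ => 1)
  simpa using this.symm

lemma integrable_reward (h : Fin H) (s : Fin S) (a : Fin A) :
    Integrable (fun x : ℝ × Fin S => x.1) (M.outcome h s a) := by
  refine Integrable.of_bound measurable_fst.aestronglyMeasurable 1 ?_
  filter_upwards [M.reward_mem h s a] with x hx
  rw [Real.norm_eq_abs, abs_le]
  constructor <;> linarith [hx.1, hx.2]

lemma R_nonneg (h : Fin H) (s : Fin S) (a : Fin A) : 0 ≤ M.R h s a := by
  refine integral_nonneg_of_ae ?_
  filter_upwards [M.reward_mem h s a] with x hx using hx.1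

lemma R_le_one (h : Fin H) (s : Fin S) (a : Fin A) : M.R h s a ≤ 1 := by
  have : M.R h s a ≤ ∫ _, (1 : ℝ) ∂(M.outcome h s a) := by
    refine integral_mono_ae (M.integrable_reward h s a) (integrable_const _) ?_
    filter_upwards [M.reward_mem h s a] with x hx using hx.2
  simpa using this

lemma sum_P_mul_le {h : Fin H} {s : Fin S} {a : Fin A} {U : Fin S → ℝ} {c : ℝ}
    (hU : ∀ s', U s' ≤ c) : ∑ s', M.P h s a s' * U s' ≤ c := by
  calc ∑ s', M.P h s a s' * U s' ≤ ∑ s', M.P h s a s' * c :=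
        Finset.sum_le_sum fun s' _ => mul_le_mul_of_nonneg_left (hU s') (M.P_nonneg h s a s')
    _ = c := by rw [← Finset.sum_mul, M.P_sum, one_mul]

lemma le_sum_P_mul {h : Fin H} {s : Fin S} {a : Fin A} {U : Fin S → ℝ} {c : ℝ}
    (hU : ∀ s', c ≤ U s') : c ≤ ∑ s', M.P h s a s' * U s' := by
  calc c = ∑ s', M.P h s a s' * c := by rw [← Finset.sum_mul, M.P_sum, one_mul]
    _ ≤ ∑ s', M.P h s a s' * U s' :=
        Finset.sum_le_sum fun s' _ => mul_le_mul_of_nonneg_left (hU s') (M.P_nonneg h s a s')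

lemma sum_P_mul_mono {h : Fin H} {s : Fin S} {a : Fin A} {U V : Fin S → ℝ}
    (hU : ∀ s', U s' ≤ V s') : ∑ s', M.P h s a s' * U s' ≤ ∑ s', M.P h s a s' * V s' :=
  Finset.sum_le_sum fun s' _ => mul_le_mul_of_nonneg_left (hU s') (M.P_nonneg h s a s')

lemma value_last (π : Policy H S A) (s : Fin S) : M.value π (Fin.last H) s = 0 := by
  simp [value]

lemma value_castSucc (π : Policy H S A) (h : Fin H) (s : Fin S) :
    M.value π h.castSucc s
      = M.R h s (π h s) + ∑ s', M.P h s (π h s) s' * M.value π h.succ s' := by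
  simp [value]

/-! #### Optimal values -/

/-- The solution of the Bellman optimality recursion. -/
def bellman (i : Fin (H + 1)) : Fin S → ℝ :=
  Fin.reverseInduction (motive := fun _ => Fin S → ℝ) (fun _ => 0)
    (fun h V s => ⨆ a, (M.R h s a + ∑ s', M.P h s a s' * V s')) i

lemma bellman_last (s : Fin S) : M.bellman (Fin.last H) s = 0 := by
  simp [bellman]

lemma bellman_castSucc (h : Fin H) (s : Fin S) :
    M.bellman h.castSucc s
      = ⨆ a, (M.R h s a + ∑ s', M.P h s a s' * M.bellman h.succ s') := by
  simp [bellman]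

lemma value_le_bellman (π : Policy H S A) (i : Fin (H + 1)) :
    ∀ s, M.value π i s ≤ M.bellman i s := by
  induction i using Fin.reverseInduction with
  | last => intro s; rw [value_last, bellman_last]
  | cast h ih =>
    intro s
    rw [value_castSucc, bellman_castSucc]
    refine le_trans ?_ (le_ciSup (Set.finite_range _).bddAbove (π h s))
    exact add_le_add_right (M.sum_P_mul_mono ih) _

section Optimal

variable [Nonempty (Fin A)]

lemma exists_greedy_bellman (h : Fin H) (s : Fin S) :
    ∃ a, M.bellman h.castSucc s
      = M.R h s a + ∑ s', M.P h s a s' * M.bellman h.succ s' := by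
  obtain ⟨a, ha⟩ := exists_eq_ciSup_of_finite
    (f := fun a => M.R h s a + ∑ s', M.P h s a s' * M.bellman h.succ s')
  exact ⟨a, by rw [bellman_castSucc, ha]⟩

/-- One policy, greedy for the recursion, attains the recursion at all stages and states at once, so
the maximum over policies satisfies the Bellman equation. -/
lemma optValue_eq_bellman (i : Fin (H + 1)) (s : Fin S) : M.optValue i s = M.bellman i s := by
  refine le_antisymm (ciSup_le fun π => M.value_le_bellman π i s) ?_
  choose a ha using M.exists_greedy_bellman
  have key : ∀ s, M.value (fun h s => a h s) i s = M.bellman i s := by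
    induction i using Fin.reverseInduction with
    | last => intro s; rw [value_last, bellman_last]
    | cast h ih =>
      intro s
      rw [value_castSucc, ha]
      simp [ih]
  rw [← key s]
  exact le_ciSup (f := fun π => M.value π i s) (Set.finite_range _).bddAbove _

lemma value_le_optValue (π : Policy H S A) (i : Fin (H + 1)) (s : Fin S) :
    M.value π i s ≤ M.optValue i s := by
  rw [optValue_eq_bellman]; exact M.value_le_bellman π i s

lemma optValue_last (s : Fin S) : M.optValue (Fin.last H) s = 0 := by
  rw [optValue_eq_bellman, bellman_last]

lemma le_optValue (h : Fin H) (s : Fin S) (a : Fin A) :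
    M.R h s a + ∑ s', M.P h s a s' * M.optValue h.succ s' ≤ M.optValue h.castSucc s := by
  simp only [optValue_eq_bellman]
  rw [bellman_castSucc]
  exact le_ciSup (f := fun a => M.R h s a + ∑ s', M.P h s a s' * M.bellman h.succ s')
    (Set.finite_range _).bddAbove a

lemma exists_optValue_eq (h : Fin H) (s : Fin S) :
    ∃ a, M.optValue h.castSucc s
      = M.R h s a + ∑ s', M.P h s a s' * M.optValue h.succ s' := by
  simp only [optValue_eq_bellman]
  exact M.exists_greedy_bellman h s

lemma optValue_bounds (i : Fin (H + 1)) :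
    ∀ s, 0 ≤ M.optValue i s ∧ M.optValue i s ≤ (H : ℝ) - (i : ℕ) := by
  induction i using Fin.reverseInduction with
  | last => intro s; rw [optValue_last]; simp
  | cast h ih =>
    intro s
    obtain ⟨a, ha⟩ := M.exists_optValue_eq h s
    have h1 := M.le_sum_P_mul (h := h) (s := s) (a := a) fun s' => (ih s').1
    have h2 := M.sum_P_mul_le (h := h) (s := s) (a := a) fun s' => (ih s').2
    have h3 := M.R_nonneg h s a
    have h4 := M.R_le_one h s a
    rw [ha]
    simp only [Fin.val_succ, Nat.cast_add, Nat.cast_one, Fin.val_castSucc] at *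
    constructor <;> linarith

lemma optValue_nonneg (i : Fin (H + 1)) (s : Fin S) : 0 ≤ M.optValue i s :=
  (M.optValue_bounds i s).1

lemma optValue_le (i : Fin (H + 1)) (s : Fin S) : M.optValue i s ≤ H := by
  have := (M.optValue_bounds i s).2
  have h2 : (0 : ℝ) ≤ (i : ℕ) := Nat.cast_nonneg _
  linarith

end Optimal

/-! #### Occupancies -/

/-- Probability of being in a given state at a given stage when `π` is run. -/
def occ (π : Policy H S A) (i : Fin (H + 1)) : Fin S → ℝ :=
  Fin.induction (motive := fun _ => Fin S → ℝ) (fun s => if s = M.init then 1 else 0)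
    (fun h o s' => ∑ s, o s * M.P h s (π h s) s') i

lemma occ_zero (π : Policy H S A) (s : Fin S) :
    M.occ π 0 s = if s = M.init then 1 else 0 := by simp [occ]

lemma occ_succ (π : Policy H S A) (h : Fin H) (s' : Fin S) :
    M.occ π h.succ s' = ∑ s, M.occ π h.castSucc s * M.P h s (π h s) s' := by simp [occ]

lemma occ_nonneg (π : Policy H S A) (i : Fin (H + 1)) : ∀ s, 0 ≤ M.occ π i s := by
  induction i using Fin.induction with
  | zero => intro s; rw [occ_zero]; split_ifs <;> norm_num
  | succ h ih =>
    intro s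
    rw [occ_succ]
    exact Finset.sum_nonneg fun s _ => mul_nonneg (ih s) (M.P_nonneg _ _ _ _)

lemma occ_sum (π : Policy H S A) (i : Fin (H + 1)) : ∑ s, M.occ π i s = 1 := by
  induction i using Fin.induction with
  | zero => simp [occ_zero]
  | succ h ih =>
    simp only [occ_succ]
    rw [Finset.sum_comm]
    simp only [← Finset.mul_sum, P_sum, mul_one, ih]

/-- Expected cumulative value of `w` along a trajectory of `π`. -/
def expSum (π : Policy H S A) (w : Fin H → Fin S → Fin A → ℝ) : ℝ :=
  ∑ h, ∑ s, M.occ π h.castSucc s * w h s (π h s)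

variable {M}

lemma expSum_mono {π : Policy H S A} {w w' : Fin H → Fin S → Fin A → ℝ}
    (hw : ∀ h s, w h s (π h s) ≤ w' h s (π h s)) : M.expSum π w ≤ M.expSum π w' :=
  Finset.sum_le_sum fun h _ => Finset.sum_le_sum fun s _ =>
    mul_le_mul_of_nonneg_left (hw h s) (M.occ_nonneg π _ s)

lemma expSum_nonneg {π : Policy H S A} {w : Fin H → Fin S → Fin A → ℝ}
    (hw : ∀ h s, 0 ≤ w h s (π h s)) : 0 ≤ M.expSum π w :=
  Finset.sum_nonneg fun h _ => Finset.sum_nonneg fun s _ =>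
    mul_nonneg (M.occ_nonneg π _ s) (hw h s)

lemma expSum_add (π : Policy H S A) (w w' : Fin H → Fin S → Fin A → ℝ) :
    M.expSum π (fun h s a => w h s a + w' h s a) = M.expSum π w + M.expSum π w' := by
  simp only [expSum, mul_add, Finset.sum_add_distrib]

lemma expSum_sub (π : Policy H S A) (w w' : Fin H → Fin S → Fin A → ℝ) :
    M.expSum π (fun h s a => w h s a - w' h s a) = M.expSum π w - M.expSum π w' := by
  simp only [expSum, mul_sub, Finset.sum_sub_distrib]

lemma expSum_mul (π : Policy H S A) (c : ℝ) (w : Fin H → Fin S → Fin A → ℝ) :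
    M.expSum π (fun h s a => c * w h s a) = c * M.expSum π w := by
  simp only [expSum, Finset.mul_sum]
  exact Finset.sum_congr rfl fun h _ => Finset.sum_congr rfl fun s _ => by ring

lemma expSum_const (π : Policy H S A) (c : ℝ) : M.expSum π (fun _ _ _ => c) = H * c := by
  simp only [expSum, ← Finset.sum_mul, occ_sum]
  simp

/-- The next occupancy is the current one pushed through the transitions, so the occupancy average
of `P U` at one stage is that of `U` at the next. All value differences and variance sums below are
expanded this way. -/
lemma expSum_telescope (π : Policy H S A) (U : Fin (H + 1) → Fin S → ℝ)
    (hU : ∀ s, U (Fin.last H) s = 0) :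
    M.expSum π (fun h s a => U h.castSucc s - ∑ s', M.P h s a s' * U h.succ s')
      = U 0 M.init := by
  set F : Fin (H + 1) → ℝ := fun i => ∑ s, M.occ π i s * U i s with hF
  have h1 : M.expSum π (fun h s a => U h.castSucc s - ∑ s', M.P h s a s' * U h.succ s')
      = ∑ h : Fin H, (F h.castSucc - F h.succ) := by
    refine Finset.sum_congr rfl fun h _ => ?_
    simp only [mul_sub, Finset.sum_sub_distrib, hF]
    congr 1
    simp only [occ_succ, Finset.mul_sum, Finset.sum_mul]
    rw [Finset.sum_comm]
    exact Finset.sum_congr rfl fun s _ => Finset.sum_congr rfl fun s' _ => by ring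
  have h2 := Fin.sum_univ_castSucc F
  rw [Fin.sum_univ_succ] at h2
  have h3 : F (Fin.last H) = 0 := by simp [hF, hU]
  have h4 : F 0 = U 0 M.init := by simp [hF, occ_zero]
  rw [h1, Finset.sum_sub_distrib]
  linarith

lemma value_eq_expSum (π : Policy H S A) : M.value π 0 M.init = M.expSum π M.R := by
  rw [← expSum_telescope π (M.value π) (M.value_last π)]
  refine le_antisymm (expSum_mono fun h s => ?_) (expSum_mono fun h s => ?_) <;>
    rw [value_castSucc] <;> linarith

lemma wvar_P (h : Fin H) (s : Fin S) (a : Fin A) (U : Fin S → ℝ) :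
    wvar (M.P h s a) U = ∑ s', M.P h s a s' * U s' ^ 2 - (∑ s', M.P h s a s' * U s') ^ 2 := by
  unfold wvar
  set m := ∑ s', M.P h s a s' * U s'
  have : ∀ s', M.P h s a s' * (U s' - m) ^ 2
      = M.P h s a s' * U s' ^ 2 - 2 * m * (M.P h s a s' * U s') + m ^ 2 * M.P h s a s' :=
    fun s' => by ring
  simp only [this, Finset.sum_add_distrib, Finset.sum_sub_distrib, ← Finset.mul_sum, P_sum]
  ring

/-- The expected total variance of `U` is controlled by its Bellman residuals. -/
lemma expSum_wvar_le (π : Policy H S A) (U : Fin (H + 1) → Fin S → ℝ)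
    (hU : ∀ s, U (Fin.last H) s = 0) {c : ℝ} (hc : ∀ i s, |U i s| ≤ c) :
    M.expSum π (fun h s a => wvar (M.P h s a) (U h.succ))
      ≤ 2 * c * M.expSum π (fun h s a => |U h.castSucc s - ∑ s', M.P h s a s' * U h.succ s'|) := by
  -- Squares telescope to a nonnegative number. Adding their increments to the variances leaves `U ^
  -- 2 - (P U) ^ 2 = (U - P U) (U + P U)`, whose second factor is at most `2 c`.
  have h1 := expSum_telescope (M := M) π (fun i s => U i s ^ 2) (fun s => by simp [hU])
  have h2 : 0 ≤ U 0 M.init ^ 2 := sq_nonneg _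
  have h3 : M.expSum π (fun h s a => wvar (M.P h s a) (U h.succ))
      + M.expSum π (fun h s a => U h.castSucc s ^ 2 - ∑ s', M.P h s a s' * U h.succ s' ^ 2)
      ≤ 2 * c *
        M.expSum π (fun h s a => |U h.castSucc s - ∑ s', M.P h s a s' * U h.succ s'|) := by
    rw [← expSum_add, ← expSum_mul]
    refine expSum_mono fun h s => ?_
    rw [wvar_P]
    set m := ∑ s', M.P h s (π h s) s' * U h.succ s' with hm
    have hmc : |m| ≤ c := abs_le.2
      ⟨M.le_sum_P_mul fun s' => (abs_le.1 (hc _ s')).1,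
        M.sum_P_mul_le fun s' => (abs_le.1 (hc _ s')).2⟩
    have h4 : |(U h.castSucc s - m) * (U h.castSucc s + m)|
        ≤ |U h.castSucc s - m| * (2 * c) := by
      rw [abs_mul]
      refine mul_le_mul_of_nonneg_left ?_ (abs_nonneg _)
      exact (abs_add_le _ _).trans (by linarith [hc h.castSucc s])
    have h5 := le_abs_self ((U h.castSucc s - m) * (U h.castSucc s + m))
    nlinarith
  linarith

/-- The residuals `V* - P V*` dominate the rewards for every action, hence are nonnegative. Their
absolute values therefore telescope to `V*` at the start, which is at most `H`. -/
lemma expSum_wvar_optValue_le [Nonempty (Fin A)] (π : Policy H S A) :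
    M.expSum π (fun h s a => wvar (M.P h s a) (M.optValue h.succ)) ≤ 2 * (H : ℝ) ^ 2 := by
  have h1 := expSum_wvar_le (M := M) π M.optValue M.optValue_last (c := H)
    (fun i s => by rw [abs_of_nonneg (M.optValue_nonneg i s)]; exact M.optValue_le i s)
  have h2 : M.expSum π (fun h s a =>
      |M.optValue h.castSucc s - ∑ s', M.P h s a s' * M.optValue h.succ s'|)
      ≤ M.optValue 0 M.init := by
    rw [← expSum_telescope π M.optValue M.optValue_last]
    refine expSum_mono fun h s => (abs_of_nonneg ?_).le
    have := M.le_optValue h s (π h s)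
    have := M.R_nonneg h s (π h s)
    linarith
  have h3 := M.optValue_le 0 M.init
  have h4 : (0 : ℝ) ≤ H := Nat.cast_nonneg _
  nlinarith

end MDP

/-! ### Weighted variances -/

lemma sqrt_mul_le {τ u v : ℝ} (hτ : 0 < τ) (hu : 0 ≤ u) (hv : 0 ≤ v) :
    Real.sqrt (u * v) ≤ τ * u + v / τ := by
  refine Real.sqrt_le_iff.2 ⟨by positivity, ?_⟩
  have h1 : (τ * u) * (v / τ) = u * v := by field_simp
  have h2 : 0 ≤ τ * u := by positivity
  have h3 : 0 ≤ v / τ := by positivity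
  nlinarith

lemma sqrt_add_le {u v : ℝ} (hu : 0 ≤ u) (hv : 0 ≤ v) :
    Real.sqrt (u + v) ≤ Real.sqrt u + Real.sqrt v := by
  refine Real.sqrt_le_iff.2 ⟨by positivity, ?_⟩
  have h1 := Real.sq_sqrt hu
  have h2 := Real.sq_sqrt hv
  have h3 : 0 ≤ Real.sqrt u * Real.sqrt v := by positivity
  nlinarith

section Variance

variable {S : ℕ} {p u v : Fin S → ℝ}

lemma wvar_nonneg (hp : ∀ s, 0 ≤ p s) : 0 ≤ wvar p u :=
  Finset.sum_nonneg fun s _ => mul_nonneg (hp s) (sq_nonneg _)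

/-- The bias-variance identity. -/
lemma sum_mul_sub_sq (h1 : ∑ s, p s = 1) (c : ℝ) :
    ∑ s, p s * (u s - c) ^ 2 = wvar p u + (∑ s, p s * u s - c) ^ 2 := by
  unfold wvar
  set m := ∑ s, p s * u s with hm
  have e : ∀ s, p s * (u s - c) ^ 2 = p s * (u s - m) ^ 2 + 2 * (m - c) * (p s * u s)
      + (c ^ 2 - m ^ 2) * p s := fun s => by ring
  simp only [e, Finset.sum_add_distrib, ← Finset.mul_sum, h1, ← hm]
  ring

lemma wvar_add_le (hp : ∀ s, 0 ≤ p s) (u v : Fin S → ℝ) :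
    wvar p (fun s => u s + v s) ≤ 2 * wvar p u + 2 * wvar p v := by
  have e : ∑ s, p s * (u s + v s) = ∑ s, p s * u s + ∑ s, p s * v s := by
    simp only [mul_add, Finset.sum_add_distrib]
  unfold wvar
  rw [e]
  generalize ∑ s, p s * u s = a
  generalize ∑ s, p s * v s = b
  rw [Finset.mul_sum, Finset.mul_sum, ← Finset.sum_add_distrib]
  refine Finset.sum_le_sum fun s _ => ?_
  nlinarith [mul_nonneg (hp s) (sq_nonneg ((u s - a) - (v s - b)))]

/-- Expand `v = u + (v - u)` around the mean of `u`: the square of `v - u` beats the squared mean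
shift, and the cross term is at least `-2 c p (v - u)` since `u` lies within `c` of its mean. This
lets the noise, built from the variance of the perturbed values, pay for errors governed by the
variance of `V*`. -/
lemma wvar_le_add_mean_sub (hp : ∀ s, 0 ≤ p s) (h1 : ∑ s, p s = 1) {c : ℝ}
    (hu : ∀ s, 0 ≤ u s ∧ u s ≤ c) (huv : ∀ s, u s ≤ v s) :
    wvar p u ≤ wvar p v + 2 * c * ∑ s, p s * (v s - u s) := by
  have e := sum_mul_sub_sq (u := v) h1 (∑ s, p s * u s)
  have e2 : wvar p v = ∑ s, p s * (v s - ∑ s, p s * u s) ^ 2 - (∑ s, p s * (v s - u s)) ^ 2 := by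
    simp only [mul_sub, Finset.sum_sub_distrib] at *
    linarith
  have e3 : wvar p (fun s => v s - u s) = ∑ s, p s * (v s - u s) ^ 2
      - (∑ s, p s * (v s - u s)) ^ 2 := by
    have := sum_mul_sub_sq (u := fun s => v s - u s) h1 0
    simp only [sub_zero] at this
    linarith
  have e4 := wvar_nonneg (u := fun s => v s - u s) hp
  have hm : ∑ s, p s * u s ≤ c := by
    calc ∑ s, p s * u s ≤ ∑ s, p s * c :=
          Finset.sum_le_sum fun s _ => mul_le_mul_of_nonneg_left (hu s).2 (hp s)
      _ = c := by rw [← Finset.sum_mul, h1, one_mul]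
  have e5 : wvar p u + ∑ s, p s * (v s - u s) ^ 2
      ≤ ∑ s, p s * (v s - ∑ s, p s * u s) ^ 2 + 2 * c * ∑ s, p s * (v s - u s) := by
    unfold wvar
    rw [Finset.mul_sum, ← Finset.sum_add_distrib, ← Finset.sum_add_distrib]
    refine Finset.sum_le_sum fun s _ => ?_
    set m := ∑ s, p s * u s
    have h6 : 0 ≤ p s * (v s - u s) := mul_nonneg (hp s) (by linarith [huv s])
    nlinarith [mul_nonneg h6 (show 0 ≤ u s - m + c by linarith [(hu s).1])]
  rw [e2]
  linarith

end Variance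

/-! ### Empirical weights -/

section Empirical

variable {H S A k : ℕ} (D : History H S A k)

/-- The reciprocal of one plus the number of visits. -/
def invVisits (h : Fin H) (s : Fin S) (a : Fin A) : ℝ := 1 / ((visits D h s a : ℝ) + 1)

lemma invVisits_pos (h : Fin H) (s : Fin S) (a : Fin A) : 0 < invVisits D h s a := by
  unfold invVisits; positivity

lemma invVisits_le_one (h : Fin H) (s : Fin S) (a : Fin A) : invVisits D h s a ≤ 1 := by
  unfold invVisits
  rw [div_le_one (by positivity)]
  linarith [Nat.cast_nonneg (α := ℝ) (visits D h s a)]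

lemma sum_transCount (h : Fin H) (s : Fin S) (a : Fin A) :
    ∑ s', transCount D h s a s' = visits D h s a := by
  unfold transCount visits
  rw [Finset.sum_comm]
  refine Finset.sum_congr rfl fun l _ => ?_
  by_cases hs : (D l h).state = s ∧ (D l h).action = a
  · simp [hs.1, hs.2]
  · rw [if_neg hs]
    exact Finset.sum_eq_zero fun s' _ => if_neg fun h' => hs ⟨h'.1, h'.2.1⟩

lemma transCount_eq_zero {h : Fin H} {s : Fin S} {a : Fin A} (hn : visits D h s a = 0)
    (s' : Fin S) : transCount D h s a s' = 0 := by
  have h1 := sum_transCount D h s a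
  rw [hn, Finset.sum_eq_zero_iff] at h1
  exact h1 s' (Finset.mem_univ _)

lemma pTilde_nonneg (h : Fin H) (s : Fin S) (a : Fin A) (s' : Fin S) :
    0 ≤ pTilde D h s a s' := by
  unfold pTilde; positivity

lemma pTilde_eq_zero {h : Fin H} {s : Fin S} {a : Fin A} (hn : visits D h s a = 0)
    (s' : Fin S) : pTilde D h s a s' = 0 := by
  simp [pTilde, transCount_eq_zero D hn]

lemma max_visits {h : Fin H} {s : Fin S} {a : Fin A} (hn : visits D h s a ≠ 0) :
    max (visits D h s a : ℝ) 1 = visits D h s a := by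
  have : (1 : ℝ) ≤ visits D h s a := by exact_mod_cast Nat.one_le_iff_ne_zero.2 hn
  exact max_eq_left this

lemma sum_pTilde {h : Fin H} {s : Fin S} {a : Fin A} (hn : visits D h s a ≠ 0) :
    ∑ s', pTilde D h s a s' = 1 := by
  unfold pTilde
  rw [← Finset.sum_div, max_visits D hn, ← Nat.cast_sum, sum_transCount]
  exact div_self (by exact_mod_cast hn)

/-- The two estimators differ only by a shrinkage `1 - x`; the analysis works with the genuine
empirical distribution and treats the shrinkage as a separate error of size `x`. -/
lemma pHat_eq (h : Fin H) (s : Fin S) (a : Fin A) (s' : Fin S) :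
    pHat D h s a s' = (1 - invVisits D h s a) * pTilde D h s a s' := by
  by_cases hn : visits D h s a = 0
  · rw [pTilde_eq_zero D hn, mul_zero, pHat, transCount_eq_zero D hn]; simp
  · have h0 : (visits D h s a : ℝ) ≠ 0 := by exact_mod_cast hn
    have h1 : (visits D h s a : ℝ) + 1 ≠ 0 := by positivity
    rw [pHat, pTilde, invVisits, max_visits D hn]
    field_simp
    ring

lemma invVisits_eq_one {h : Fin H} {s : Fin S} {a : Fin A} (hn : visits D h s a = 0) :
    invVisits D h s a = 1 := by simp [invVisits, hn]

lemma invVisits_le_half {h : Fin H} {s : Fin S} {a : Fin A} (hn : visits D h s a ≠ 0) :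
    invVisits D h s a ≤ 1 / 2 := by
  have : (1 : ℝ) ≤ visits D h s a := by exact_mod_cast Nat.one_le_iff_ne_zero.2 hn
  unfold invVisits
  exact one_div_le_one_div_of_le (by norm_num) (by linarith)

lemma sigmaBe_eq (h : Fin H) (s : Fin S) (a : Fin A) (V : Fin S → ℝ) :
    sigmaBe D h s a V
      = Real.sqrt (16 * wvar (pTilde D h s a) V * (logFactor H S A k * invVisits D h s a))
        + 65 * H * (logFactor H S A k * invVisits D h s a)
        + Real.sqrt (logFactor H S A k * invVisits D h s a) := by
  unfold sigmaBe invVisits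
  congr 2
  · congr 1; ring
  · ring
  · ring_nf

/-! ### Perturbed values -/

lemma vBar_last (z : ℝ) (s : Fin S) : vBar D z (Fin.last H) s = 0 := by simp [vBar]

lemma vBar_castSucc (z : ℝ) (h : Fin H) (s : Fin S) :
    vBar D z h.castSucc s = clip (2 * ((H : ℝ) - (h : ℕ))) (⨆ a, qBar D z h s a) := by
  simp [vBar, qBar]

lemma abs_vBar_le (z : ℝ) (i : Fin (H + 1)) (s : Fin S) :
    |vBar D z i s| ≤ 2 * ((H : ℝ) - (i : ℕ)) := by
  induction i using Fin.lastCases with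
  | last => simp [vBar_last]
  | cast h =>
    rw [vBar_castSucc, Fin.val_castSucc]
    have h1 : ((h : ℕ) : ℝ) ≤ H := by exact_mod_cast h.2.le
    unfold clip
    rw [abs_le]
    exact ⟨le_max_left _ _, max_le (by linarith) (min_le_left _ _)⟩

lemma abs_vBar_le_two_mul (z : ℝ) (i : Fin (H + 1)) (s : Fin S) : |vBar D z i s| ≤ 2 * H := by
  have h1 := abs_vBar_le D z i s
  have h2 : (0 : ℝ) ≤ (i : ℕ) := Nat.cast_nonneg _
  linarith

lemma iSup_qBar_eq {sel : Selector H S A} (hsel : sel.IsArgmax) (z : ℝ) (h : Fin H) (s : Fin S) :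
    ⨆ a, qBar D z h s a = qBar D z h s (greedy sel D z h s) := by
  have hmax := (hsel k h s).2 (qBar D z h s)
  have : Nonempty (Fin A) := ⟨greedy sel D z h s⟩
  exact le_antisymm (ciSup_le hmax) (le_ciSup (Set.finite_range _).bddAbove _)

end Empirical

/-! ### Analysis of one episode for a history with accurate estimates -/

/-- The estimates computed from the history are accurate at confidence level `L`. -/
structure Accurate {H S A k : ℕ} (M : MDP H S A) (D : History H S A k) (L : ℝ) : Prop where
  reward : ∀ h s a, |rHat D h s a - M.R h s a|
    ≤ 3 * (Real.sqrt (L * invVisits D h s a) + L * invVisits D h s a)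
  value : ∀ h s a, |∑ s', pTilde D h s a s' * M.optValue h.succ s'
      - ∑ s', M.P h s a s' * M.optValue h.succ s'|
    ≤ 4 * (Real.sqrt (wvar (M.P h s a) (M.optValue h.succ) * (L * invVisits D h s a))
      + H * (L * invVisits D h s a))
  variance : ∀ h s a, wvar (M.P h s a) (M.optValue h.succ)
    ≤ 4 * wvar (pTilde D h s a) (M.optValue h.succ) + 64 * H ^ 2 * (L * invVisits D h s a)
  trans : ∀ h s a s', |pTilde D h s a s' - M.P h s a s'|
    ≤ 4 * (Real.sqrt (M.P h s a s' * (L * invVisits D h s a)) + L * invVisits D h s a)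

section Episode

variable {H S A k : ℕ} {M : MDP H S A} {D : History H S A k} {L : ℝ}

lemma Accurate.pTilde_le (hD : Accurate M D L) (hL : 0 ≤ L) (h : Fin H) (s : Fin S) (a : Fin A)
    (s' : Fin S) : pTilde D h s a s' ≤ 2 * M.P h s a s' + 8 * (L * invVisits D h s a) := by
  have h1 := (abs_le.1 (hD.trans h s a s')).2
  have hy : 0 ≤ L * invVisits D h s a := mul_nonneg hL (invVisits_pos D h s a).le
  have hP := M.P_nonneg h s a s'
  -- AM-GM; multiplied by four, the linear part `P / 4` becomes the second copy of `P`.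
  have h2 : Real.sqrt (M.P h s a s' * (L * invVisits D h s a))
      ≤ M.P h s a s' / 4 + (L * invVisits D h s a) := by
    refine Real.sqrt_le_iff.2 ⟨by positivity, ?_⟩
    nlinarith [sq_nonneg (M.P h s a s' / 4 - (L * invVisits D h s a))]
  linarith

/-- Centering at the true mean only increases the empirical variance, and the weights can then be
compared one state at a time. The additive errors over all states produce the factor `S`, in a
lower-order term only. -/
lemma Accurate.wvar_pTilde_le (hD : Accurate M D L) (hL : 0 ≤ L) (h : Fin H) (s : Fin S)
    (a : Fin A) {V : Fin S → ℝ} {c : ℝ} (hV : ∀ s, |V s| ≤ c) :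
    wvar (pTilde D h s a) V
      ≤ 2 * wvar (M.P h s a) V + 32 * S * c ^ 2 * (L * invVisits D h s a) := by
  have hy : 0 ≤ L * invVisits D h s a := mul_nonneg hL (invVisits_pos D h s a).le
  by_cases hn : visits D h s a = 0
  · have : wvar (pTilde D h s a) V = 0 := by simp [wvar, pTilde_eq_zero D hn]
    rw [this]
    have := wvar_nonneg (u := V) (M.P_nonneg h s a)
    positivity
  · have h1 := sum_mul_sub_sq (u := V) (sum_pTilde D hn) (∑ s', M.P h s a s' * V s')
    have h2 : wvar (pTilde D h s a) V
        ≤ ∑ s', pTilde D h s a s' * (V s' - ∑ s', M.P h s a s' * V s') ^ 2 := by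
      rw [h1]; linarith [sq_nonneg (∑ s', pTilde D h s a s' * V s' - ∑ s', M.P h s a s' * V s')]
    refine h2.trans ?_
    have h3 : ∀ s', (V s' - ∑ s', M.P h s a s' * V s') ^ 2 ≤ 4 * c ^ 2 := by
      intro s'
      have h4 := abs_le.1 (hV s')
      have h5 := M.sum_P_mul_le (h := h) (s := s) (a := a) fun s' => (abs_le.1 (hV s')).2
      have h6 := M.le_sum_P_mul (h := h) (s := s) (a := a) fun s' => (abs_le.1 (hV s')).1
      have h7 := abs_le_of_sq_le_sq' (a := V s' - ∑ s', M.P h s a s' * V s') (b := 2 * c)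
      nlinarith
    calc ∑ s', pTilde D h s a s' * (V s' - ∑ s', M.P h s a s' * V s') ^ 2
        ≤ ∑ s', (2 * (M.P h s a s' * (V s' - ∑ s', M.P h s a s' * V s') ^ 2)
            + 32 * c ^ 2 * (L * invVisits D h s a)) := by
          refine Finset.sum_le_sum fun s' _ => ?_
          have h8 := mul_le_mul_of_nonneg_right (hD.pTilde_le hL h s a s')
            (sq_nonneg (V s' - ∑ s', M.P h s a s' * V s'))
          have h9 := mul_le_mul_of_nonneg_left (h3 s') (mul_nonneg (by norm_num : (0:ℝ) ≤ 8) hy)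
          nlinarith
      _ = _ := by
          rw [Finset.sum_add_distrib, ← Finset.mul_sum, Finset.sum_const, Finset.card_univ,
            Fintype.card_fin, nsmul_eq_mul, wvar]
          ring

/-- For functions that may depend on the data, as `V̄ - V*` does: entrywise bounds combined by
Cauchy-Schwarz, hence the `S` next to the variance. -/
lemma Accurate.abs_sum_sub_le (hD : Accurate M D L) (hL : 1 ≤ L) (hS : 0 < S) (h : Fin H)
    (s : Fin S) (a : Fin A) {V : Fin S → ℝ} {c : ℝ} (hV : ∀ s, |V s| ≤ c) :
    |∑ s', pTilde D h s a s' * V s' - ∑ s', M.P h s a s' * V s'|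
      ≤ 4 * Real.sqrt (wvar (M.P h s a) V * (S * (L * invVisits D h s a)))
        + 8 * S * c * (L * invVisits D h s a) := by
  have hx := invVisits_pos D h s a
  set y := L * invVisits D h s a with hy
  have hy0 : 0 ≤ y := mul_nonneg (by linarith) hx.le
  have hS1 : (1 : ℝ) ≤ S := by exact_mod_cast hS
  set m := ∑ s', M.P h s a s' * V s' with hm
  have hmc : |m| ≤ c := abs_le.2
      ⟨M.le_sum_P_mul fun s' => (abs_le.1 (hV s')).1, M.sum_P_mul_le fun s' => (abs_le.1 (hV s')).2⟩
  have hc : 0 ≤ c := (abs_nonneg _).trans hmc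
  by_cases hn : visits D h s a = 0
  · simp only [pTilde_eq_zero D hn, zero_mul, Finset.sum_const_zero, zero_sub, abs_neg]
    have h1 : 1 ≤ y := by rw [hy, invVisits_eq_one D hn]; linarith
    have h2 : c ≤ S * c * y := by nlinarith [mul_nonneg hc (sub_nonneg.2 hS1)]
    have h3 := Real.sqrt_nonneg (wvar (M.P h s a) V * (S * y))
    nlinarith
  -- Both weights have mass one, so `V` may be centered at its true mean; this makes the variance
  -- appear.
  · have e : ∑ s', pTilde D h s a s' * V s' - m
        = ∑ s', (pTilde D h s a s' - M.P h s a s') * (V s' - m) := by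
      simp only [sub_mul, mul_sub, Finset.sum_sub_distrib, ← Finset.sum_mul, sum_pTilde D hn,
        M.P_sum]
      rw [← hm]; ring
    rw [e]
    have hb : ∀ s', |V s' - m| ≤ 2 * c := fun s' =>
      (abs_sub _ _).trans (by linarith [hV s'])
    calc |∑ s', (pTilde D h s a s' - M.P h s a s') * (V s' - m)|
        ≤ ∑ s', (4 * Real.sqrt y * (Real.sqrt (M.P h s a s') * |V s' - m|) + 8 * c * y) := by
          refine (Finset.abs_sum_le_sum_abs _ _).trans (Finset.sum_le_sum fun s' _ => ?_)
          rw [abs_mul]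
          have h1 := mul_le_mul_of_nonneg_right (hD.trans h s a s') (abs_nonneg (V s' - m))
          rw [Real.sqrt_mul (M.P_nonneg h s a s')] at h1
          have h2 := mul_le_mul_of_nonneg_left (hb s') (mul_nonneg (by norm_num : (0:ℝ) ≤ 4) hy0)
          nlinarith
      _ = 4 * (Real.sqrt y * ∑ s', Real.sqrt (M.P h s a s') * |V s' - m|) + 8 * S * c * y := by
          rw [Finset.sum_add_distrib, ← Finset.mul_sum, Finset.sum_const, Finset.card_univ,
            Fintype.card_fin, nsmul_eq_mul]
          ring
      _ ≤ _ := by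
          gcongr
          have h4 : (∑ s', Real.sqrt (M.P h s a s') * |V s' - m|) ^ 2
              ≤ S * wvar (M.P h s a) V := by
            have h5 := sq_sum_le_card_mul_sum_sq (s := Finset.univ)
              (f := fun s' => Real.sqrt (M.P h s a s') * |V s' - m|)
            rw [Finset.card_univ, Fintype.card_fin] at h5
            refine h5.trans_eq ?_
            congr 1
            refine Finset.sum_congr rfl fun s' _ => ?_
            rw [mul_pow, Real.sq_sqrt (M.P_nonneg h s a s'), sq_abs]
          refine Real.le_sqrt_of_sq_le ?_
          rw [mul_pow, Real.sq_sqrt hy0]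
          nlinarith

/-- The part of the confidence width that does not depend on the perturbed values. -/
def bonus (M : MDP H S A) (D : History H S A k) (L B θ : ℝ) (h : Fin H) (s : Fin S) (a : Fin A) :
    ℝ :=
  12 * B * L * θ * (1 + wvar (M.P h s a) (M.optValue h.succ))
    + (24 * B / θ + 14544 * B ^ 2 * L * S * H) * invVisits D h s a

/-- Confidence width for the Bellman residual of `V`. -/
def width (M : MDP H S A) (D : History H S A k) (L B θ : ℝ) (V : Fin (H + 1) → Fin S → ℝ)
    (h : Fin H) (s : Fin S) (a : Fin A) : ℝ :=
  bonus M D L B θ h s a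
    + 1 / (100 * H) * wvar (M.P h s a) (fun s' => V h.succ s' - M.optValue h.succ s')

lemma bonus_nonneg {B θ : ℝ} (hL : 0 ≤ L) (hB : 0 ≤ B) (hθ : 0 ≤ θ) (h : Fin H) (s : Fin S)
    (a : Fin A) : 0 ≤ bonus M D L B θ h s a := by
  have h1 := wvar_nonneg (u := M.optValue h.succ) (M.P_nonneg h s a)
  have h2 := invVisits_pos D h s a
  unfold bonus
  positivity

lemma width_nonneg {B θ : ℝ} (hL : 0 ≤ L) (hB : 0 ≤ B) (hθ : 0 ≤ θ)
    (V : Fin (H + 1) → Fin S → ℝ) (h : Fin H) (s : Fin S)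
    (a : Fin A) : 0 ≤ width M D L B θ V h s a := by
  have h1 := wvar_nonneg (u := fun s' => V h.succ s' - M.optValue h.succ s') (M.P_nonneg h s a)
  have h2 := bonus_nonneg (M := M) (D := D) hL hB hθ h s a
  unfold width
  positivity

lemma sqrt_noise_le {S H y t vs vd w : ℝ} (hS : 1 ≤ S) (hH : 0 ≤ H) (hy : 0 ≤ y) (hvs : 0 ≤ vs)
    (hvd : 0 ≤ vd) (hw0 : 0 ≤ w) (ht : t ≤ y)
    (hw : w ≤ 4 * vs + 4 * vd + 128 * S * H ^ 2 * y) :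
    Real.sqrt (16 * w * t)
      ≤ 8 * Real.sqrt (vs * y) + 8 * Real.sqrt (vd * (S * y)) + 46 * S * H * y := by
  have e1 : ∀ u : ℝ, Real.sqrt (64 * u) = 8 * Real.sqrt u := fun u => by
    rw [Real.sqrt_mul (by norm_num), show (64 : ℝ) = 8 ^ 2 by norm_num,
      Real.sqrt_sq (by norm_num)]
  -- The constant 46 comes from `16 * 128 = 2048 ≤ 46 ^ 2`.
  have h1 : 16 * w * t ≤ (64 * (vs * y) + 64 * (vd * (S * y))) + (46 * S * H * y) ^ 2 := by
    have h2 : 16 * w * t ≤ 16 * w * y := by gcongr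
    have h4 : 16 * w * y ≤ 16 * (4 * vs + 4 * vd + 128 * S * H ^ 2 * y) * y := by gcongr
    have h5 : vd * y ≤ S * (vd * y) := le_mul_of_one_le_left (by positivity) hS
    have h6 : S * (H ^ 2 * y ^ 2) ≤ S * (S * (H ^ 2 * y ^ 2)) :=
      le_mul_of_one_le_left (by positivity) hS
    have h7 : 0 ≤ S * (S * (H ^ 2 * y ^ 2)) := by positivity
    linarith
  have h8 : 0 ≤ 64 * (vs * y) := by positivity
  have h9 : 0 ≤ 64 * (vd * (S * y)) := by positivity
  have h10 := sqrt_add_le h8 h9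
  have h11 := sqrt_add_le (add_nonneg h8 h9) (sq_nonneg (46 * S * H * y))
  rw [Real.sqrt_sq (by positivity)] at h11
  rw [e1, e1] at h10
  linarith [Real.sqrt_le_sqrt h1]

/-- Adds the five parts of the residual: reward, value of `V*`, value of `V - V*`, noise, shrinkage.
The linear terms sum to `3 + 4 + 24 + (46 + 65) + 2 = 144`. -/
lemma residual_sum_le {B S H y q₀ q₁ q₂ r v d n m : ℝ} (hB : 1 ≤ B) (hS : 1 ≤ S) (hH : 1 ≤ H)
    (hy : 0 ≤ y) (h₀ : 0 ≤ q₀) (h₁ : 0 ≤ q₁) (h₂ : 0 ≤ q₂) (hr : r ≤ 3 * (q₀ + y))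
    (hv : v ≤ 4 * (q₁ + H * y)) (hd : d ≤ 4 * q₂ + 8 * S * (3 * H) * y)
    (hn : n ≤ B * (8 * q₁ + 8 * q₂ + 46 * S * H * y + 65 * H * y + q₀)) (hm : m ≤ y * (2 * H)) :
    r + v + d + n + m ≤ B * (4 * q₀ + 12 * q₁ + 12 * q₂ + 144 * S * H * y) := by
  have a1 : q₀ ≤ B * q₀ := le_mul_of_one_le_left h₀ hB
  have a2 : q₁ ≤ B * q₁ := le_mul_of_one_le_left h₁ hB
  have a3 : q₂ ≤ B * q₂ := le_mul_of_one_le_left h₂ hB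
  have a4 : y ≤ H * y := le_mul_of_one_le_left hy hH
  have a5 : H * y ≤ S * (H * y) := le_mul_of_one_le_left (by positivity) hS
  have a6 : S * (H * y) ≤ B * (S * (H * y)) := le_mul_of_one_le_left (by positivity) hB
  have a7 : B * (H * y) ≤ B * (S * (H * y)) := by gcongr
  linarith

lemma width_sum_le {B θ L S H x y vs vd q₀ q₁ q₂ : ℝ} (hB : 1 ≤ B) (hθ : 0 < θ) (hL : 0 < L)
    (hS : 0 < S) (hH : 0 < H) (hx : 0 < x) (hy : y = L * x)
    (h₀ : q₀ ≤ θ * L * 1 + x / θ) (h₁ : q₁ ≤ θ * L * vs + x / θ)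
    (h₂ : 12 * B * q₂ ≤ 1 / (100 * H) * vd + 14400 * B ^ 2 * L * S * H * x) :
    B * (4 * q₀ + 12 * q₁ + 12 * q₂ + 144 * S * H * y)
      ≤ 12 * B * L * θ * (1 + vs) + (24 * B / θ + 14544 * B ^ 2 * L * S * H) * x
        + 1 / (100 * H) * vd := by
  have g4 : B * (144 * S * H * y) ≤ 144 * B ^ 2 * L * S * H * x := by
    have : B ≤ B ^ 2 := by nlinarith
    calc B * (144 * S * H * y) = B * (144 * L * S * H * x) := by rw [hy]; ring
      _ ≤ B ^ 2 * (144 * L * S * H * x) := by gcongr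
      _ = _ := by ring
  have g7 := mul_le_mul_of_nonneg_left h₀ (show 0 ≤ 4 * B by positivity)
  have g8 := mul_le_mul_of_nonneg_left h₁ (show 0 ≤ 12 * B by positivity)
  have e9 : 24 * B / θ * x = 24 * (B * (x / θ)) := by ring
  have g10 : 0 ≤ B * (θ * L * 1) := by positivity
  have g11 : 0 ≤ B * (x / θ) := by positivity
  rw [add_mul, e9]
  linarith

/-- Splitting `V = V* + (V - V*)` confines the factor `S` to the second part. AM-GM then makes each
square root linear in the variances and in `x`, the form that can be summed along trajectories. -/
lemma Accurate.abs_residual_le [Nonempty (Fin A)] (hD : Accurate M D L) (hL : 1 ≤ L)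
    (hlog : logFactor H S A k ≤ L) (hlog0 : 0 ≤ logFactor H S A k) {B θ z : ℝ} (hB : 1 ≤ B)
    (hθ : 0 < θ) (hz : |z| ≤ B) {V : Fin (H + 1) → Fin S → ℝ} (h : Fin H)
    (hV : ∀ s, |V h.succ s| ≤ 2 * H) (s : Fin S) (a : Fin A) :
    |qStep D z h (V h.succ) s a - M.R h s a - ∑ s', M.P h s a s' * V h.succ s'|
      ≤ width M D L B θ V h s a := by
  have hS : 0 < S := s.pos
  have hH : 0 < H := h.pos
  have hS1 : (1 : ℝ) ≤ S := by exact_mod_cast hS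
  have hH1 : (1 : ℝ) ≤ H := by exact_mod_cast hH
  have hx := invVisits_pos D h s a
  have hx1 := invVisits_le_one D h s a
  set x := invVisits D h s a with hxdef
  set y := L * x with hy
  have hy0 : 0 ≤ y := by positivity
  have hxy : x ≤ y := by nlinarith
  set U := M.optValue h.succ with hU
  set E : Fin S → ℝ := fun s' => V h.succ s' - U s' with hE
  set vs := wvar (M.P h s a) U with hvs
  set vd := wvar (M.P h s a) E with hvd
  have hvs0 : 0 ≤ vs := wvar_nonneg (M.P_nonneg h s a)
  have hvd0 : 0 ≤ vd := wvar_nonneg (M.P_nonneg h s a)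
  have hEb : ∀ s', |E s'| ≤ 3 * H := fun s' => by
    have h1 := abs_le.1 (hV s')
    have h2 := M.optValue_nonneg h.succ s'
    have h3 := M.optValue_le h.succ s'
    rw [abs_le]
    constructor <;> simp only [hE, hU] <;> linarith
  have hr := hD.reward h s a
  have hv := hD.value h s a
  have hd := hD.abs_sum_sub_le hL hS h s a hEb
  rw [← hxdef, ← hy] at hr hv hd
  have hhat : ∑ s', pHat D h s a s' * V h.succ s'
      = (1 - x) * ∑ s', pTilde D h s a s' * V h.succ s' := by
    rw [Finset.mul_sum]
    exact Finset.sum_congr rfl fun s' _ => by rw [pHat_eq, mul_assoc]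
  have hsplit : ∀ p : Fin S → ℝ, ∑ s', p s' * V h.succ s'
      = ∑ s', p s' * U s' + ∑ s', p s' * E s' := fun p => by
    rw [← Finset.sum_add_distrib]
    exact Finset.sum_congr rfl fun s' _ => by simp only [hE]; ring
  have hmass : |∑ s', pTilde D h s a s' * V h.succ s'| ≤ 2 * H := by
    by_cases hn : visits D h s a = 0
    · simp [pTilde_eq_zero D hn]
    · calc |∑ s', pTilde D h s a s' * V h.succ s'|
          ≤ ∑ s', pTilde D h s a s' * (2 * H) := by
            refine (Finset.abs_sum_le_sum_abs _ _).trans (Finset.sum_le_sum fun s' _ => ?_)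
            rw [abs_mul, abs_of_nonneg (pTilde_nonneg D h s a s')]
            exact mul_le_mul_of_nonneg_left (hV s') (pTilde_nonneg D h s a s')
        _ = 2 * H := by rw [← Finset.sum_mul, sum_pTilde D hn, one_mul]
  have hw := hD.wvar_pTilde_le (by linarith) h s a hV
  rw [← hxdef, ← hy] at hw
  have hwV : wvar (M.P h s a) (V h.succ) ≤ 2 * vs + 2 * vd := by
    have : V h.succ = fun s' => U s' + E s' := by ext s'; simp [hE]
    rw [this]
    exact wvar_add_le (M.P_nonneg h s a) U E
  set wt := wvar (pTilde D h s a) (V h.succ) with hwt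
  have hwt0 : 0 ≤ wt := wvar_nonneg (pTilde_nonneg D h s a)
  have hly : logFactor H S A k * x ≤ y := mul_le_mul_of_nonneg_right hlog hx.le
  have hly0 : 0 ≤ logFactor H S A k * x := by positivity
  have hs1 : Real.sqrt (16 * wt * (logFactor H S A k * x))
      ≤ 8 * Real.sqrt (vs * y) + 8 * Real.sqrt (vd * (S * y)) + 46 * S * H * y := by
    refine sqrt_noise_le hS1 (by linarith) hy0 hvs0 hvd0 hwt0 hly ?_
    calc wt ≤ 2 * wvar (M.P h s a) (V h.succ) + 32 * S * (2 * H) ^ 2 * y := hw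
      _ ≤ _ := by linarith
  have hsig : |sigmaBe D h s a (V h.succ) * z|
      ≤ B * (8 * Real.sqrt (vs * y) + 8 * Real.sqrt (vd * (S * y)) + 46 * S * H * y
        + 65 * H * y + Real.sqrt y) := by
    have h1 : sigmaBe D h s a (V h.succ)
        ≤ 8 * Real.sqrt (vs * y) + 8 * Real.sqrt (vd * (S * y)) + 46 * S * H * y
        + 65 * H * y + Real.sqrt y := by
      rw [sigmaBe_eq]
      have h2 := Real.sqrt_le_sqrt hly
      have h3 : 65 * H * (logFactor H S A k * x) ≤ 65 * H * y := by gcongr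
      linarith
    have h0 : 0 ≤ sigmaBe D h s a (V h.succ) := by
      rw [sigmaBe_eq]; positivity
    rw [abs_mul, abs_of_nonneg h0, mul_comm]
    gcongr
  have htot : |qStep D z h (V h.succ) s a - M.R h s a - ∑ s', M.P h s a s' * V h.succ s'|
      ≤ B * (4 * Real.sqrt (1 * y) + 12 * Real.sqrt (vs * y) + 12 * Real.sqrt (vd * (S * y))
        + 144 * S * H * y) := by
    have e : qStep D z h (V h.succ) s a - M.R h s a - ∑ s', M.P h s a s' * V h.succ s'
        = (rHat D h s a - M.R h s a)
          + (∑ s', pTilde D h s a s' * U s' - ∑ s', M.P h s a s' * U s')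
          + (∑ s', pTilde D h s a s' * E s' - ∑ s', M.P h s a s' * E s')
          + (sigmaBe D h s a (V h.succ) * z)
          + (- (x * ∑ s', pTilde D h s a s' * V h.succ s')) := by
      unfold qStep
      rw [hhat, hsplit (M.P h s a), sub_mul, one_mul, hsplit (pTilde D h s a)]
      ring
    rw [e]
    have h5 : |-(x * ∑ s', pTilde D h s a s' * V h.succ s')| ≤ y * (2 * H) := by
      rw [abs_neg, abs_mul, abs_of_pos hx]
      gcongr
    refine (abs_add_le _ _).trans ?_
    refine (add_le_add (abs_add_le _ _) le_rfl).trans ?_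
    refine (add_le_add (add_le_add (abs_add_le _ _) le_rfl) le_rfl).trans ?_
    refine (add_le_add (add_le_add (add_le_add (abs_add_le _ _) le_rfl) le_rfl) le_rfl).trans ?_
    rw [one_mul]
    exact residual_sum_le hB hS1 hH1 hy0 (Real.sqrt_nonneg _) (Real.sqrt_nonneg _)
      (Real.sqrt_nonneg _) hr hv hd hsig h5
  refine htot.trans ?_
  have g1 : Real.sqrt (1 * y) ≤ θ * L * 1 + x / θ := by
    have := sqrt_mul_le (τ := θ * L) (by positivity) zero_le_one hy0
    rwa [hy, mul_comm θ L, mul_div_mul_left _ _ (by positivity : L ≠ 0), mul_comm L θ] at this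
  have g2 : Real.sqrt (vs * y) ≤ θ * L * vs + x / θ := by
    have := sqrt_mul_le (τ := θ * L) (by positivity) hvs0 hy0
    rwa [hy, mul_comm θ L, mul_div_mul_left _ _ (by positivity : L ≠ 0), mul_comm L θ] at this
  -- The AM-GM weight is chosen so that the variance of `V - V*` receives exactly the coefficient `1
  -- / (100 * H)`; the rest is `12 * 1200 = 14400`.
  have g3 : 12 * B * Real.sqrt (vd * (S * y))
      ≤ 1 / (100 * H) * vd + 14400 * B ^ 2 * L * S * H * x := by
    have := sqrt_mul_le (τ := 1 / (1200 * B * H)) (by positivity) hvd0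
      (v := S * y) (by positivity)
    have h2 := mul_le_mul_of_nonneg_left this (show 0 ≤ 12 * B by positivity)
    refine h2.trans_eq ?_
    rw [hy]
    field_simp
    ring
  exact width_sum_le hB hθ (by linarith) (by linarith) (by linarith) hx hy g1 g2 g3

end Episode

/-! ### Optimism under a large common seed -/

section Optimism

/-- A seed of size at least `4 c` compensates the estimation error. -/
lemma optimism_inequality {c z x y t H r R e₁ e₂ E w₁ w₂ v : ℝ} (hc : 1 ≤ c) (hz : 4 * c ≤ z)
    (hx0 : 0 ≤ x) (hx : x ≤ 1 / 2) (hxy : x ≤ 2 * y) (ht0 : 0 ≤ t) (ht : t ≤ c * y)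
    (hH : 1 ≤ H) (hE : 0 ≤ E) (hw₁ : 0 ≤ w₁) (hw₂ : 0 ≤ w₂) (hw : w₁ ≤ w₂ + 2 * H * E)
    (hv : v ≤ 4 * w₁ + 64 * H ^ 2 * t) (he : |e₁ - e₂| ≤ 4 * (Real.sqrt (v * t) + H * t))
    (hr : |r - R| ≤ 3 * (Real.sqrt t + t)) (he₁ : e₁ ≤ H) :
    R + e₂ ≤ r + (1 - x) * (e₁ + E) + (Real.sqrt (16 * w₂ * y) + 65 * H * y + Real.sqrt y) * z := by
  have hy : 0 ≤ y := by linarith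
  have hz0 : 0 ≤ z := by linarith
  have hc0 : 0 ≤ c := by linarith
  set q := Real.sqrt y with hq
  set s₁ := Real.sqrt w₁ with hs₁
  set s₂ := Real.sqrt w₂ with hs₂
  set g := Real.sqrt z with hg
  set e := Real.sqrt c with he'
  have q0 : 0 ≤ q := Real.sqrt_nonneg _
  have s10 : 0 ≤ s₁ := Real.sqrt_nonneg _
  have s20 : 0 ≤ s₂ := Real.sqrt_nonneg _
  have g0 : 0 ≤ g := Real.sqrt_nonneg _
  have e1 : 1 ≤ e := Real.one_le_sqrt.2 hc
  have qq : q ^ 2 = y := Real.sq_sqrt hy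
  have ss1 : s₁ ^ 2 = w₁ := Real.sq_sqrt hw₁
  have ss2 : s₂ ^ 2 = w₂ := Real.sq_sqrt hw₂
  have gg : g ^ 2 = z := Real.sq_sqrt hz0
  have ee : e ^ 2 = c := Real.sq_sqrt hc0
  -- This is where `z ≥ 4 c` enters. The estimation error scales with `√c` and the noise with `z`;
  -- `√z` serves as an intermediate scale.
  have hge : 2 * e ≤ g := by
    refine abs_le_of_sq_le_sq' ?_ g0 |>.2
    nlinarith
  have a1 : Real.sqrt (16 * w₂ * y) = 4 * s₂ * q := by
    rw [Real.sqrt_mul (by positivity), Real.sqrt_mul (by norm_num), show (16 : ℝ) = 4 ^ 2 by norm_num,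
      Real.sqrt_sq (by norm_num)]
  have a2 : Real.sqrt t ≤ e * q := by
    rw [he', hq, ← Real.sqrt_mul hc0]; exact Real.sqrt_le_sqrt ht
  have a3 : Real.sqrt (v * t) ≤ 2 * s₁ * e * q + 8 * H * c * y := by
    refine Real.sqrt_le_iff.2 ⟨by positivity, ?_⟩
    have b1 : v * t ≤ (4 * w₁ + 64 * H ^ 2 * t) * t := by gcongr
    have b2 : (4 * w₁ + 64 * H ^ 2 * t) * t ≤ (4 * w₁ + 64 * H ^ 2 * (c * y)) * (c * y) := by
      gcongr
    have b3 : (2 * s₁ * e * q + 8 * H * c * y) ^ 2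
        = 4 * s₁ ^ 2 * (e ^ 2 * q ^ 2) + 64 * H ^ 2 * (c * y) * (c * y)
          + 2 * (2 * s₁ * e * q) * (8 * H * c * y) := by ring
    have b4 : 0 ≤ 2 * (2 * s₁ * e * q) * (8 * H * c * y) := by positivity
    rw [ss1, ee, qq] at b3
    linarith
  -- Replacing the variance of `V*` by that of the optimistic values costs half of `E`, the optimism
  -- already present at the next stage. The shrinkage costs at most the other half (`c7`), so the
  -- gain `E` is enough.
  have a4 : 4 * g * q * s₁ ≤ 4 * g * q * s₂ + (E / 2 + 16 * z * y * H) := by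
    have b1 : s₁ ≤ s₂ + Real.sqrt (2 * H * E) :=
      (Real.sqrt_le_sqrt hw).trans (sqrt_add_le hw₂ (by positivity))
    have b2 : 4 * g * q * Real.sqrt (2 * H * E) ≤ E / 2 + 16 * z * y * H := by
      refine abs_le_of_sq_le_sq' ?_ (by positivity) |>.2
      rw [mul_pow, Real.sq_sqrt (by positivity)]
      have b3 : (4 * g * q) ^ 2 = 16 * z * y := by rw [mul_pow, mul_pow, gg, qq]; ring
      rw [b3]
      nlinarith [sq_nonneg (E / 2 - 16 * z * y * H)]
    have b4 : 4 * g * q * s₁ ≤ 4 * g * q * (s₂ + Real.sqrt (2 * H * E)) := by gcongr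
    linarith
  have c1 := (abs_le.1 he).1
  have c2 := (abs_le.1 hr).1
  have c3 : 8 * e * q * s₁ ≤ 4 * g * q * s₁ := by
    have h := mul_le_mul_of_nonneg_right hge (mul_nonneg q0 s10)
    linarith
  have hgz : g ≤ z := by
    have h := le_mul_of_one_le_left g0 (show 1 ≤ g by linarith)
    rwa [← sq, gg] at h
  have c4 : 4 * g * q * s₂ ≤ 4 * z * q * s₂ := by gcongr
  have c5 : 3 * (e * q) ≤ z * q := by
    have h := le_mul_of_one_le_left (zero_le_one.trans e1) e1
    rw [← sq, ee] at h
    have h' := mul_le_mul_of_nonneg_right (show 3 * e ≤ z by linarith) q0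
    linarith
  have c6 : x * e₁ ≤ 2 * (H * y) := by
    have d1 : x * e₁ ≤ x * H := by gcongr
    have d2 : x * H ≤ 2 * y * H := by gcongr
    linarith
  have c7 : x * E ≤ E / 2 := by
    have h := mul_le_mul_of_nonneg_right hx hE
    linarith
  have c8 : H * t ≤ H * (c * y) := by gcongr
  have c9 : c * y ≤ H * (c * y) := le_mul_of_one_le_left (by positivity) hH
  have c10 : H * y ≤ c * (H * y) := le_mul_of_one_le_left (by positivity) hc
  have c11 : 4 * c * (H * y) ≤ z * (H * y) := by gcongr
  rw [a1]
  have c12 : 0 ≤ H * y := by positivity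
  linarith

variable {H S A k : ℕ} {M : MDP H S A} {D : History H S A k} {L : ℝ} [Nonempty (Fin A)]

lemma Accurate.le_qStep (hD : Accurate M D L) {c z : ℝ} (hL : 1 ≤ L)
    (hc : 1 ≤ c) (hlog : L ≤ c * logFactor H S A k) (hlog0 : 1 / 2 ≤ logFactor H S A k)
    (hz : 4 * c ≤ z) {h : Fin H} {V : Fin S → ℝ} (hV : ∀ s, M.optValue h.succ s ≤ V s)
    (s : Fin S) (a : Fin A) :
    M.R h s a + ∑ s', M.P h s a s' * M.optValue h.succ s' ≤ qStep D z h V s a := by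
  have hH1 : (1 : ℝ) ≤ H := by exact_mod_cast h.pos
  -- Without data all empirical terms vanish, and the noise term `65 * H * logFactor` alone exceeds
  -- the largest possible value `H`. With data, the shrinkage `x` is at most one half.
  by_cases hn : visits D h s a = 0
  · have h1 := M.le_optValue h s a
    have h2 := M.optValue_le h.castSucc s
    have h3 : rHat D h s a = 0 := by
      have : ∀ l, ¬ ((D l h).state = s ∧ (D l h).action = a) := by
        intro l hl
        have h4 := Finset.sum_eq_zero_iff.1 hn l (Finset.mem_univ _)
        simp [hl] at h4
      simp [rHat, this]
    have h4 : sigmaBe D h s a V = 65 * H * logFactor H S A k + Real.sqrt (logFactor H S A k) := by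
      rw [sigmaBe_eq, invVisits_eq_one D hn]
      simp [wvar, pTilde_eq_zero D hn]
    have h5 : ∑ s', pHat D h s a s' * V s' = 0 := by
      simp [pHat_eq, pTilde_eq_zero D hn]
    rw [qStep, h3, h4, h5]
    have h6 := Real.sqrt_nonneg (logFactor H S A k)
    have h7 : (H : ℝ) ≤ 65 * H * logFactor H S A k := by nlinarith
    have h8 : (1 : ℝ) ≤ z := by linarith
    nlinarith
  · have hx := invVisits_pos D h s a
    set x := invVisits D h s a with hxdef
    set U := M.optValue h.succ
    have h1 : qStep D z h V s a = rHat D h s a + (1 - x) * (∑ s', pTilde D h s a s' * U s'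
        + ∑ s', pTilde D h s a s' * (V s' - U s'))
        + (Real.sqrt (16 * wvar (pTilde D h s a) V * (logFactor H S A k * x))
          + 65 * H * (logFactor H S A k * x) + Real.sqrt (logFactor H S A k * x)) * z := by
      rw [qStep, sigmaBe_eq]
      congr 2
      rw [← Finset.sum_add_distrib, Finset.mul_sum]
      exact Finset.sum_congr rfl fun s' _ => by rw [pHat_eq]; ring
    rw [h1]
    have hp := pTilde_nonneg D h s a
    have hU : ∀ s', 0 ≤ U s' ∧ U s' ≤ H := fun s' =>
      ⟨M.optValue_nonneg _ s', M.optValue_le _ s'⟩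
    refine optimism_inequality hc hz hx.le (invVisits_le_half D hn) ?_ (t := L * x)
      (by positivity) ?_ hH1 ?_ (wvar_nonneg hp) (wvar_nonneg hp)
      (wvar_le_add_mean_sub hp (sum_pTilde D hn) hU hV) (hD.variance h s a)
      (hD.value h s a) (hD.reward h s a) ?_
    · nlinarith
    · nlinarith
    · exact Finset.sum_nonneg fun s' _ => mul_nonneg (hp s') (by linarith [hV s'])
    · calc ∑ s', pTilde D h s a s' * U s' ≤ ∑ s', pTilde D h s a s' * H :=
          Finset.sum_le_sum fun s' _ => mul_le_mul_of_nonneg_left (hU s').2 (hp s')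
        _ = H := by rw [← Finset.sum_mul, sum_pTilde D hn, one_mul]

/-- Backward induction: optimism at the next stage is the input of `Accurate.le_qStep`. Clipping is
harmless because `V*` is at most half the clipping level. -/
lemma Accurate.optValue_le_vBar (hD : Accurate M D L) {c z : ℝ} (hL : 1 ≤ L)
    (hc : 1 ≤ c) (hlog : L ≤ c * logFactor H S A k) (hlog0 : 1 / 2 ≤ logFactor H S A k)
    (hz : 4 * c ≤ z) (i : Fin (H + 1)) : ∀ s, M.optValue i s ≤ vBar D z i s := by
  induction i using Fin.reverseInduction with
  | last => intro s; rw [vBar_last, M.optValue_last]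
  | cast h ih =>
    intro s
    rw [vBar_castSucc]
    obtain ⟨a, ha⟩ := M.exists_optValue_eq h s
    have h1 : M.optValue h.castSucc s ≤ ⨆ a, qBar D z h s a := by
      rw [ha]
      exact (hD.le_qStep hL hc hlog hlog0 hz ih s a).trans
        (le_ciSup (f := fun a => qBar D z h s a) (Set.finite_range _).bddAbove a)
    have h2 := (M.optValue_bounds h.castSucc s).2
    have h3 := (M.optValue_bounds h.castSucc s).1
    rw [Fin.val_castSucc] at h2
    exact le_max_of_le_right (le_min (by linarith) h1)

end Optimism

/-! ### From confidence widths to the regret of one seed -/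

section EpisodeRegret

variable {H S A k : ℕ} {M : MDP H S A} {D : History H S A k} {L B θ z : ℝ}

lemma MDP.sub_value_eq (U : Fin (H + 1) → Fin S → ℝ) (hU : ∀ s, U (Fin.last H) s = 0)
    (π : Policy H S A) :
    U 0 M.init - M.value π 0 M.init = M.expSum π (fun h s a =>
      (U h.castSucc s - ∑ s', M.P h s a s' * U h.succ s') - M.R h s a) := by
  rw [MDP.expSum_sub, MDP.expSum_telescope π U hU, MDP.value_eq_expSum]

/-- Hypotheses on the parameters that make the confidence widths valid. -/
structure WidthValid (M : MDP H S A) (D : History H S A k) (L B θ : ℝ) : Prop where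
  accurate : Accurate M D L
  one_le : 1 ≤ L
  log_le : logFactor H S A k ≤ L
  log_nonneg : 0 ≤ logFactor H S A k
  one_le_bound : 1 ≤ B
  pos : 0 < θ

lemma WidthValid.width_nonneg (hD : WidthValid M D L B θ) (V : Fin (H + 1) → Fin S → ℝ)
    (h : Fin H) (s : Fin S) (a : Fin A) : 0 ≤ width M D L B θ V h s a :=
  SSR.width_nonneg (by linarith [hD.one_le]) (by linarith [hD.one_le_bound]) hD.pos.le V h s a

variable [Nonempty (Fin A)]

/-- Holds for every action because the perturbed value maximizes over actions. If the upper clipping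
is active, the level `2 (H - h)` still exceeds `R + P V̄ ≤ 1 + 2 (H - h - 1)`, so clipping never
spoils the bound. -/
lemma WidthValid.neg_width_le (hD : WidthValid M D L B θ) (hz : |z| ≤ B) (h : Fin H)
    (s : Fin S) (a : Fin A) :
    - width M D L B θ (vBar D z) h s a
      ≤ vBar D z h.castSucc s - ∑ s', M.P h s a s' * vBar D z h.succ s' - M.R h s a := by
  have h1 := (abs_le.1 (hD.accurate.abs_residual_le hD.one_le hD.log_le hD.log_nonneg
    hD.one_le_bound hD.pos hz h (fun s => abs_vBar_le_two_mul D z h.succ s) s a)).1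
  have hw := hD.width_nonneg (vBar D z) h s a
  have h2 : ∑ s', M.P h s a s' * vBar D z h.succ s' ≤ 2 * ((H : ℝ) - ((h : ℕ) + 1)) := by
    refine M.sum_P_mul_le fun s' => ?_
    have := (abs_le.1 (abs_vBar_le D z h.succ s')).2
    simpa using this
  have h3 := M.R_le_one h s a
  have h4 : min (2 * ((H : ℝ) - (h : ℕ))) (qStep D z h (vBar D z h.succ) s a)
      ≤ vBar D z h.castSucc s := by
    rw [vBar_castSucc]
    refine le_max_of_le_right (min_le_min le_rfl ?_)
    exact le_ciSup (f := fun a => qBar D z h s a) (Set.finite_range _).bddAbove a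
  rcases min_choice (2 * ((H : ℝ) - (h : ℕ))) (qStep D z h (vBar D z h.succ) s a) with h5 | h5 <;>
    rw [h5] at h4 <;> linarith

/-- The reverse inequality is available only for the maximizing action. Lower clipping is harmless
for the symmetric reason: `P V̄ ≥ -2 (H - h - 1)` and rewards are nonnegative. -/
lemma WidthValid.le_width_greedy (hD : WidthValid M D L B θ) {sel : Selector H S A}
    (hsel : sel.IsArgmax) (hz : |z| ≤ B) (h : Fin H) (s : Fin S) :
    vBar D z h.castSucc s - ∑ s', M.P h s (greedy sel D z h s) s' * vBar D z h.succ s'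
        - M.R h s (greedy sel D z h s)
      ≤ width M D L B θ (vBar D z) h s (greedy sel D z h s) := by
  set a := greedy sel D z h s with ha
  have h1 := (abs_le.1 (hD.accurate.abs_residual_le hD.one_le hD.log_le hD.log_nonneg
    hD.one_le_bound hD.pos hz h (fun s => abs_vBar_le_two_mul D z h.succ s) s a)).2
  have hw := hD.width_nonneg (vBar D z) h s a
  have h2 : - (2 * ((H : ℝ) - ((h : ℕ) + 1))) ≤ ∑ s', M.P h s a s' * vBar D z h.succ s' := by
    refine M.le_sum_P_mul fun s' => ?_
    have := (abs_le.1 (abs_vBar_le D z h.succ s')).1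
    simpa using this
  have h3 := M.R_nonneg h s a
  have h4 : vBar D z h.castSucc s
      ≤ max (- (2 * ((H : ℝ) - (h : ℕ)))) (qStep D z h (vBar D z h.succ) s a) := by
    rw [vBar_castSucc, iSup_qBar_eq D hsel]
    exact max_le_max le_rfl (min_le_right _ _)
  rcases max_choice (- (2 * ((H : ℝ) - (h : ℕ)))) (qStep D z h (vBar D z h.succ) s a) with h5 | h5
    <;> rw [h5] at h4 <;> linarith

lemma WidthValid.vBar_sub_value_le (hD : WidthValid M D L B θ) {sel : Selector H S A}
    (hsel : sel.IsArgmax) (hz : |z| ≤ B) :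
    vBar D z 0 M.init - M.value (greedy sel D z) 0 M.init
      ≤ M.expSum (greedy sel D z) (width M D L B θ (vBar D z)) := by
  rw [MDP.sub_value_eq _ (vBar_last D z)]
  exact MDP.expSum_mono fun h s => hD.le_width_greedy hsel hz h s

/-- The policy is arbitrary so that the values of one seed can be compared with the greedy policy of
another. -/
lemma WidthValid.neg_le_vBar_sub_value (hD : WidthValid M D L B θ) (hz : |z| ≤ B)
    (π : Policy H S A) :
    - M.expSum π (width M D L B θ (vBar D z)) ≤ vBar D z 0 M.init - M.value π 0 M.init := by
  rw [MDP.sub_value_eq _ (vBar_last D z)]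
  have h1 := MDP.expSum_mul (M := M) π (-1) (width M D L B θ (vBar D z))
  rw [neg_one_mul] at h1
  rw [← h1]
  refine MDP.expSum_mono fun h s => ?_
  linarith [hD.neg_width_le hz h s (π h s)]

/-- A self-bounding inequality: the variance part of the width is controlled, through total
variance, by the Bellman residuals of `V̄ - V*`, and these by widths and regrets. -/
lemma WidthValid.expSum_width_le (hD : WidthValid M D L B θ) {sel : Selector H S A}
    (hsel : sel.IsArgmax) (hz : |z| ≤ B) (hH : 0 < H) (π : Policy H S A) :
    M.expSum π (width M D L B θ (vBar D z)) ≤ M.expSum π (bonus M D L B θ)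
      + 6 / 100 * (M.expSum (greedy sel D z) (width M D L B θ (vBar D z))
        + 2 * M.expSum π (width M D L B θ (vBar D z))
        + 2 * (M.optValue 0 M.init - M.value π 0 M.init)) := by
  have hH1 : (1 : ℝ) ≤ H := by exact_mod_cast hH
  set U : Fin (H + 1) → Fin S → ℝ := fun i s => vBar D z i s - M.optValue i s with hU
  have h1 : M.expSum π (width M D L B θ (vBar D z)) = M.expSum π (bonus M D L B θ)
      + 1 / (100 * H) * M.expSum π (fun h s a => wvar (M.P h s a) (U h.succ)) := by
    rw [← MDP.expSum_mul, ← MDP.expSum_add]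
    rfl
  have h2 := MDP.expSum_wvar_le (M := M) π U
    (fun s => by simp only [hU, vBar_last, M.optValue_last, sub_zero]) (c := 3 * H) (by
      intro i s
      have h3 := abs_le.1 (abs_vBar_le_two_mul D z i s)
      have h4 := M.optValue_nonneg i s
      have h5 := M.optValue_le i s
      simp only [hU]
      rw [abs_le]
      constructor <;> linarith)
  -- Relative to the reward, the residual of `V̄` is at least minus the width and that of `V*` is
  -- nonnegative. Adding twice the width to the first therefore removes the absolute values, and the
  -- sums telescope.
  have h3 : M.expSum π (fun h s a => |U h.castSucc s - ∑ s', M.P h s a s' * U h.succ s'|)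
      ≤ (vBar D z 0 M.init - M.value π 0 M.init)
        + 2 * M.expSum π (width M D L B θ (vBar D z))
        + (M.optValue 0 M.init - M.value π 0 M.init) := by
    rw [MDP.sub_value_eq _ (vBar_last D z), MDP.sub_value_eq _ M.optValue_last,
      ← MDP.expSum_mul, ← MDP.expSum_add, ← MDP.expSum_add]
    refine MDP.expSum_mono fun h s => ?_
    have h4 := hD.neg_width_le hz h s (π h s)
    have h5 := M.le_optValue h s (π h s)
    have h6 := hD.width_nonneg (vBar D z) h s (π h s)
    simp only [hU, mul_sub, Finset.sum_sub_distrib]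
    rw [abs_le]
    constructor <;> linarith
  have h4 := hD.vBar_sub_value_le hsel hz
  have h5 := M.value_le_optValue (greedy sel D z) 0 M.init
  -- `2 * (3 * H) / (100 * H) = 6 / 100`.
  have h6 : 1 / (100 * (H : ℝ)) * M.expSum π (fun h s a => wvar (M.P h s a) (U h.succ))
      ≤ 6 / 100 * M.expSum π
        (fun h s a => |U h.castSucc s - ∑ s', M.P h s a s' * U h.succ s'|) := by
    refine (mul_le_mul_of_nonneg_left h2 (by positivity)).trans_eq ?_
    field_simp
    ring
  linarith

/-- The comparison passes from the optimal value through `V̄` of the optimistic seed, the value of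
its greedy policy and `V̄` of the played seed. This leaves three unknown width sums; the three
self-bounding inequalities have small enough coefficients to eliminate them linearly. -/
lemma WidthValid.regret_le_bonus (hD : WidthValid M D L B θ) {sel : Selector H S A}
    (hsel : sel.IsArgmax) (hz : |z| ≤ B) (hH : 0 < H) {z' : ℝ} (hz' : |z'| ≤ B)
    (hopt : M.optValue 0 M.init ≤ vBar D z' 0 M.init) :
    M.optValue 0 M.init - M.value (greedy sel D z) 0 M.init
      ≤ 4 * (M.expSum (greedy sel D z) (bonus M D L B θ)
        + M.expSum (greedy sel D z') (bonus M D L B θ)) := by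
  have h1 := hD.vBar_sub_value_le hsel hz
  have h2 := hD.vBar_sub_value_le hsel hz'
  have h3 := hD.neg_le_vBar_sub_value hz (greedy sel D z')
  have h4 := hD.expSum_width_le hsel hz hH (greedy sel D z)
  have h5 := hD.expSum_width_le hsel hz hH (greedy sel D z')
  have h6 := hD.expSum_width_le hsel hz' hH (greedy sel D z')
  have h7 : ∀ z, 0 ≤ M.expSum (greedy sel D z) (bonus M D L B θ) := fun z =>
    MDP.expSum_nonneg fun h s => bonus_nonneg (by linarith [hD.one_le])
      (by linarith [hD.one_le_bound]) hD.pos.le h s _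
  have h8 := h7 z
  have h9 := h7 z'
  linarith

lemma WidthValid.expSum_bonus_le (hD : WidthValid M D L B θ) (hH : 0 < H) (π : Policy H S A) :
    M.expSum π (bonus M D L B θ) ≤ 36 * B * L * θ * H ^ 2
      + (24 * B / θ + 14544 * B ^ 2 * L * S * H) * M.expSum π (invVisits D) := by
  have hH1 : (1 : ℝ) ≤ H := by exact_mod_cast hH
  have h1 : M.expSum π (bonus M D L B θ)
      = 12 * B * L * θ * (H * 1 + M.expSum π (fun h s a => wvar (M.P h s a) (M.optValue h.succ)))
      + (24 * B / θ + 14544 * B ^ 2 * L * S * H) * M.expSum π (invVisits D) := by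
    rw [← MDP.expSum_const (M := M) π 1, ← MDP.expSum_add, ← MDP.expSum_mul, ← MDP.expSum_mul,
      ← MDP.expSum_add]
    rfl
  have h2 := MDP.expSum_wvar_optValue_le (M := M) π
  have h3 : (0 : ℝ) ≤ 12 * B * L * θ := by
    have := hD.one_le; have := hD.one_le_bound; have := hD.pos; positivity
  have h4 := mul_le_mul_of_nonneg_left
    (show H * 1 + M.expSum π (fun h s a => wvar (M.P h s a) (M.optValue h.succ)) ≤ 3 * H ^ 2 by
      nlinarith) h3
  linarith

end EpisodeRegret

/-! ### Measurability of the algorithm -/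

section Measurability

variable {H S A k : ℕ}

instance : MeasurableSpace (Obs S A) :=
  MeasurableSpace.comap (fun o => (o.state, o.action, o.reward, o.next)) inferInstance

lemma measurable_obs_tuple :
    Measurable fun o : Obs S A => (o.state, o.action, o.reward, o.next) :=
  comap_measurable _

lemma measurable_obs_iff {Ω : Type*} [MeasurableSpace Ω] {f : Ω → Obs S A} :
    Measurable f ↔
      Measurable fun ω => ((f ω).state, (f ω).action, (f ω).reward, (f ω).next) :=
  measurable_comap_iff

lemma measurable_state : Measurable (Obs.state : Obs S A → Fin S) := measurable_obs_tuple.fst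

lemma measurable_action : Measurable (Obs.action : Obs S A → Fin A) :=
  measurable_obs_tuple.snd.fst

lemma measurable_reward : Measurable (Obs.reward : Obs S A → ℝ) :=
  measurable_obs_tuple.snd.snd.fst

lemma measurable_next : Measurable (Obs.next : Obs S A → Fin S) :=
  measurable_obs_tuple.snd.snd.snd

lemma measurable_history_apply (l : Fin k) (h : Fin H) :
    Measurable fun D : History H S A k => D l h := by fun_prop

lemma measurableSet_visit (s : Fin S) (a : Fin A) :
    MeasurableSet {o : Obs S A | o.state = s ∧ o.action = a} :=
  (measurable_state (measurableSet_singleton s)).inter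
    (measurable_action (measurableSet_singleton a))

lemma measurableSet_transition (s : Fin S) (a : Fin A) (s' : Fin S) :
    MeasurableSet {o : Obs S A | o.state = s ∧ o.action = a ∧ o.next = s'} :=
  (measurable_state (measurableSet_singleton s)).inter
    ((measurable_action (measurableSet_singleton a)).inter
      (measurable_next (measurableSet_singleton s')))

lemma measurable_sum_history {F : Obs S A → ℝ} (hF : Measurable F) (h : Fin H) :
    Measurable fun D : History H S A k => ∑ l, F (D l h) :=
  Finset.measurable_sum _ fun l _ => hF.comp (measurable_history_apply l h)

lemma measurable_visits (h : Fin H) (s : Fin S) (a : Fin A) :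
    Measurable fun D : History H S A k => (visits D h s a : ℝ) := by
  simp only [visits, Nat.cast_sum, Nat.cast_ite, Nat.cast_one, Nat.cast_zero]
  exact measurable_sum_history (F := fun o => if o.state = s ∧ o.action = a then 1 else 0)
    (Measurable.ite (measurableSet_visit s a) measurable_const measurable_const) h

lemma measurable_transCount (h : Fin H) (s : Fin S) (a : Fin A) (s' : Fin S) :
    Measurable fun D : History H S A k => (transCount D h s a s' : ℝ) := by
  simp only [transCount, Nat.cast_sum, Nat.cast_ite, Nat.cast_one, Nat.cast_zero]
  exact measurable_sum_history
    (F := fun o => if o.state = s ∧ o.action = a ∧ o.next = s' then 1 else 0)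
    (Measurable.ite (measurableSet_transition s a s') measurable_const measurable_const) h

lemma measurable_rHat (h : Fin H) (s : Fin S) (a : Fin A) :
    Measurable fun D : History H S A k => rHat D h s a :=
  (measurable_sum_history (F := fun o => if o.state = s ∧ o.action = a then o.reward else 0)
    (Measurable.ite (measurableSet_visit s a) measurable_reward measurable_const) h).div
    ((measurable_visits h s a).add_const 1)

lemma measurable_pHat (h : Fin H) (s : Fin S) (a : Fin A) (s' : Fin S) :
    Measurable fun D : History H S A k => pHat D h s a s' :=
  (measurable_transCount h s a s').div ((measurable_visits h s a).add_const 1)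

lemma measurable_pTilde (h : Fin H) (s : Fin S) (a : Fin A) (s' : Fin S) :
    Measurable fun D : History H S A k => pTilde D h s a s' :=
  (measurable_transCount h s a s').div ((measurable_visits h s a).max measurable_const)

lemma measurable_invVisits (h : Fin H) (s : Fin S) (a : Fin A) :
    Measurable fun D : History H S A k => invVisits D h s a :=
  measurable_const.div ((measurable_visits h s a).add_const 1)

lemma measurable_qStep {V : History H S A k × ℝ → Fin S → ℝ}
    (hV : ∀ s, Measurable fun p => V p s) (h : Fin H) (s : Fin S) (a : Fin A) :
    Measurable fun p : History H S A k × ℝ => qStep p.1 p.2 h (V p) s a := by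
  have h1 : Measurable fun p : History H S A k × ℝ => rHat p.1 h s a :=
    (measurable_rHat h s a).comp measurable_fst
  have h2 : ∀ s', Measurable fun p : History H S A k × ℝ => pHat p.1 h s a s' := fun s' =>
    (measurable_pHat h s a s').comp measurable_fst
  have h3 : ∀ s', Measurable fun p : History H S A k × ℝ => pTilde p.1 h s a s' := fun s' =>
    (measurable_pTilde h s a s').comp measurable_fst
  have h4 : Measurable fun p : History H S A k × ℝ => (visits p.1 h s a : ℝ) :=
    (measurable_visits h s a).comp measurable_fst
  unfold qStep sigmaBe wvar
  fun_prop

lemma measurable_vBar (i : Fin (H + 1)) :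
    ∀ s, Measurable fun p : History H S A k × ℝ => vBar p.1 p.2 i s := by
  induction i using Fin.reverseInduction with
  | last => intro s; simp only [vBar_last]; exact measurable_const
  | cast h ih =>
    intro s
    simp only [vBar_castSucc, clip, qBar]
    exact measurable_const.max (measurable_const.min
      (Measurable.iSup fun a => measurable_qStep ih h s a))

lemma measurable_greedy {sel : Selector H S A} (hsel : sel.IsArgmax) :
    Measurable fun p : History H S A k × ℝ => greedy sel p.1 p.2 := by
  refine measurable_pi_iff.2 fun h => measurable_pi_iff.2 fun s => ?_
  refine (hsel k h s).1.comp (measurable_pi_iff.2 fun a => ?_)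
  exact measurable_qStep (measurable_vBar h.succ) h s a

lemma measurable_eval_comp {Ω ι β : Type*} {mΩ : MeasurableSpace Ω} [MeasurableSpace β]
    [Countable ι] [MeasurableSpace ι] [MeasurableSingletonClass ι] {f : Ω → ι → β} {g : Ω → ι}
    (hf : ∀ i, Measurable fun ω => f ω i) (hg : Measurable g) :
    Measurable fun ω => f ω (g ω) := by
  have h : Measurable fun p : ι × Ω => f p.2 p.1 :=
    measurable_from_prod_countable_right fun i => hf i
  exact h.comp (hg.prodMk measurable_id)

/-- The table of outcomes of an episode. -/
abbrev Table (H S A : ℕ) : Type := Fin H → Fin S → Fin A → ℝ × Fin S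

lemma path_zero (s₁ : Fin S) (π : Policy H S A) (y : Table H S A) : path s₁ π y 0 = s₁ := by
  simp [path]

lemma path_succ (s₁ : Fin S) (π : Policy H S A) (y : Table H S A) (h : Fin H) :
    path s₁ π y h.succ = (y h (path s₁ π y h.castSucc) (π h (path s₁ π y h.castSucc))).2 := by
  simp [path]

lemma measurable_step {Ω : Type*} {mΩ : MeasurableSpace Ω} {y : Ω → Fin S → Fin A → ℝ × Fin S}
    {f : Ω → Fin S} {π : Ω → Fin S → Fin A} (hy : Measurable y) (hf : Measurable f)
    (hπ : Measurable π) : Measurable fun ω => y ω (f ω) (π ω (f ω)) := by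
  have h1 : Measurable fun ω => y ω (f ω) :=
    measurable_eval_comp (fun i => (measurable_pi_apply i).comp hy) hf
  have h2 : Measurable fun ω => π ω (f ω) :=
    measurable_eval_comp (fun i => (measurable_pi_apply i).comp hπ) hf
  exact measurable_eval_comp (fun i => (measurable_pi_apply i).comp h1) h2

lemma measurable_path (s₁ : Fin S) (i : Fin (H + 1)) :
    Measurable fun p : Policy H S A × Table H S A => path s₁ p.1 p.2 i := by
  induction i using Fin.induction with
  | zero => simp only [path_zero]; exact measurable_const
  | succ h ih =>
    simp only [path_succ]
    exact (measurable_step ((measurable_pi_apply h).comp measurable_snd) ih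
      ((measurable_pi_apply h).comp measurable_fst)).snd

lemma measurable_rollout (s₁ : Fin S) :
    Measurable fun p : Policy H S A × Table H S A => rollout s₁ p.1 p.2 := by
  refine measurable_pi_iff.2 fun h => measurable_obs_iff.2 ?_
  have h1 := measurable_path (A := A) s₁ h.castSucc
  have h2 := measurable_path (A := A) s₁ h.succ
  have h3 : Measurable fun p : Policy H S A × Table H S A => p.1 h :=
    (measurable_pi_apply h).comp measurable_fst
  have h4 : Measurable fun p : Policy H S A × Table H S A => p.2 h :=
    (measurable_pi_apply h).comp measurable_snd
  exact h1.prodMk ((measurable_eval_comp (fun i => (measurable_pi_apply i).comp h3) h1).prodMk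
    ((measurable_step h4 h1 h3).fst.prodMk h2))

lemma measurable_episode {sel : Selector H S A} (hsel : sel.IsArgmax) (s₁ : Fin S) :
    Measurable fun p : History H S A k × Seed H S A =>
      rollout s₁ (greedy sel p.1 p.2.1) p.2.2 :=
  (measurable_rollout s₁).comp
    (((measurable_greedy hsel).comp (measurable_fst.prodMk measurable_snd.fst)).prodMk
      measurable_snd.snd)

end Measurability

/-! ### Independence of the past -/

section Past

/-- The σ-algebra generated by the coordinates with index in `I`. -/
abbrev coordσ {ι : Type*} {X : ι → Type*} [∀ i, MeasurableSpace (X i)] (I : Set ι) :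
    MeasurableSpace (∀ i, X i) :=
  ⨆ i ∈ I, MeasurableSpace.comap (fun x => x i) inferInstance

lemma measurable_coordσ {ι : Type*} {X : ι → Type*} [∀ i, MeasurableSpace (X i)] {I : Set ι}
    {i : ι} (hi : i ∈ I) : Measurable[coordσ I] fun x : ∀ i, X i => x i := by
  rw [measurable_iff_comap_le]
  exact le_iSup₂_of_le i hi le_rfl

lemma coordσ_mono {ι : Type*} {X : ι → Type*} [∀ i, MeasurableSpace (X i)] {I J : Set ι}
    (hIJ : I ⊆ J) : (coordσ I : MeasurableSpace (∀ i, X i)) ≤ coordσ J :=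
  biSup_mono hIJ

lemma coordσ_le {ι : Type*} {X : ι → Type*} [∀ i, MeasurableSpace (X i)] (I : Set ι) :
    (coordσ I : MeasurableSpace (∀ i, X i)) ≤ MeasurableSpace.pi :=
  iSup₂_le fun i _ => (measurable_pi_apply i).comap_le

/-- Used on two scales: stages inside one outcome table, and episodes inside a run. -/
lemma indepFun_of_measurable_coordσ {ι : Type*} {X : ι → Type*} [∀ i, MeasurableSpace (X i)]
    {μ : Measure (∀ i, X i)} (hμ : iIndepFun (fun i (x : ∀ i, X i) => x i) μ) {I : Set ι} {j : ι}
    (hj : j ∉ I) {β : Type*} [MeasurableSpace β] {f : (∀ i, X i) → β}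
    (hf : Measurable[coordσ I] f) : IndepFun f (fun x => x j) μ := by
  rw [IndepFun_iff_Indep]
  have h1 := indep_iSup_of_disjoint (fun i => (measurable_pi_apply i).comap_le) hμ.iIndep
    (S := I) (T := {j}) (Set.disjoint_singleton_right.2 hj)
  refine indep_of_indep_of_le_left (indep_of_indep_of_le_right h1 ?_) hf.comap_le
  exact le_iSup₂_of_le j rfl le_rfl

variable {H S A : ℕ}

/-- The law of the table of outcomes of an episode. -/
def tableLaw (M : MDP H S A) : Measure (Table H S A) :=
  Measure.pi fun h => Measure.pi fun s => Measure.pi fun a => M.outcome h s a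

instance (M : MDP H S A) : IsProbabilityMeasure (tableLaw M) := by
  unfold tableLaw; infer_instance

lemma seedLaw_eq (M : MDP H S A) : seedLaw M = (gaussianReal 0 1).prod (tableLaw M) := rfl

lemma lintegral_entry (M : MDP H S A) (h : Fin H) (s : Fin S) (a : Fin A)
    {g : ℝ × Fin S → ENNReal} (hg : Measurable g) :
    ∫⁻ y, g (y h s a) ∂(tableLaw M) = ∫⁻ o, g o ∂(M.outcome h s a) := by
  have h1 := measurePreserving_eval
    (fun h => Measure.pi fun s => Measure.pi fun a => M.outcome h s a) h
  have h2 := measurePreserving_eval (fun s => Measure.pi fun a => M.outcome h s a) s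
  have h3 := measurePreserving_eval (fun a => M.outcome h s a) a
  exact ((h3.comp h2).comp h1).lintegral_comp hg

lemma measurable_path_coordσ (s₁ : Fin S) (π : Policy H S A) (i : Fin (H + 1)) :
    Measurable[coordσ {j : Fin H | j.castSucc < i}] fun y : Table H S A => path s₁ π y i := by
  induction i using Fin.induction with
  | zero => simp only [path_zero]; exact measurable_const
  | succ h ih =>
    simp only [path_succ]
    have h1 : Measurable[coordσ {j : Fin H | j.castSucc < h.succ}] fun y : Table H S A => y h :=
      measurable_coordσ Fin.castSucc_lt_succ
    have h2 : Measurable[coordσ {j : Fin H | j.castSucc < h.succ}]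
        fun y : Table H S A => path s₁ π y h.castSucc :=
      ih.mono (coordσ_mono fun j hj => lt_trans hj Fin.castSucc_lt_succ) le_rfl
    exact (measurable_step h1 h2 (π := fun _ => π h) measurable_const).snd

/-- The Markov property of the table model: the current state is a function of earlier rows, hence
independent of row `h`. -/
lemma lintegral_path_step (M : MDP H S A) (π : Policy H S A) (h : Fin H)
    {Φ : Fin S → ℝ × Fin S → ENNReal} (hΦ : ∀ s, Measurable (Φ s)) :
    ∫⁻ y, Φ (path M.init π y h.castSucc)
        (y h (path M.init π y h.castSucc) (π h (path M.init π y h.castSucc))) ∂(tableLaw M)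
      = ∑ s, tableLaw M {y | path M.init π y h.castSucc = s}
          * ∫⁻ o, Φ s o ∂(M.outcome h s (π h s)) := by
  have hind : iIndepFun (fun i (x : Table H S A) => x i) (tableLaw M) :=
    iIndepFun_pi (X := fun _ x => x) fun i => aemeasurable_id
  have hpath : Measurable fun y : Table H S A => path M.init π y h.castSucc :=
    (measurable_path_coordσ M.init π h.castSucc).mono (coordσ_le _) le_rfl
  have hindep := indepFun_of_measurable_coordσ hind (j := h) (by simp)
    (measurable_path_coordσ M.init π h.castSucc)
  have hentry : ∀ s a, Measurable fun y : Table H S A => y h s a := fun s a => by fun_prop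
  have e : ∀ y : Table H S A, Φ (path M.init π y h.castSucc)
        (y h (path M.init π y h.castSucc) (π h (path M.init π y h.castSucc)))
      = ∑ s, ({s} : Set (Fin S)).indicator (fun _ => (1 : ENNReal)) (path M.init π y h.castSucc)
          * Φ s (y h s (π h s)) := by
    intro y
    rw [Finset.sum_eq_single (path M.init π y h.castSucc)]
    · simp
    · intro s _ hs
      simp [Ne.symm hs]
    · simp
  simp only [e]
  rw [lintegral_finsetSum _ fun s _ => ?_]
  swap
  · exact Measurable.mul
      ((measurable_const.indicator (measurableSet_singleton s)).comp hpath)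
      ((hΦ s).comp (hentry s _))
  refine Finset.sum_congr rfl fun s _ => ?_
  have h1 : Measurable (({s} : Set (Fin S)).indicator (fun _ => (1 : ENNReal))) :=
    measurable_of_finite _
  have h2 : Measurable fun z : Fin S → Fin A → ℝ × Fin S => Φ s (z s (π h s)) :=
    (hΦ s).comp (by fun_prop)
  have h3 := lintegral_mul_eq_lintegral_mul_lintegral_of_indepFun (h1.comp hpath)
    (h2.comp (measurable_pi_apply h)) (hindep.comp h1 h2)
  refine h3.trans ?_
  congr 1
  · have h4 : MeasurableSet {y | path M.init π y h.castSucc = s} :=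
      hpath (measurableSet_singleton s)
    rw [← one_mul (tableLaw M _), ← lintegral_indicator_const h4]
    rfl
  · exact lintegral_entry M h s (π h s) (hΦ s)

lemma measurable_path_table (s₁ : Fin S) (π : Policy H S A) (i : Fin (H + 1)) :
    Measurable fun y : Table H S A => path s₁ π y i :=
  (measurable_path_coordσ s₁ π i).mono (coordσ_le _) le_rfl

lemma tableLaw_path (M : MDP H S A) (π : Policy H S A) (i : Fin (H + 1)) :
    ∀ s, tableLaw M {y | path M.init π y i = s} = ENNReal.ofReal (M.occ π i s) := by
  induction i using Fin.induction with
  | zero =>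
    intro s
    simp only [path_zero, MDP.occ_zero]
    by_cases h : s = M.init <;> simp [h, eq_comm]
  | succ h ih =>
    intro s'
    have h1 := lintegral_path_step M π h
      (Φ := fun _ o => {o : ℝ × Fin S | o.2 = s'}.indicator (fun _ => 1) o)
      (fun _ => measurable_const.indicator (measurable_snd (measurableSet_singleton s')))
    have h2 : ∀ y : Table H S A, {o : ℝ × Fin S | o.2 = s'}.indicator (fun _ => (1 : ENNReal))
        (y h (path M.init π y h.castSucc) (π h (path M.init π y h.castSucc)))
        = {y | path M.init π y h.succ = s'}.indicator (fun _ => 1) y := fun y => by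
      simp [Set.indicator_apply, path_succ]
    simp only [h2] at h1
    have h3 : MeasurableSet {y | path M.init π y h.succ = s'} :=
      measurable_path_table M.init π h.succ (measurableSet_singleton s')
    have h4 : MeasurableSet {o : ℝ × Fin S | o.2 = s'} :=
      measurable_snd (measurableSet_singleton s')
    rw [lintegral_indicator_const h3, one_mul] at h1
    rw [h1, MDP.occ_succ, ENNReal.ofReal_sum_of_nonneg fun s _ =>
      mul_nonneg (M.occ_nonneg π _ s) (M.P_nonneg _ _ _ _)]
    refine Finset.sum_congr rfl fun s _ => ?_
    rw [ih, lintegral_indicator_const h4, one_mul,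
      ENNReal.ofReal_mul (M.occ_nonneg π _ s), MDP.P, ofReal_measureReal]

lemma integral_sum_path (M : MDP H S A) (π : Policy H S A) (w : Fin H → Fin S → Fin A → ℝ) :
    ∫ y, ∑ h, w h (path M.init π y h.castSucc) (π h (path M.init π y h.castSucc)) ∂(tableLaw M)
      = M.expSum π w := by
  have h1 : ∀ h : Fin H, ∀ f : Fin S → ℝ,
      Integrable (fun y => f (path M.init π y h.castSucc)) (tableLaw M) ∧
      ∫ y, f (path M.init π y h.castSucc) ∂(tableLaw M)
        = ∑ s, M.occ π h.castSucc s * f s := by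
    intro h f
    have hm := measurable_path_table M.init π h.castSucc
    have : IsProbabilityMeasure ((tableLaw M).map fun y => path M.init π y h.castSucc) :=
      Measure.isProbabilityMeasure_map hm.aemeasurable
    constructor
    · exact (Integrable.of_finite (f := f)
        (μ := (tableLaw M).map fun y => path M.init π y h.castSucc)).comp_measurable hm
    · rw [← integral_map (φ := fun y => path M.init π y h.castSucc) hm.aemeasurable
        (measurable_of_finite f).aestronglyMeasurable, integral_fintype Integrable.of_finite]
      refine Finset.sum_congr rfl fun s _ => ?_
      rw [map_measureReal_apply hm (measurableSet_singleton s), smul_eq_mul, measureReal_def]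
      congr 1
      have := tableLaw_path M π h.castSucc s
      rw [show (fun y => path M.init π y h.castSucc) ⁻¹' {s}
        = {y | path M.init π y h.castSucc = s} from rfl, this,
        ENNReal.toReal_ofReal (M.occ_nonneg π _ s)]
  rw [integral_finsetSum _ fun h _ => (h1 h fun s => w h s (π h s)).1]
  exact Finset.sum_congr rfl fun h _ => (h1 h fun s => w h s (π h s)).2

end Past

/-! ### Exponential inequalities along the run -/

section Supermartingale

variable {H S A : ℕ} {M : MDP H S A} {sel : Selector H S A}

lemma history_succ_castSucc (ω : ℕ → Seed H S A) (k : ℕ) (l : Fin k) :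
    history M sel ω (k + 1) l.castSucc = history M sel ω k l := by
  simp [history]

lemma history_succ_last (ω : ℕ → Seed H S A) (k : ℕ) :
    history M sel ω (k + 1) (Fin.last k)
      = rollout M.init (greedy sel (history M sel ω k) (ω k).1) (ω k).2 := by
  simp [history]

lemma sum_history (F : Obs S A → ℝ) (h : Fin H) (ω : ℕ → Seed H S A) (k : ℕ) :
    ∑ l, F (history M sel ω k l h) = ∑ l ∈ Finset.range k,
      F (rollout M.init (greedy sel (history M sel ω l) (ω l).1) (ω l).2 h) := by
  induction k with
  | zero => simp
  | succ k ih =>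
    rw [Fin.sum_univ_castSucc, Finset.sum_range_succ, ← ih]
    simp only [history_succ_castSucc, history_succ_last]

lemma measurable_of_forall_apply {Ω ι : Type*} {X : ι → Type*} {mΩ : MeasurableSpace Ω}
    [∀ i, MeasurableSpace (X i)] {f : Ω → ∀ i, X i} (hf : ∀ i, Measurable fun ω => f ω i) :
    Measurable f :=
  measurable_pi_iff.2 hf

lemma measurable_snoc {Ω : Type*} {mΩ : MeasurableSpace Ω} (hsel : sel.IsArgmax) {k : ℕ}
    {D : Ω → History H S A k} {ξ : Ω → Seed H S A} (hD : Measurable D) (hξ : Measurable ξ) :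
    Measurable fun ω => Fin.snoc (α := fun _ => Fin H → Obs S A) (D ω)
      (rollout M.init (greedy sel (D ω) (ξ ω).1) (ξ ω).2) := by
  have h1 : Measurable fun ω => rollout M.init (greedy sel (D ω) (ξ ω).1) (ξ ω).2 := by
    have h0 := (measurable_episode (k := k) hsel M.init).comp (hD.prodMk hξ)
    exact h0
  refine measurable_of_forall_apply (X := fun _ => Fin H → Obs S A) fun l => ?_
  induction l using Fin.lastCases with
  | last =>
    simp only [Fin.snoc_last]
    exact h1
  | cast l =>
    simp only [Fin.snoc_castSucc]
    exact (measurable_pi_apply l).comp hD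

lemma measurable_history_coordσ (hsel : sel.IsArgmax) (k : ℕ) :
    Measurable[coordσ (Set.Iio k)] fun ω : ℕ → Seed H S A => history M sel ω k := by
  induction k with
  | zero => exact measurable_of_forall_apply fun l => l.elim0
  | succ k ih =>
    refine measurable_snoc hsel (ih.mono (coordσ_mono (Set.Iio_subset_Iio k.le_succ)) le_rfl)
      (measurable_coordσ (Set.mem_Iio.2 k.lt_succ_self))

lemma measurable_history (hsel : sel.IsArgmax) (k : ℕ) :
    Measurable fun ω : ℕ → Seed H S A => history M sel ω k :=
  (measurable_history_coordσ hsel k).mono (coordσ_le _) le_rfl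

/-- A product of conditionally subnormalized factors has integral at most one. -/
lemma lintegral_prod_history_le (hsel : sel.IsArgmax)
    {g : ∀ k, History H S A k → Seed H S A → ENNReal}
    (hg : ∀ k, Measurable fun p : _ × _ => g k p.1 p.2)
    (hg1 : ∀ k D, ∫⁻ ξ, g k D ξ ∂(seedLaw M) ≤ 1) (K : ℕ) :
    ∫⁻ ω, ∏ k ∈ Finset.range K, g k (history M sel ω k) (ω k) ∂(runLaw M) ≤ 1 := by
  have hind : iIndepFun (fun i (x : ℕ → Seed H S A) => x i) (runLaw M) :=
    iIndepFun_infinitePi (X := fun _ x => x) fun i => measurable_id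
  have hZ : ∀ K, Measurable[coordσ (Set.Iio K)] fun ω : ℕ → Seed H S A =>
      ∏ k ∈ Finset.range K, g k (history M sel ω k) (ω k) := by
    intro K
    refine Finset.measurable_fun_prod _ fun k hk => ?_
    have hk' : k < K := Finset.mem_range.1 hk
    exact (hg k).comp (((measurable_history_coordσ hsel k).mono
      (coordσ_mono (Set.Iio_subset_Iio hk'.le)) le_rfl).prodMk
        (measurable_coordσ (Set.mem_Iio.2 hk')))
  induction K with
  | zero => simp
  | succ K ih =>
    have h1 : Measurable[coordσ (Set.Iio K)] fun ω : ℕ → Seed H S A =>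
        (history M sel ω K, ∏ k ∈ Finset.range K, g k (history M sel ω k) (ω k)) :=
      (measurable_history_coordσ hsel K).prodMk (hZ K)
    -- The past product and history use coordinates below `K` only. Their joint law with episode `K`
    -- is thus a product measure, and Fubini replaces conditional expectations.
    have h2 := indepFun_of_measurable_coordσ hind (j := K) (by simp) h1
    have h1' := h1.mono (coordσ_le _) le_rfl
    rw [indepFun_iff_map_prod_eq_prod_map_map h1'.aemeasurable
      (measurable_pi_apply K).aemeasurable] at h2
    have h3 : Measure.map (fun x : ℕ → Seed H S A => x K) (runLaw M) = seedLaw M :=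
      Measure.infinitePi_map_eval (fun _ : ℕ => seedLaw M) K
    rw [h3] at h2
    set F : (History H S A K × ENNReal) × Seed H S A → ENNReal :=
      fun q => q.1.2 * g K q.1.1 q.2 with hF
    have hFm : Measurable F :=
      measurable_fst.snd.mul ((hg K).comp (measurable_fst.fst.prodMk measurable_snd))
    have h4 : ∫⁻ ω, ∏ k ∈ Finset.range (K + 1), g k (history M sel ω k) (ω k) ∂(runLaw M)
        = ∫⁻ q, F q ∂(Measure.map (fun ω : ℕ → Seed H S A => ((history M sel ω K,
            ∏ k ∈ Finset.range K, g k (history M sel ω k) (ω k)), ω K)) (runLaw M)) := by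
      rw [lintegral_map hFm (h1'.prodMk (measurable_pi_apply K))]
      simp only [Finset.prod_range_succ, hF]
    rw [h4, h2, lintegral_prod _ hFm.aemeasurable]
    calc ∫⁻ q, ∫⁻ ξ, F (q, ξ) ∂(seedLaw M) ∂(Measure.map _ (runLaw M))
        ≤ ∫⁻ q, q.2 ∂(Measure.map (fun ω : ℕ → Seed H S A => (history M sel ω K,
            ∏ k ∈ Finset.range K, g k (history M sel ω k) (ω k))) (runLaw M)) := by
          refine lintegral_mono fun q => ?_
          simp only [hF]
          have hgm : Measurable fun ξ => g K q.1 ξ :=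
            (hg K).comp (measurable_const.prodMk measurable_id)
          rw [lintegral_const_mul _ hgm]
          exact mul_le_of_le_one_right' (hg1 K q.1)
      _ = ∫⁻ ω, ∏ k ∈ Finset.range K, g k (history M sel ω k) (ω k) ∂(runLaw M) := by
          rw [lintegral_map measurable_snd h1']
      _ ≤ 1 := ih

/-- Exponential Markov inequality for sums with subnormalized conditional exponential moments. -/
lemma measure_le_sum_history_le (hsel : sel.IsArgmax)
    {Ψ : ∀ k, History H S A k → Seed H S A → ℝ}
    (hΨ : ∀ k, Measurable fun p : _ × _ => Ψ k p.1 p.2)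
    (hΨ1 : ∀ k D, ∫⁻ ξ, ENNReal.ofReal (Real.exp (Ψ k D ξ)) ∂(seedLaw M) ≤ 1) (K : ℕ) (L : ℝ) :
    runLaw M {ω | L ≤ ∑ k ∈ Finset.range K, Ψ k (history M sel ω k) (ω k)}
      ≤ ENNReal.ofReal (Real.exp (-L)) := by
  have hg : ∀ k, Measurable fun p : History H S A k × Seed H S A =>
      ENNReal.ofReal (Real.exp (Ψ k p.1 p.2)) := fun k => (hΨ k).exp.ennreal_ofReal
  have h1 := lintegral_prod_history_le (M := M) hsel hg hΨ1 K
  have h2 : Measurable fun ω : ℕ → Seed H S A =>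
      ∏ k ∈ Finset.range K, ENNReal.ofReal (Real.exp (Ψ k (history M sel ω k) (ω k))) :=
    Finset.measurable_fun_prod _ fun k _ =>
      (hg k).comp ((measurable_history hsel k).prodMk (measurable_pi_apply k))
  have h3 := meas_ge_le_lintegral_div (μ := runLaw M) h2.aemeasurable
    (ε := ENNReal.ofReal (Real.exp L)) (by simp [Real.exp_pos]) (by simp)
  refine (measure_mono fun ω hω => ?_).trans (h3.trans ?_)
  · simp only [Set.mem_ofPred_eq] at hω ⊢
    rw [← ENNReal.ofReal_prod_of_nonneg fun _ _ => (Real.exp_pos _).le, ← Real.exp_sum]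
    exact ENNReal.ofReal_le_ofReal (Real.exp_le_exp.2 hω)
  · rw [Real.exp_neg, ENNReal.ofReal_inv_of_pos (Real.exp_pos L), div_eq_mul_inv]
    exact mul_le_of_le_one_left' h1

end Supermartingale

/-! ### Multiplicative Chernoff bounds -/

section Chernoff

variable {H S A : ℕ} {M : MDP H S A} {sel : Selector H S A}
  {X : ∀ k, History H S A k → Seed H S A → ℝ}

lemma integrable_of_bounds {Ω : Type*} {mΩ : MeasurableSpace Ω} {μ : Measure Ω}
    [IsProbabilityMeasure μ] {f : Ω → ℝ} (hf : Measurable f) {a b : ℝ}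
    (hab : ∀ᵐ ω ∂μ, a ≤ f ω ∧ f ω ≤ b) : Integrable f μ := by
  refine Integrable.of_bound hf.aestronglyMeasurable (max |a| |b|) ?_
  filter_upwards [hab] with ω hω
  exact abs_le_max_abs_abs hω.1 hω.2

/-- Taking means gives at most `1 + c ≤ exp c`. Both Chernoff bounds and Bernstein's inequality are
instances, for different choices of `g`. -/
lemma lintegral_exp_le_one {Ω : Type*} {mΩ : MeasurableSpace Ω} {μ : Measure Ω}
    [IsProbabilityMeasure μ] {f g : Ω → ℝ} {c : ℝ}
    (hg : Integrable g μ) (hfg : ∀ᵐ ω ∂μ, Real.exp (f ω) ≤ 1 + g ω) (hc : ∫ ω, g ω ∂μ ≤ c) :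
    ∫⁻ ω, ENNReal.ofReal (Real.exp (f ω - c)) ∂μ ≤ 1 := by
  have h0 : Integrable (fun ω => (1 + g ω) * Real.exp (-c)) μ :=
    ((integrable_const 1).add hg).mul_const _
  have h1 : ∫⁻ ω, ENNReal.ofReal (Real.exp (f ω - c)) ∂μ
      ≤ ∫⁻ ω, ENNReal.ofReal ((1 + g ω) * Real.exp (-c)) ∂μ := by
    refine lintegral_mono_ae ?_
    filter_upwards [hfg] with ω hω
    rw [sub_eq_add_neg, Real.exp_add]
    exact ENNReal.ofReal_le_ofReal (mul_le_mul_of_nonneg_right hω (Real.exp_pos _).le)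
  refine h1.trans ?_
  rw [← ofReal_integral_eq_lintegral_ofReal h0, ENNReal.ofReal_le_one]
  · rw [integral_mul_const, integral_add (integrable_const 1) hg]
    simp only [integral_const, probReal_univ, smul_eq_mul, mul_one]
    calc (1 + ∫ ω, g ω ∂μ) * Real.exp (-c) ≤ Real.exp c * Real.exp (-c) := by
          gcongr
          linarith [Real.add_one_le_exp c]
      _ = 1 := by rw [← Real.exp_add]; simp
  · filter_upwards [hfg] with ω hω
    exact mul_nonneg ((Real.exp_pos _).le.trans hω) (Real.exp_pos _).le

lemma measurable_mean (hX : ∀ k, Measurable fun p : _ × _ => X k p.1 p.2) (k : ℕ) :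
    Measurable fun D => ∫ ξ, X k D ξ ∂(seedLaw M) :=
  ((hX k).stronglyMeasurable.integral_prod_right' (ν := seedLaw M)).measurable

lemma exp_le_one_add_two_mul {x : ℝ} (h0 : 0 ≤ x) (h1 : x ≤ 1) : Real.exp x ≤ 1 + 2 * x := by
  have h2 := abs_le.1 (Real.abs_exp_sub_one_sub_id_le (x := x) (by rwa [abs_of_nonneg h0]))
  nlinarith [h2.2]

lemma exp_neg_le_one_sub_half {x : ℝ} (h0 : 0 ≤ x) (h1 : x ≤ 1) :
    Real.exp (-x) ≤ 1 + -(x / 2) := by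
  have h2 := Real.add_one_le_exp x
  have h3 : Real.exp (-x) * Real.exp x = 1 := by rw [← Real.exp_add]; simp
  have h4 : 1 ≤ (1 + -(x / 2)) * Real.exp x := by nlinarith
  nlinarith [Real.exp_pos x]

/-- Sums of variables in `[0, 1]` are controlled by their conditional means. -/
lemma measure_sum_gt_le (hsel : sel.IsArgmax)
    (hX : ∀ k, Measurable fun p : _ × _ => X k p.1 p.2)
    (hX0 : ∀ k D ξ, 0 ≤ X k D ξ) (hX1 : ∀ k D ξ, X k D ξ ≤ 1) (K : ℕ) (L : ℝ) :
    runLaw M {ω | 2 * (∑ k ∈ Finset.range K, ∫ ξ, X k (history M sel ω k) ξ ∂(seedLaw M)) + L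
        < ∑ k ∈ Finset.range K, X k (history M sel ω k) (ω k)}
      ≤ ENNReal.ofReal (Real.exp (-L)) := by
  refine (measure_mono fun ω hω => ?_).trans (measure_le_sum_history_le (M := M) hsel
    (Ψ := fun k D ξ => X k D ξ - 2 * ∫ ξ, X k D ξ ∂(seedLaw M)) (fun k => ?_) (fun k D => ?_) K L)
  · simp only [Set.mem_ofPred_eq, Finset.sum_sub_distrib, ← Finset.mul_sum] at hω ⊢
    linarith
  · exact (hX k).sub (((measurable_mean hX k).comp measurable_fst).const_mul 2)
  · have hm : Measurable (X k D) := (hX k).comp (measurable_const.prodMk measurable_id)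
    have hi : Integrable (X k D) (seedLaw M) :=
      integrable_of_bounds hm (Filter.Eventually.of_forall fun ξ => ⟨hX0 k D ξ, hX1 k D ξ⟩)
    refine lintegral_exp_le_one (hi.const_mul 2) (Filter.Eventually.of_forall fun ξ => ?_) ?_
    · exact exp_le_one_add_two_mul (hX0 k D ξ) (hX1 k D ξ)
    · rw [integral_const_mul]

/-- Conditional means of variables in `[0, 1]` are controlled by their sums. -/
lemma measure_sum_mean_gt_le (hsel : sel.IsArgmax)
    (hX : ∀ k, Measurable fun p : _ × _ => X k p.1 p.2)
    (hX0 : ∀ k D ξ, 0 ≤ X k D ξ) (hX1 : ∀ k D ξ, X k D ξ ≤ 1) (K : ℕ) (L : ℝ) :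
    runLaw M {ω | 2 * (∑ k ∈ Finset.range K, X k (history M sel ω k) (ω k)) + 2 * L
        < ∑ k ∈ Finset.range K, ∫ ξ, X k (history M sel ω k) ξ ∂(seedLaw M)}
      ≤ ENNReal.ofReal (Real.exp (-L)) := by
  refine (measure_mono fun ω hω => ?_).trans (measure_le_sum_history_le (M := M) hsel
    (Ψ := fun k D ξ => -X k D ξ - -((∫ ξ, X k D ξ ∂(seedLaw M)) / 2))
    (fun k => ?_) (fun k D => ?_) K L)
  · simp only [Set.mem_ofPred_eq, Finset.sum_sub_distrib, Finset.sum_neg_distrib,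
      ← Finset.sum_div] at hω ⊢
    linarith
  · exact (hX k).neg.sub (((measurable_mean hX k).comp measurable_fst).div_const 2).neg
  · have hm : Measurable (X k D) := (hX k).comp (measurable_const.prodMk measurable_id)
    have hi : Integrable (X k D) (seedLaw M) :=
      integrable_of_bounds hm (Filter.Eventually.of_forall fun ξ => ⟨hX0 k D ξ, hX1 k D ξ⟩)
    refine lintegral_exp_le_one (f := fun ξ => -X k D ξ) (hi.div_const 2).neg
      (Filter.Eventually.of_forall fun ξ => ?_) ?_
    · exact exp_neg_le_one_sub_half (hX0 k D ξ) (hX1 k D ξ)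
    · simp only [Pi.neg_apply]
      rw [integral_neg, integral_div]

end Chernoff

/-! ### Bernstein's inequality with random visit counts -/

section Bernstein

variable {H S A : ℕ} {M : MDP H S A} {sel : Selector H S A}

/-- Sum of the deviations of `f` over the observations made at `(h, s, a)`. -/
def deviation {k : ℕ} (D : History H S A k) (h : Fin H) (s : Fin S) (a : Fin A)
    (f : ℝ × Fin S → ℝ) (μ : ℝ) : ℝ :=
  ∑ l, if (D l h).state = s ∧ (D l h).action = a then f ((D l h).reward, (D l h).next) - μ else 0

/-- The unconstrained optimum is `√(L / v)`; when it violates `lam * b ≤ 1`, the endpoint `1 / b` is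
used and the linear term dominates. -/
lemma exists_bernstein_rate {b v L : ℝ} (hb : 0 < b) (hv : 0 ≤ v) (hL : 0 < L) :
    ∃ lam : ℝ, 0 < lam ∧ lam * b ≤ 1 ∧ lam * v + L / lam ≤ 2 * Real.sqrt (v * L) + 2 * b * L := by
  by_cases h : v ≤ b ^ 2 * L
  · refine ⟨1 / b, by positivity, by rw [one_div_mul_cancel hb.ne'], ?_⟩
    have h1 : 1 / b * v ≤ b * L := by
      rw [one_div, inv_mul_le_iff₀ hb]; linarith
    have h2 : L / (1 / b) = b * L := by field_simp
    have := Real.sqrt_nonneg (v * L)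
    rw [h2]; linarith
  · push Not at h
    have hv0 : 0 < v := lt_of_le_of_lt (by positivity) h
    have h3 : 0 < Real.sqrt (v * L) := Real.sqrt_pos.2 (by positivity)
    have h4 : Real.sqrt (v * L) ^ 2 = v * L := Real.sq_sqrt (by positivity)
    refine ⟨Real.sqrt (v * L) / v, by positivity, ?_, ?_⟩
    · rw [div_mul_eq_mul_div, div_le_one hv0]
      refine abs_le_of_sq_le_sq' ?_ hv0.le |>.2
      rw [mul_pow, h4]
      nlinarith
    · have h5 : L / (Real.sqrt (v * L) / v) = Real.sqrt (v * L) := by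
        rw [div_div_eq_mul_div, div_eq_iff h3.ne', ← sq, h4, mul_comm]
      rw [h5, div_mul_cancel₀ _ hv0.ne']
      have : 0 ≤ b * L := by positivity
      linarith

/-- Fixing the visit count `n` makes the rate `lam` deterministic although the count is random; the
later union over `n` removes this restriction. -/
lemma measure_deviation_gt_le (hsel : sel.IsArgmax) (h : Fin H) (s : Fin S) (a : Fin A)
    {f : ℝ × Fin S → ℝ} (hf : Measurable f) {μ b v L : ℝ} (hb : 0 < b) (hv : 0 ≤ v) (hL : 0 < L)
    (hμ : ∫ o, f o ∂(M.outcome h s a) = μ) (hfb : ∀ᵐ o ∂(M.outcome h s a), |f o - μ| ≤ b)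
    (hvar : ∫ o, (f o - μ) ^ 2 ∂(M.outcome h s a) ≤ v) (k n : ℕ) :
    runLaw M {ω | visits (history M sel ω k) h s a = n ∧
        2 * Real.sqrt (v * n * L) + 2 * b * L < deviation (history M sel ω k) h s a f μ}
      ≤ ENNReal.ofReal (Real.exp (-L)) := by
  obtain ⟨lam, hlam, hlamb, hrate⟩ := exists_bernstein_rate (v := v * n) hb (by positivity) hL
  -- The compensator is charged only at visits, so on the event the exponents add up to `lam` times
  -- the deviation minus `lam ^ 2 * v * n`.
  set G : Obs S A → ℝ := fun o => if o.state = s ∧ o.action = a then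
    lam * (f (o.reward, o.next) - μ) - lam ^ 2 * v else 0 with hG
  have hGm : Measurable G := Measurable.ite (measurableSet_visit s a)
    ((((hf.comp (measurable_reward.prodMk measurable_next)).sub_const μ).const_mul lam).sub_const _)
    measurable_const
  refine (measure_mono fun ω hω => ?_).trans (measure_le_sum_history_le (M := M) hsel
    (Ψ := fun k D ξ => G (rollout M.init (greedy sel D ξ.1) ξ.2 h)) (fun k => ?_)
    (fun k D => ?_) k L)
  · obtain ⟨h1, h2⟩ := hω
    rw [Set.mem_ofPred_eq, ← sum_history (M := M) (sel := sel) G h ω k]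
    have h3 : ∑ l, G (history M sel ω k l h)
        = lam * deviation (history M sel ω k) h s a f μ - lam ^ 2 * v * n := by
      rw [← h1, deviation, visits, Finset.mul_sum, Nat.cast_sum, Finset.mul_sum,
        ← Finset.sum_sub_distrib]
      refine Finset.sum_congr rfl fun l _ => ?_
      simp only [hG]
      split_ifs <;> simp
    rw [h3]
    have h4 : lam * (lam * (v * n) + L / lam) ≤ lam * deviation (history M sel ω k) h s a f μ :=
      mul_le_mul_of_nonneg_left (hrate.trans h2.le) hlam.le
    have h5 : lam * (lam * (v * n) + L / lam) = lam ^ 2 * v * n + L := by field_simp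
    linarith
  · exact hGm.comp ((measurable_pi_apply h).comp (measurable_episode hsel M.init))
  · have hm : Measurable fun ξ : Seed H S A =>
        ENNReal.ofReal (Real.exp (G (rollout M.init (greedy sel D ξ.1) ξ.2 h))) :=
      (hGm.comp ((measurable_pi_apply h).comp ((measurable_episode hsel M.init).comp
        (measurable_const.prodMk measurable_id)))).exp.ennreal_ofReal
    rw [seedLaw_eq, lintegral_prod _ hm.aemeasurable]
    have hone : ∀ z, ∫⁻ y, ENNReal.ofReal (Real.exp (G (rollout M.init (greedy sel D z) y h)))
        ∂(tableLaw M) ≤ 1 := by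
      intro z
      set π := greedy sel D z
      set Φ : Fin S → ℝ × Fin S → ENNReal := fun s' o =>
        ENNReal.ofReal (Real.exp (G ⟨s', π h s', o.1, o.2⟩)) with hΦ
      have hΦm : ∀ s', Measurable (Φ s') := fun s' =>
        (hGm.comp ((measurable_obs_iff (f := fun o : ℝ × Fin S =>
          (⟨s', π h s', o.1, o.2⟩ : Obs S A))).2 (measurable_const.prodMk (measurable_const.prodMk
          (measurable_fst.prodMk measurable_snd))))).exp.ennreal_ofReal
      have e1 : ∀ y : Table H S A, ENNReal.ofReal (Real.exp (G (rollout M.init π y h)))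
          = Φ (path M.init π y h.castSucc)
            (y h (path M.init π y h.castSucc) (π h (path M.init π y h.castSucc))) := fun y => by
        simp only [hΦ, rollout, path_succ]
      simp only [e1]
      rw [lintegral_path_step M π h hΦm]
      have h6 : ∀ s', ∫⁻ o, Φ s' o ∂(M.outcome h s' (π h s')) ≤ 1 := by
        intro s'
        by_cases hs : s' = s ∧ π h s' = a
        · obtain ⟨rfl, rfl⟩ := hs
          simp only [hΦ, hG, and_self, if_true]
          have hint : Integrable f (M.outcome h s' (π h s')) := by
            refine integrable_of_bounds hf (a := μ - b) (b := μ + b) ?_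
            filter_upwards [hfb] with o ho
            have := abs_le.1 ho
            constructor <;> linarith
          have hint2 : Integrable (fun o => (f o - μ) ^ 2) (M.outcome h s' (π h s')) := by
            refine integrable_of_bounds ((hf.sub_const μ).pow_const 2) (a := 0) (b := b ^ 2) ?_
            filter_upwards [hfb] with o ho
            exact ⟨sq_nonneg _, sq_le_sq' (abs_le.1 ho).1 (abs_le.1 ho).2⟩
          refine lintegral_exp_le_one (f := fun o => lam * (f o - μ))
            (g := fun o => lam * (f o - μ) + lam ^ 2 * (f o - μ) ^ 2)
            (((hint.sub (integrable_const μ)).const_mul lam).add (hint2.const_mul _)) ?_ ?_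
          · filter_upwards [hfb] with o ho
            have h7 : |lam * (f o - μ)| ≤ 1 := by
              rw [abs_mul, abs_of_pos hlam]
              exact (mul_le_mul_of_nonneg_left ho hlam.le).trans hlamb
            -- `exp x ≤ 1 + x + x ^ 2` for `|x| ≤ 1`; the linear part has mean zero.
            have h8 := (abs_le.1 (Real.abs_exp_sub_one_sub_id_le h7)).2
            rw [mul_pow] at h8
            linarith
          · have hint1 : Integrable (fun o => lam * (f o - μ)) (M.outcome h s' (π h s')) :=
              (hint.sub (integrable_const μ)).const_mul lam
            rw [integral_add hint1 (hint2.const_mul _), integral_const_mul, integral_const_mul,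
              integral_sub hint (integrable_const μ), hμ]
            simp only [integral_const, probReal_univ, smul_eq_mul, one_mul, sub_self, mul_zero,
              zero_add]
            exact mul_le_mul_of_nonneg_left hvar (sq_nonneg lam)
        · simp only [hΦ, hG, if_neg hs]
          simp
      calc ∑ s', tableLaw M {y | path M.init π y h.castSucc = s'}
            * ∫⁻ o, Φ s' o ∂(M.outcome h s' (π h s'))
          ≤ ∑ s', tableLaw M {y | path M.init π y h.castSucc = s'} :=
            Finset.sum_le_sum fun s' _ => mul_le_of_le_one_right' (h6 s')
        _ = 1 := by
            simp only [tableLaw_path]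
            rw [← ENNReal.ofReal_sum_of_nonneg fun s _ => M.occ_nonneg π _ s, M.occ_sum,
              ENNReal.ofReal_one]
    calc ∫⁻ z, ∫⁻ y, ENNReal.ofReal (Real.exp (G (rollout M.init (greedy sel D z) y h)))
          ∂(tableLaw M) ∂(gaussianReal 0 1)
        ≤ ∫⁻ _, 1 ∂(gaussianReal 0 1) := lintegral_mono hone
      _ = 1 := by simp

/-- Bernstein's inequality, uniformly over a finite family of observables and over the first
`K` episodes. -/
lemma measure_exists_deviation_gt_le {J : Type*} [Fintype J] (hsel : sel.IsArgmax)
    (i : J → Fin H × Fin S × Fin A) {f : J → ℝ × Fin S → ℝ} (hf : ∀ j, Measurable (f j))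
    {μ b v : J → ℝ} {L : ℝ} (hb : ∀ j, 0 < b j) (hv : ∀ j, 0 ≤ v j) (hL : 0 < L)
    (hμ : ∀ j, ∫ o, f j o ∂(M.outcome (i j).1 (i j).2.1 (i j).2.2) = μ j)
    (hfb : ∀ j, ∀ᵐ o ∂(M.outcome (i j).1 (i j).2.1 (i j).2.2), |f j o - μ j| ≤ b j)
    (hvar : ∀ j, ∫ o, (f j o - μ j) ^ 2 ∂(M.outcome (i j).1 (i j).2.1 (i j).2.2) ≤ v j)
    (K : ℕ) :
    runLaw M {ω | ∃ j, ∃ k < K, 2 * Real.sqrt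
        (v j * visits (history M sel ω k) (i j).1 (i j).2.1 (i j).2.2 * L) + 2 * b j * L
          < |deviation (history M sel ω k) (i j).1 (i j).2.1 (i j).2.2 (f j) (μ j)|}
      ≤ ENNReal.ofReal (2 * Fintype.card J * K ^ 2 * Real.exp (-L)) := by
  -- The union runs over sign, observable, episode and visit count, whence the factor `2 * card J *
  -- K ^ 2`. Counts are below `K` because at most `k < K` episodes have been observed.
  set E : Bool × J × Fin K × Fin K → Set (ℕ → Seed H S A) := fun q =>
    {ω | visits (history M sel ω q.2.2.1) (i q.2.1).1 (i q.2.1).2.1 (i q.2.1).2.2 = (q.2.2.2 : ℕ) ∧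
      2 * Real.sqrt (v q.2.1 * (q.2.2.2 : ℕ) * L) + 2 * b q.2.1 * L
        < deviation (history M sel ω q.2.2.1) (i q.2.1).1 (i q.2.1).2.1 (i q.2.1).2.2
          (fun o => (if q.1 then 1 else -1) * f q.2.1 o) ((if q.1 then 1 else -1) * μ q.2.1)}
    with hE
  have hEm : ∀ q, runLaw M (E q) ≤ ENNReal.ofReal (Real.exp (-L)) := by
    rintro ⟨ε, j, k, n⟩
    have hε : (if ε then (1 : ℝ) else -1) = 1 ∨ (if ε then (1 : ℝ) else -1) = -1 := by
      cases ε <;> simp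
    refine measure_deviation_gt_le hsel _ _ _ ((hf j).const_mul _) (hb j) (hv j) hL ?_ ?_ ?_ k n
    · rw [integral_const_mul, hμ j]
    · filter_upwards [hfb j] with o ho
      rw [← mul_sub, abs_mul]
      rcases hε with h | h <;> rw [h] <;> simpa using ho
    · simp only [← mul_sub, mul_pow]
      refine le_trans (le_of_eq ?_) (hvar j)
      rcases hε with h | h <;> rw [h] <;> norm_num
  have hsub : {ω | ∃ j, ∃ k < K, 2 * Real.sqrt
        (v j * visits (history M sel ω k) (i j).1 (i j).2.1 (i j).2.2 * L) + 2 * b j * L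
          < |deviation (history M sel ω k) (i j).1 (i j).2.1 (i j).2.2 (f j) (μ j)|}
      ⊆ ⋃ q, E q := by
    rintro ω ⟨j, k, hk, hω⟩
    have hn : visits (history M sel ω k) (i j).1 (i j).2.1 (i j).2.2 < K := by
      refine lt_of_le_of_lt ?_ hk
      refine (Finset.sum_le_sum (g := fun _ => 1) fun l _ => ?_).trans (by simp)
      split_ifs <;> simp
    have hdev : ∀ c : ℝ, deviation (history M sel ω k) (i j).1 (i j).2.1 (i j).2.2
        (fun o => c * f j o) (c * μ j)
        = c * deviation (history M sel ω k) (i j).1 (i j).2.1 (i j).2.2 (f j) (μ j) := by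
      intro c
      simp only [deviation, Finset.mul_sum]
      refine Finset.sum_congr rfl fun l _ => ?_
      split_ifs <;> ring
    rw [Set.mem_iUnion]
    rcases lt_abs.1 hω with h | h
    · refine ⟨(true, j, ⟨k, hk⟩, ⟨_, hn⟩), rfl, ?_⟩
      simp only [if_true, one_mul]
      exact h
    · refine ⟨(false, j, ⟨k, hk⟩, ⟨_, hn⟩), rfl, ?_⟩
      have hd := hdev (-1)
      simp only [neg_one_mul] at hd
      simp only [Bool.false_eq_true, if_false, neg_one_mul, hd]
      exact h
  calc runLaw M _ ≤ runLaw M (⋃ q, E q) := measure_mono hsub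
    _ ≤ ∑ q, runLaw M (E q) := measure_iUnion_fintype_le _ _
    _ ≤ ∑ _q : Bool × J × Fin K × Fin K, ENNReal.ofReal (Real.exp (-L)) :=
        Finset.sum_le_sum fun q _ => hEm q
    _ = _ := by
        rw [Finset.sum_const, Finset.card_univ, nsmul_eq_mul, ← ENNReal.ofReal_natCast,
          ← ENNReal.ofReal_mul (by positivity)]
        congr 1
        simp only [Fintype.card_prod, Fintype.card_bool, Fintype.card_fin]
        push_cast
        ring

end Bernstein

/-! ### Accuracy of the estimates -/

section AccurateOfDeviation

variable {H S A k : ℕ} (M : MDP H S A) (D : History H S A k)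

lemma sum_next_eq (h : Fin H) (s : Fin S) (a : Fin A) (g : Fin S → ℝ) :
    ∑ l, (if (D l h).state = s ∧ (D l h).action = a then g (D l h).next else 0)
      = ∑ s', (transCount D h s a s' : ℝ) * g s' := by
  simp only [transCount, Nat.cast_sum, Finset.sum_mul]
  rw [Finset.sum_comm]
  refine Finset.sum_congr rfl fun l _ => ?_
  by_cases hs : (D l h).state = s ∧ (D l h).action = a
  · simp [hs.1, hs.2]
  · rw [if_neg hs]
    refine (Finset.sum_eq_zero fun s' _ => ?_).symm
    rw [if_neg fun h' => hs ⟨h'.1, h'.2.1⟩]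
    simp

lemma deviation_eq (h : Fin H) (s : Fin S) (a : Fin A) (f : ℝ × Fin S → ℝ) (μ : ℝ) :
    deviation D h s a f μ
      = ∑ l, (if (D l h).state = s ∧ (D l h).action = a then f ((D l h).reward, (D l h).next)
          else 0) - visits D h s a * μ := by
  simp only [deviation, visits, Nat.cast_sum, Finset.sum_mul]
  rw [← Finset.sum_sub_distrib]
  refine Finset.sum_congr rfl fun l _ => ?_
  split_ifs <;> simp

lemma deviation_next {h : Fin H} {s : Fin S} {a : Fin A} (hn : visits D h s a ≠ 0)
    (g : Fin S → ℝ) (μ : ℝ) :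
    deviation D h s a (fun o => g o.2) μ
      = visits D h s a * (∑ s', pTilde D h s a s' * g s' - μ) := by
  have h0 : (visits D h s a : ℝ) ≠ 0 := by exact_mod_cast hn
  rw [deviation_eq, sum_next_eq, mul_sub, Finset.mul_sum]
  congr 1
  refine Finset.sum_congr rfl fun s' _ => ?_
  rw [pTilde, max_visits D hn]
  field_simp

/-- Passing from `1 / n` to `1 / (n + 1)` costs a factor two for `n ≥ 1`, and `√2 ≤ 3 / 2` under the
root. -/
lemma abs_le_of_abs_mul_le {n t v b L x : ℝ} (hn : 1 ≤ n) (hv : 0 ≤ v) (hb : 0 ≤ b) (hL : 0 ≤ L)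
    (hx : x = 1 / (n + 1)) (h : |n * t| ≤ 2 * Real.sqrt (v * n * L) + 2 * b * L) :
    |t| ≤ 3 * Real.sqrt (v * (L * x)) + 4 * b * (L * x) := by
  have hn0 : 0 < n := by linarith
  have hx0 : 0 < x := by rw [hx]; positivity
  have hnx : 1 ≤ 2 * (n * x) := by
    rw [hx, mul_one_div, ← mul_div_assoc, le_div_iff₀ (by linarith)]
    linarith
  have h1 : Real.sqrt (v * n * L) ≤ 3 / 2 * n * Real.sqrt (v * (L * x)) := by
    refine Real.sqrt_le_iff.2 ⟨by positivity, ?_⟩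
    rw [mul_pow, Real.sq_sqrt (by positivity)]
    have h2 : v * n * L * 1 ≤ v * n * L * (2 * (n * x)) := by gcongr
    have h3 : 0 ≤ v * n * L * (n * x) := by positivity
    nlinarith
  have h2 : b * L * 1 ≤ b * L * (2 * (n * x)) := by gcongr
  rw [abs_mul, abs_of_pos hn0] at h
  have h3 : n * |t| ≤ n * (3 * Real.sqrt (v * (L * x)) + 4 * b * (L * x)) := by linarith
  exact le_of_mul_le_mul_left h3 hn0

/-- The deviation of the observable `f` is within the Bernstein bound. -/
def DeviationLe (h : Fin H) (s : Fin S) (a : Fin A) (f : ℝ × Fin S → ℝ) (μ v b L : ℝ) : Prop :=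
  |deviation D h s a f μ| ≤ 2 * Real.sqrt (v * visits D h s a * L) + 2 * b * L

variable {D}

lemma DeviationLe.abs_sum_sub_le {h : Fin H} {s : Fin S} {a : Fin A}
    (hn : visits D h s a ≠ 0) {g : Fin S → ℝ} {μ v b L : ℝ} (hv : 0 ≤ v) (hb : 0 ≤ b)
    (hL : 0 ≤ L) (hdev : DeviationLe D h s a (fun o => g o.2) μ v b L) :
    |∑ s', pTilde D h s a s' * g s' - μ|
      ≤ 3 * Real.sqrt (v * (L * invVisits D h s a)) + 4 * b * (L * invVisits D h s a) := by
  unfold DeviationLe at hdev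
  rw [deviation_next D hn] at hdev
  exact abs_le_of_abs_mul_le (by exact_mod_cast Nat.one_le_iff_ne_zero.2 hn) hv hb hL rfl hdev

variable {M}

lemma wvar_optValue_le [Nonempty (Fin A)] (h : Fin H) (s : Fin S) (a : Fin A) :
    wvar (M.P h s a) (M.optValue h.succ) ≤ (H : ℝ) ^ 2 := by
  have h1 := MDP.wvar_P (M := M) h s a (M.optValue h.succ)
  have h2 : ∑ s', M.P h s a s' * M.optValue h.succ s' ^ 2 ≤ (H : ℝ) ^ 2 :=
    M.sum_P_mul_le fun s' => by
      have := M.optValue_nonneg h.succ s'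
      have := M.optValue_le h.succ s'
      gcongr
  nlinarith [sq_nonneg (∑ s', M.P h s a s' * M.optValue h.succ s')]

/-- Here `w + e ^ 2` is the empirical second moment about the true mean, to which Bernstein applies.
For `y ≥ 1 / 64` the trivial `v ≤ H ^ 2` suffices; otherwise AM-GM and the bound on the bias `e`
return only a fraction of `v`, which is absorbed. -/
lemma variance_le_of_deviation {v w y e H : ℝ} (hv : 0 ≤ v) (hw : 0 ≤ w) (hy : 0 ≤ y)
    (hvH : v ≤ H ^ 2)
    (h1 : |(w + e ^ 2) - v| ≤ 3 * Real.sqrt (H ^ 2 * v * y) + 4 * H ^ 2 * y)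
    (h2 : |e| ≤ 3 * Real.sqrt (v * y) + 4 * H * y) :
    v ≤ 4 * w + 64 * H ^ 2 * y := by
  by_cases hy1 : 1 / 64 ≤ y
  · nlinarith [sq_nonneg H]
  · push Not at hy1
    have a1 : Real.sqrt (H ^ 2 * v * y) ≤ v / 12 + 3 * (H ^ 2 * y) := by
      refine Real.sqrt_le_iff.2 ⟨by positivity, ?_⟩
      nlinarith [sq_nonneg (v / 12 - 3 * (H ^ 2 * y))]
    have a2 : e ^ 2 ≤ (3 * Real.sqrt (v * y) + 4 * H * y) ^ 2 := by
      rw [← sq_abs]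
      gcongr
    have a3 := Real.sq_sqrt (mul_nonneg hv hy)
    have a4 : (3 * Real.sqrt (v * y) + 4 * H * y) ^ 2 ≤ 18 * (v * y) + 32 * (H ^ 2 * y * y) := by
      nlinarith [sq_nonneg (3 * Real.sqrt (v * y) - 4 * H * y)]
    have a5 : v * y ≤ v * (1 / 64) := by gcongr
    have a6 : H ^ 2 * y * y ≤ H ^ 2 * y * (1 / 64) := by gcongr
    have a7 := (abs_le.1 h1).1
    have a8 : 0 ≤ H ^ 2 * y := by positivity
    linarith

lemma accurate_of_deviationLe [Nonempty (Fin A)] {L : ℝ} (hL : 1 ≤ L)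
    (h₁ : ∀ h s a, DeviationLe D h s a (fun o => o.1) (M.R h s a) 1 1 L)
    (h₂ : ∀ h s a, DeviationLe D h s a (fun o => M.optValue h.succ o.2)
      (∑ s', M.P h s a s' * M.optValue h.succ s') (wvar (M.P h s a) (M.optValue h.succ)) H L)
    (h₃ : ∀ h s a, DeviationLe D h s a
      (fun o => (M.optValue h.succ o.2 - ∑ s', M.P h s a s' * M.optValue h.succ s') ^ 2)
      (wvar (M.P h s a) (M.optValue h.succ))
      ((H : ℝ) ^ 2 * wvar (M.P h s a) (M.optValue h.succ)) ((H : ℝ) ^ 2) L)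
    (h₄ : ∀ h s a s', DeviationLe D h s a (fun o => if o.2 = s' then 1 else 0)
      (M.P h s a s') (M.P h s a s') 1 L) :
    Accurate M D L := by
  have hL0 : 0 ≤ L := by linarith
  have hvalue : ∀ h s a, |∑ s', pTilde D h s a s' * M.optValue h.succ s'
      - ∑ s', M.P h s a s' * M.optValue h.succ s'|
    ≤ 3 * Real.sqrt (wvar (M.P h s a) (M.optValue h.succ) * (L * invVisits D h s a))
      + 4 * H * (L * invVisits D h s a) := by
    intro h s a
    by_cases hn : visits D h s a = 0
    · simp only [pTilde_eq_zero D hn, invVisits_eq_one D hn, zero_mul, Finset.sum_const_zero,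
        zero_sub, abs_neg, mul_one]
      have h5 := M.sum_P_mul_le (h := h) (s := s) (a := a) fun s' => M.optValue_le h.succ s'
      have h6 := M.le_sum_P_mul (h := h) (s := s) (a := a) fun s' => M.optValue_nonneg h.succ s'
      rw [abs_of_nonneg h6]
      have h7 := Real.sqrt_nonneg (wvar (M.P h s a) (M.optValue h.succ) * L)
      nlinarith
    · exact (h₂ h s a).abs_sum_sub_le hn (wvar_nonneg (M.P_nonneg h s a)) (by positivity) hL0
  refine ⟨fun h s a => ?_, fun h s a => ?_, fun h s a => ?_, fun h s a s' => ?_⟩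
  · have h5 := h₁ h s a
    unfold DeviationLe at h5
    have hx := invVisits_pos D h s a
    -- The denominator `n + 1` acts like one extra observation of reward zero, which contributes the
    -- bias `-R`.
    have e : rHat D h s a - M.R h s a
        = invVisits D h s a * (deviation D h s a (fun o => o.1) (M.R h s a) - M.R h s a) := by
      rw [deviation_eq, rHat, invVisits]
      field_simp
      ring
    have h6 : |deviation D h s a (fun o => o.1) (M.R h s a) - M.R h s a|
        ≤ 2 * Real.sqrt (1 * visits D h s a * L) + 3 * L := by
      have h7 := abs_sub (deviation D h s a (fun o => o.1) (M.R h s a)) (M.R h s a)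
      rw [abs_of_nonneg (M.R_nonneg h s a)] at h7
      linarith [M.R_le_one h s a]
    rw [e, abs_mul, abs_of_pos hx]
    have h8 : invVisits D h s a * Real.sqrt (1 * visits D h s a * L)
        ≤ Real.sqrt (L * invVisits D h s a) := by
      refine Real.le_sqrt_of_sq_le ?_
      rw [mul_pow, Real.sq_sqrt (by positivity)]
      have h9 : invVisits D h s a * visits D h s a ≤ 1 := by
        rw [invVisits, one_div_mul_eq_div, div_le_one (by positivity)]
        linarith
      calc invVisits D h s a ^ 2 * (1 * visits D h s a * L)
          = (L * invVisits D h s a) * (invVisits D h s a * visits D h s a) := by ring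
        _ ≤ (L * invVisits D h s a) * 1 := by gcongr
        _ = _ := mul_one _
    have h10 := mul_le_mul_of_nonneg_left h6 hx.le
    have h11 := Real.sqrt_nonneg (L * invVisits D h s a)
    linarith
  · have h5 := hvalue h s a
    have h6 := Real.sqrt_nonneg (wvar (M.P h s a) (M.optValue h.succ) * (L * invVisits D h s a))
    linarith
  · have hy : 0 ≤ L * invVisits D h s a := mul_nonneg hL0 (invVisits_pos D h s a).le
    have hw : 0 ≤ wvar (pTilde D h s a) (M.optValue h.succ) := wvar_nonneg (pTilde_nonneg D h s a)
    by_cases hn : visits D h s a = 0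
    · have h5 := wvar_optValue_le (M := M) h s a
      rw [invVisits_eq_one D hn]
      nlinarith [sq_nonneg (H : ℝ)]
    · have hv : 0 ≤ wvar (M.P h s a) (M.optValue h.succ) := wvar_nonneg (M.P_nonneg h s a)
      have h5 := (h₃ h s a).abs_sum_sub_le (g := fun s'' =>
        (M.optValue h.succ s'' - ∑ s', M.P h s a s' * M.optValue h.succ s') ^ 2) hn
        (by positivity) (by positivity) hL0
      rw [sum_mul_sub_sq (sum_pTilde D hn)] at h5
      exact variance_le_of_deviation hv hw hy (wvar_optValue_le h s a) h5
        (hvalue h s a)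
  · have hy : 0 ≤ L * invVisits D h s a := mul_nonneg hL0 (invVisits_pos D h s a).le
    have hsq := Real.sqrt_nonneg (M.P h s a s' * (L * invVisits D h s a))
    by_cases hn : visits D h s a = 0
    · rw [pTilde_eq_zero D hn, invVisits_eq_one D hn, zero_sub, abs_neg,
        abs_of_nonneg (M.P_nonneg h s a s')]
      rw [invVisits_eq_one D hn] at hsq
      have h5 : M.P h s a s' ≤ 1 := by
        have : IsProbabilityMeasure (M.outcome h s a) := inferInstance
        exact measureReal_le_one
      linarith
    · have h5 := (h₄ h s a s').abs_sum_sub_le (g := fun o => if o = s' then 1 else 0) hn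
        (M.P_nonneg h s a s') zero_le_one hL0
      simp only [mul_ite, mul_one, mul_zero, Finset.sum_ite_eq', Finset.mem_univ, if_true] at h5
      linarith

end AccurateOfDeviation

/-! ### Probability that all estimates are accurate -/

section AccurateProbability

variable {H S A : ℕ} {M : MDP H S A} {sel : Selector H S A}

lemma measure_not_accurate_le (hsel : sel.IsArgmax) (hH : 0 < H) (hS : 0 < S) (hA : 0 < A)
    {L : ℝ} (hL : 1 ≤ L) (K : ℕ) :
    runLaw M {ω | ∃ k < K, ¬ Accurate M (history M sel ω k) L}
      ≤ ENNReal.ofReal (8 * (H * S * A * S) * K ^ 2 * Real.exp (-L)) := by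
  have : Nonempty (Fin A) := ⟨⟨0, hA⟩⟩
  have hL0 : 0 < L := by linarith
  have hH1 : (1 : ℝ) ≤ H := by exact_mod_cast hH
  have hH0 : (0 : ℝ) < H := by linarith
  have hS1 : (1 : ℝ) ≤ S := by exact_mod_cast hS
  have mV : ∀ g : Fin S → ℝ, Measurable fun o : ℝ × Fin S => g o.2 := fun g =>
    (measurable_of_finite g).comp measurable_snd
  have bP : ∀ h s a (g : Fin S → ℝ) (c : ℝ), (∀ s', 0 ≤ g s') → (∀ s', g s' ≤ c) →
      ∀ s', |g s' - ∑ s', M.P h s a s' * g s'| ≤ c := by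
    intro h s a g c h0 hc s'
    have h1 := M.sum_P_mul_le (h := h) (s := s) (a := a) hc
    have h2 := M.le_sum_P_mul (h := h) (s := s) (a := a) h0
    rw [abs_le]
    constructor <;> linarith [h0 s', hc s']
  have hvarP : ∀ h s a (g : Fin S → ℝ),
      ∫ o, (g o.2 - ∑ s', M.P h s a s' * g s') ^ 2 ∂(M.outcome h s a) = wvar (M.P h s a) g :=
    fun h s a g => M.integral_next h s a fun s'' => (g s'' - ∑ s', M.P h s a s' * g s') ^ 2
  -- A variable in `[0, c]` has variance at most `c` times its mean. This supplies the variance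
  -- proxies for the squared deviations of `V*` and for the indicators.
  have hvarLe : ∀ h s a (g : Fin S → ℝ) (c : ℝ), (∀ s', 0 ≤ g s') → (∀ s', g s' ≤ c) →
      wvar (M.P h s a) g ≤ c * ∑ s', M.P h s a s' * g s' := by
    intro h s a g c h0 hc
    rw [MDP.wvar_P, Finset.mul_sum]
    have : ∑ s', M.P h s a s' * g s' ^ 2 ≤ ∑ s', c * (M.P h s a s' * g s') :=
      Finset.sum_le_sum fun s' _ => by
        have := mul_nonneg (M.P_nonneg h s a s') (h0 s')
        nlinarith [hc s']
    nlinarith [sq_nonneg (∑ s', M.P h s a s' * g s')]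
  have hind : ∀ h s a s', ∑ s'', M.P h s a s'' * (if s'' = s' then (1 : ℝ) else 0)
      = M.P h s a s' := fun h s a s' => by simp
  have hU0 : ∀ (h : Fin H) s', 0 ≤ M.optValue h.succ s' := fun h => M.optValue_nonneg h.succ
  have hUH : ∀ (h : Fin H) s', M.optValue h.succ s' ≤ H := fun h => M.optValue_le h.succ
  have p₁ := measure_exists_deviation_gt_le (M := M) (J := Fin H × Fin S × Fin A) hsel id
    (f := fun _ o => o.1) (μ := fun j => M.R j.1 j.2.1 j.2.2) (b := fun _ => 1) (v := fun _ => 1)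
    (fun _ => measurable_fst) (fun _ => one_pos) (fun _ => zero_le_one) hL0 (fun _ => rfl)
    (fun j => by
      filter_upwards [M.reward_mem j.1 j.2.1 j.2.2] with o ho
      have h1 := M.R_nonneg j.1 j.2.1 j.2.2
      have h2 := M.R_le_one j.1 j.2.1 j.2.2
      rw [abs_le]
      constructor <;> linarith [ho.1, ho.2])
    (fun j => by
      have h3 : ∫ o, (o.1 - M.R j.1 j.2.1 j.2.2) ^ 2 ∂(M.outcome j.1 j.2.1 j.2.2)
          ≤ ∫ _, (1 : ℝ) ∂(M.outcome j.1 j.2.1 j.2.2) := by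
        refine integral_mono_of_nonneg (Filter.Eventually.of_forall fun o => sq_nonneg _)
          (integrable_const _) ?_
        filter_upwards [M.reward_mem j.1 j.2.1 j.2.2] with o ho
        have h1 := M.R_nonneg j.1 j.2.1 j.2.2
        have h2 := M.R_le_one j.1 j.2.1 j.2.2
        rw [sq_le_one_iff_abs_le_one, abs_le]
        constructor <;> linarith [ho.1, ho.2]
      simpa using h3) K
  have p₂ := measure_exists_deviation_gt_le (M := M) (J := Fin H × Fin S × Fin A) hsel id
    (f := fun j o => M.optValue j.1.succ o.2)
    (μ := fun j => ∑ s', M.P j.1 j.2.1 j.2.2 s' * M.optValue j.1.succ s') (b := fun _ => (H : ℝ))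
    (v := fun j => wvar (M.P j.1 j.2.1 j.2.2) (M.optValue j.1.succ))
    (fun j => mV _) (fun _ => hH0) (fun j => wvar_nonneg (M.P_nonneg _ _ _)) hL0
    (fun j => M.integral_next _ _ _ (M.optValue j.1.succ))
    (fun j => Filter.Eventually.of_forall fun o =>
      bP j.1 j.2.1 j.2.2 _ H (hU0 j.1) (hUH j.1) o.2)
    (fun j => (hvarP j.1 j.2.1 j.2.2 _).le) K
  have hG0 : ∀ (h : Fin H) s a s'', 0 ≤ (M.optValue h.succ s''
      - ∑ s', M.P h s a s' * M.optValue h.succ s') ^ 2 := fun _ _ _ _ => sq_nonneg _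
  have hGH : ∀ (h : Fin H) s a s'', (M.optValue h.succ s''
      - ∑ s', M.P h s a s' * M.optValue h.succ s') ^ 2 ≤ (H : ℝ) ^ 2 := fun h s a s'' => by
    rw [← sq_abs]
    have := bP h s a _ H (hU0 h) (hUH h) s''
    gcongr
  have p₃ := measure_exists_deviation_gt_le (M := M) (J := Fin H × Fin S × Fin A) hsel id
    (f := fun j o => (M.optValue j.1.succ o.2
      - ∑ s', M.P j.1 j.2.1 j.2.2 s' * M.optValue j.1.succ s') ^ 2)
    (μ := fun j => wvar (M.P j.1 j.2.1 j.2.2) (M.optValue j.1.succ)) (b := fun _ => (H : ℝ) ^ 2)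
    (v := fun j => (H : ℝ) ^ 2 * wvar (M.P j.1 j.2.1 j.2.2) (M.optValue j.1.succ))
    (fun j => ((mV _).sub_const _).pow_const 2) (fun _ => by positivity)
    (fun j => mul_nonneg (sq_nonneg _) (wvar_nonneg (M.P_nonneg _ _ _))) hL0
    (fun j => hvarP _ _ _ _)
    (fun j => Filter.Eventually.of_forall fun o =>
      bP j.1 j.2.1 j.2.2 (fun s'' => (M.optValue j.1.succ s''
        - ∑ s', M.P j.1 j.2.1 j.2.2 s' * M.optValue j.1.succ s') ^ 2) _
        (hG0 j.1 j.2.1 j.2.2) (hGH j.1 j.2.1 j.2.2) o.2)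
    (fun j => (hvarP j.1 j.2.1 j.2.2 (fun s'' => (M.optValue j.1.succ s''
        - ∑ s', M.P j.1 j.2.1 j.2.2 s' * M.optValue j.1.succ s') ^ 2)).le.trans
      (hvarLe _ _ _ _ _ (hG0 j.1 j.2.1 j.2.2) (hGH j.1 j.2.1 j.2.2))) K
  have hI0 : ∀ s' s'' : Fin S, (0 : ℝ) ≤ if s'' = s' then 1 else 0 := fun s' s'' => by
    split_ifs <;> norm_num
  have hI1 : ∀ s' s'' : Fin S, (if s'' = s' then 1 else 0 : ℝ) ≤ 1 := fun s' s'' => by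
    split_ifs <;> norm_num
  have p₄ := measure_exists_deviation_gt_le (M := M) (J := (Fin H × Fin S × Fin A) × Fin S) hsel
    Prod.fst (f := fun j o => if o.2 = j.2 then 1 else 0)
    (μ := fun j => M.P j.1.1 j.1.2.1 j.1.2.2 j.2) (b := fun _ => 1)
    (v := fun j => M.P j.1.1 j.1.2.1 j.1.2.2 j.2)
    (fun j => mV fun s'' => if s'' = j.2 then 1 else 0) (fun _ => one_pos)
    (fun j => M.P_nonneg _ _ _ _) hL0
    (fun j => by
      rw [M.integral_next _ _ _ (fun s'' => if s'' = j.2 then (1 : ℝ) else 0), hind])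
    (fun j => Filter.Eventually.of_forall fun o => by
      have := bP j.1.1 j.1.2.1 j.1.2.2 _ 1 (hI0 j.2) (hI1 j.2) o.2
      rwa [hind] at this)
    (fun j => by
      have h1 := hvarP j.1.1 j.1.2.1 j.1.2.2 fun s'' => if s'' = j.2 then (1 : ℝ) else 0
      have h2 := hvarLe j.1.1 j.1.2.1 j.1.2.2 _ 1 (hI0 j.2) (hI1 j.2)
      rw [hind] at h1 h2
      rw [one_mul] at h2
      exact h1.le.trans h2) K
  refine (measure_mono (fun ω hω => ?_)).trans ((measure_union_le _ _).trans
    (add_le_add ((measure_union_le _ _).trans (add_le_add ((measure_union_le _ _).trans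
      (add_le_add p₁ p₂)) p₃)) p₄)) |>.trans ?_
  · by_contra hc
    simp only [Set.mem_union, not_or, Set.mem_ofPred_eq, not_exists, not_and, not_lt] at hc
    obtain ⟨⟨⟨c₁, c₂⟩, c₃⟩, c₄⟩ := hc
    obtain ⟨k, hk, hna⟩ := hω
    exact hna (accurate_of_deviationLe hL (fun h s a => c₁ (h, s, a) k hk)
      (fun h s a => c₂ (h, s, a) k hk) (fun h s a => c₃ (h, s, a) k hk)
      (fun h s a s' => c₄ ((h, s, a), s') k hk))
  · rw [← ENNReal.ofReal_add (by positivity) (by positivity),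
      ← ENNReal.ofReal_add (by positivity) (by positivity),
      ← ENNReal.ofReal_add (by positivity) (by positivity)]
    refine ENNReal.ofReal_le_ofReal ?_
    simp only [Fintype.card_prod, Fintype.card_fin, Nat.cast_mul]
    have h1 : (H : ℝ) * (S * A) ≤ H * (S * A) * S := le_mul_of_one_le_right (by positivity) hS1
    have h2 := mul_le_mul_of_nonneg_right h1
      (show 0 ≤ (K : ℝ) ^ 2 * Real.exp (-L) by positivity)
    linarith

end AccurateProbability

/-! ### Expected regret of one episode -/

section ExpectedEpisode

lemma gaussianReal_abs_gt_le (B : ℝ) :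
    (gaussianReal 0 1).real {z | B < |z|} ≤ 4 * Real.exp (-B) := by
  have hexp : Real.exp (1 / 2) ≤ 2 := by
    have h1 := Real.exp_one_lt_d9
    have h2 : Real.exp (1 / 2) ^ 2 = Real.exp 1 := by rw [← Real.exp_nat_mul]; norm_num
    have h3 := Real.exp_pos (1 / 2)
    nlinarith
  have hmgf : ∀ t : ℝ, mgf id (gaussianReal 0 1) t = Real.exp (t ^ 2 / 2) := fun t => by
    rw [mgf_id_gaussianReal]; simp
  have hi : ∀ t : ℝ, Integrable (fun z => Real.exp (t * id z)) (gaussianReal 0 1) := fun t => by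
    simpa using integrable_exp_mul_gaussianReal (μ := 0) (v := 1) t
  have h1 := measure_ge_le_exp_mul_mgf (X := id) (μ := gaussianReal 0 1) B zero_le_one (hi 1)
  have h2 := measure_le_le_exp_mul_mgf (X := id) (μ := gaussianReal 0 1) (-B)
    (t := -1) (by norm_num) (hi (-1))
  rw [hmgf] at h1 h2
  have h3 : (gaussianReal 0 1).real {z | B < |z|}
      ≤ (gaussianReal 0 1).real ({z | B ≤ id z} ∪ {z | id z ≤ -B}) := by
    refine measureReal_mono fun z hz => ?_
    rcases lt_abs.1 (Set.mem_ofPred.1 hz) with h | h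
    · exact Or.inl h.le
    · exact Or.inr (by simp only [Set.mem_ofPred_eq, id]; linarith)
  have h4 := measureReal_union_le (μ := gaussianReal 0 1) {z | B ≤ id z} {z | id z ≤ -B}
  norm_num at h1 h2
  have h5 := Real.exp_pos (-B)
  norm_num at hexp
  simp only [id] at *
  nlinarith

/-- Only positivity is needed: the interval will depend on `m` alone, so this probability goes into
the constant. -/
lemma gaussianReal_Icc_pos (a : ℝ) : 0 < (gaussianReal 0 1).real (Set.Icc a (a + 1)) := by
  refine measureReal_nonneg.lt_of_ne' fun h => ?_
  rw [measureReal_eq_zero_iff] at h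
  have := gaussianReal_absolutelyContinuous' 0 (one_ne_zero (α := NNReal)) h
  simp at this

variable {H S A k : ℕ} {M : MDP H S A} {D : History H S A k}

lemma measurable_greedy_comp {Ω : Type*} {mΩ : MeasurableSpace Ω} {sel : Selector H S A}
    (hsel : sel.IsArgmax) {D : Ω → History H S A k} {z : Ω → ℝ} (hD : Measurable D)
    (hz : Measurable z) : Measurable fun ω => greedy sel (D ω) (z ω) := by
  have h := (measurable_greedy (k := k) hsel).comp (hD.prodMk hz)
  exact h

lemma integrable_greedy {sel : Selector H S A} (hsel : sel.IsArgmax) (f : Policy H S A → ℝ) :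
    Integrable (fun z => f (greedy sel D z)) (gaussianReal 0 1) := by
  have hm : Measurable fun z : ℝ => greedy sel D z :=
    measurable_greedy_comp hsel measurable_const measurable_id
  have := Measure.isProbabilityMeasure_map (μ := gaussianReal 0 1) hm.aemeasurable
  exact (Integrable.of_finite (f := f)
    (μ := (gaussianReal 0 1).map fun z => greedy sel D z)).comp_measurable hm

lemma value_nonneg (π : Policy H S A) : 0 ≤ M.value π 0 M.init := by
  rw [MDP.value_eq_expSum]
  exact MDP.expSum_nonneg fun h s => M.R_nonneg _ _ _

lemma expSum_invVisits_nonneg (π : Policy H S A) : 0 ≤ M.expSum π (invVisits D) :=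
  MDP.expSum_nonneg fun h s => (invVisits_pos D h s _).le

/-- In expectation over the seed, the regret of an episode is controlled by the expected
reciprocal visit counts. -/
lemma integral_regret_le {sel : Selector H S A} (hsel : sel.IsArgmax) (hH : 0 < H) (hA : 0 < A)
    {L B θ c : ℝ} (hD : WidthValid M D L B θ) (hc : 1 ≤ c) (hlog : L ≤ c * logFactor H S A k)
    (hlog0 : 1 / 2 ≤ logFactor H S A k) (hB : 4 * c + 1 ≤ B) :
    ∫ z, (M.optValue 0 M.init - M.value (greedy sel D z) 0 M.init) ∂(gaussianReal 0 1)
      ≤ 288 * B * L * θ * H ^ 2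
        + 4 * (24 * B / θ + 14544 * B ^ 2 * L * S * H)
          * (1 + 1 / (gaussianReal 0 1).real (Set.Icc (4 * c) (4 * c + 1)))
          * ∫ z, M.expSum (greedy sel D z) (invVisits D) ∂(gaussianReal 0 1)
        + 4 * H * Real.exp (-B) := by
  have : Nonempty (Fin A) := ⟨⟨0, hA⟩⟩
  set N : ℝ → ℝ := fun z => M.expSum (greedy sel D z) (invVisits D) with hN
  set O := Set.Icc (4 * c) (4 * c + 1) with hO
  set q := (gaussianReal 0 1).real O with hq
  have hq0 : 0 < q := gaussianReal_Icc_pos _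
  have hNi : Integrable N (gaussianReal 0 1) :=
    integrable_greedy hsel fun π => M.expSum π (invVisits D)
  have hN0 : ∀ z, 0 ≤ N z := fun z => expSum_invVisits_nonneg _
  obtain ⟨z', hz'O, hz'⟩ := exists_le_setAverage (μ := gaussianReal 0 1) (s := O) (f := N)
    (fun h => hq0.ne' (by rw [hq, measureReal_def, h]; rfl)) (measure_ne_top _ _) hNi.integrableOn
  have hz'N : N z' ≤ 1 / q * ∫ z, N z ∂(gaussianReal 0 1) := by
    refine hz'.trans ?_
    rw [setAverage_eq, smul_eq_mul, one_div]
    exact mul_le_mul_of_nonneg_left (setIntegral_le_integral hNi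
      (Filter.Eventually.of_forall hN0)) (inv_nonneg.2 hq0.le)
  set β := 24 * B / θ + 14544 * B ^ 2 * L * S * H with hβ
  have hβ0 : 0 ≤ β := by
    have := hD.one_le; have := hD.one_le_bound; have := hD.pos; positivity
  have hz'B : |z'| ≤ B := by
    rw [abs_of_nonneg (by linarith [hz'O.1])]; linarith [hz'O.2]
  have hopt := hD.accurate.optValue_le_vBar hD.one_le hc hlog hlog0 hz'O.1 0 M.init
  have hVH := M.optValue_le 0 M.init
  have hα0 : 0 ≤ 288 * B * L * θ * H ^ 2 := by
    have := hD.one_le; have := hD.one_le_bound; have := hD.pos; positivity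
  have key : ∀ z, M.optValue 0 M.init - M.value (greedy sel D z) 0 M.init
      ≤ 288 * B * L * θ * H ^ 2 + 4 * β * (N z + 1 / q * ∫ z, N z ∂(gaussianReal 0 1))
        + H * {z : ℝ | B < |z|}.indicator 1 z := by
    intro z
    have hint : 0 ≤ 1 / q * ∫ z, N z ∂(gaussianReal 0 1) := (hN0 z').trans hz'N
    -- For a seed beyond `B` the trivial bound `H` is used; the Gaussian tail makes its contribution
    -- at most `4 * H * exp (-B)`.
    by_cases hz : |z| ≤ B
    · have h1 := hD.regret_le_bonus hsel hz hH hz'B hopt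
      have h2 := hD.expSum_bonus_le hH (greedy sel D z)
      have h3 := hD.expSum_bonus_le hH (greedy sel D z')
      have h4 := mul_le_mul_of_nonneg_left hz'N hβ0
      have h5 : 0 ≤ (H : ℝ) * {z : ℝ | B < |z|}.indicator 1 z :=
        mul_nonneg (Nat.cast_nonneg _) (Set.indicator_nonneg (fun _ _ => zero_le_one) _)
      change _ ≤ _ + β * N z at h2
      change _ ≤ _ + β * N z' at h3
      linarith
    · rw [Set.indicator_of_mem (by simpa using hz)]
      have h6 := value_nonneg (M := M) (greedy sel D z)
      have h7 : 0 ≤ 4 * β * (N z + 1 / q * ∫ z, N z ∂(gaussianReal 0 1)) :=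
        mul_nonneg (by positivity) (add_nonneg (hN0 z) hint)
      simp only [Pi.one_apply, mul_one]
      linarith
  have hBm : MeasurableSet {z : ℝ | B < |z|} := measurableSet_lt measurable_const measurable_id.abs
  have hii : Integrable ({z : ℝ | B < |z|}.indicator (1 : ℝ → ℝ)) (gaussianReal 0 1) :=
    (integrable_const (1 : ℝ)).indicator hBm
  have hi1 : Integrable (fun z => 288 * B * L * θ * H ^ 2
      + 4 * β * (N z + 1 / q * ∫ z, N z ∂(gaussianReal 0 1))) (gaussianReal 0 1) :=
    (integrable_const _).add ((hNi.add (integrable_const _)).const_mul _)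
  have h8 := integral_mono (integrable_greedy hsel fun π =>
    M.optValue 0 M.init - M.value π 0 M.init) (hi1.add (hii.const_mul (H : ℝ))) key
  refine h8.trans ?_
  have e1 : ∫ z, (288 * B * L * θ * H ^ 2
      + 4 * β * (N z + 1 / q * ∫ z, N z ∂(gaussianReal 0 1))) ∂(gaussianReal 0 1)
      = 288 * B * L * θ * H ^ 2 + 4 * β * (1 + 1 / q) * ∫ z, N z ∂(gaussianReal 0 1) := by
    have hi2 : Integrable (fun z => N z + 1 / q * ∫ z, N z ∂(gaussianReal 0 1))
      (gaussianReal 0 1) := hNi.add (integrable_const _)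
    rw [integral_add (integrable_const _) (hi2.const_mul _), integral_const_mul (4 * β), integral_add hNi (integrable_const _)]
    simp only [integral_const, probReal_univ, smul_eq_mul, one_mul]
    ring
  simp only [Pi.add_apply]
  rw [integral_add hi1 (hii.const_mul (H : ℝ)), e1, integral_const_mul, integral_indicator_one hBm]
  have h9 := mul_le_mul_of_nonneg_left (gaussianReal_abs_gt_le B) (Nat.cast_nonneg (α := ℝ) H)
  linarith

end ExpectedEpisode

/-! ### Counting visits -/

section Counting

variable {H S A : ℕ} {M : MDP H S A} {sel : Selector H S A}

/-- The visit preceded by `n` others contributes `1 / (n + 1)`, so successive visits run through the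
harmonic series. -/
lemma sum_ite_invVisits (h : Fin H) (s : Fin S) (a : Fin A) (ω : ℕ → Seed H S A) (K : ℕ) :
    ∑ k ∈ Finset.range K,
        (if (history M sel ω (k + 1) (Fin.last k) h).state = s ∧
            (history M sel ω (k + 1) (Fin.last k) h).action = a
          then invVisits (history M sel ω k) h s a else 0)
      = (harmonic (visits (history M sel ω K) h s a) : ℝ) := by
  induction K with
  | zero => simp [visits]
  | succ K ih =>
    rw [Finset.sum_range_succ, ih]
    have e : visits (history M sel ω (K + 1)) h s a = visits (history M sel ω K) h s a
        + if (history M sel ω (K + 1) (Fin.last K) h).state = s ∧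
            (history M sel ω (K + 1) (Fin.last K) h).action = a then 1 else 0 := by
      simp only [visits, Fin.sum_univ_castSucc, history_succ_castSucc]
    rw [e]
    split_ifs
    · rw [harmonic_succ, invVisits]
      push_cast
      rw [one_div]
    · simp

lemma sum_invVisits_le (ω : ℕ → Seed H S A) (K : ℕ) :
    ∑ k ∈ Finset.range K, ∑ h, invVisits (history M sel ω k) h
        (rollout M.init (greedy sel (history M sel ω k) (ω k).1) (ω k).2 h).state
        (rollout M.init (greedy sel (history M sel ω k) (ω k).1) (ω k).2 h).action
      ≤ H * S * A * (1 + Real.log K) := by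
  have e : ∀ k, ∀ h : Fin H, invVisits (history M sel ω k) h
        (rollout M.init (greedy sel (history M sel ω k) (ω k).1) (ω k).2 h).state
        (rollout M.init (greedy sel (history M sel ω k) (ω k).1) (ω k).2 h).action
      = ∑ s, ∑ a, if (history M sel ω (k + 1) (Fin.last k) h).state = s ∧
            (history M sel ω (k + 1) (Fin.last k) h).action = a
          then invVisits (history M sel ω k) h s a else 0 := by
    intro k h
    rw [← history_succ_last]
    simp [ite_and]
  simp only [e]
  rw [Finset.sum_comm]
  have h1 : ∀ h : Fin H, ∑ k ∈ Finset.range K, ∑ s, ∑ a,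
      (if (history M sel ω (k + 1) (Fin.last k) h).state = s ∧
            (history M sel ω (k + 1) (Fin.last k) h).action = a
          then invVisits (history M sel ω k) h s a else 0)
      ≤ ∑ _s : Fin S, ∑ _a : Fin A, (1 + Real.log K) := by
    intro h
    rw [Finset.sum_comm]
    refine Finset.sum_le_sum fun s _ => ?_
    rw [Finset.sum_comm]
    refine Finset.sum_le_sum fun a _ => ?_
    rw [sum_ite_invVisits]
    have hn : visits (history M sel ω K) h s a ≤ K := by
      refine (Finset.sum_le_sum (g := fun _ => 1) fun l _ => ?_).trans (by simp)
      split_ifs <;> simp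
    have h2 : harmonic (visits (history M sel ω K) h s a) ≤ harmonic K :=
      Finset.sum_le_sum_of_subset_of_nonneg (Finset.range_subset_range.2 hn)
        fun i _ _ => by positivity
    calc (harmonic (visits (history M sel ω K) h s a) : ℝ) ≤ (harmonic K : ℝ) := by exact_mod_cast h2
      _ ≤ 1 + Real.log K := harmonic_le_one_add_log K
  refine (Finset.sum_le_sum fun h _ => h1 h).trans_eq ?_
  simp
  ring

end Counting

/-! ### Normalized episode quantities and their conditional means -/

section Episodes

variable {H S A : ℕ} {M : MDP H S A} {sel : Selector H S A}

/-- Normalized regret of an episode as a function of the history and of the seed. -/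
def episodeRegret (M : MDP H S A) (sel : Selector H S A) (k : ℕ) (D : History H S A k)
    (ξ : Seed H S A) : ℝ :=
  (M.optValue 0 M.init - M.value (greedy sel D ξ.1) 0 M.init) / H

/-- Normalized sum of the reciprocal visit counts met in an episode. -/
def episodeInvVisits (M : MDP H S A) (sel : Selector H S A) (k : ℕ) (D : History H S A k)
    (ξ : Seed H S A) : ℝ :=
  (∑ h, invVisits D h (rollout M.init (greedy sel D ξ.1) ξ.2 h).state
    (rollout M.init (greedy sel D ξ.1) ξ.2 h).action) / H

lemma measurable_episodeRegret (hsel : sel.IsArgmax) (k : ℕ) :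
    Measurable fun p : _ × _ => episodeRegret M sel k p.1 p.2 := by
  have h1 : Measurable fun p : History H S A k × Seed H S A => greedy sel p.1 p.2.1 :=
    measurable_greedy_comp hsel measurable_fst measurable_snd.fst
  have h2 : Measurable fun π : Policy H S A => (M.optValue 0 M.init - M.value π 0 M.init) / H :=
    measurable_of_finite _
  exact h2.comp h1

lemma measurable_episodeInvVisits (hsel : sel.IsArgmax) (k : ℕ) :
    Measurable fun p : _ × _ => episodeInvVisits M sel k p.1 p.2 := by
  have h1 : ∀ h : Fin H, Measurable fun p : History H S A k × Seed H S A =>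
      rollout M.init (greedy sel p.1 p.2.1) p.2.2 h := fun h => by
    have h0 := (measurable_pi_apply h).comp (measurable_episode (k := k) hsel M.init)
    exact h0
  have h2 : ∀ (h : Fin H) (s : Fin S), Measurable fun p : History H S A k × Seed H S A =>
      invVisits p.1 h s (rollout M.init (greedy sel p.1 p.2.1) p.2.2 h).action := fun h s => by
    have h0 := measurable_eval_comp
      (f := fun (p : History H S A k × Seed H S A) a => invVisits p.1 h s a)
      (fun a => (measurable_invVisits h s a).comp measurable_fst) (measurable_action.comp (h1 h))
    exact h0
  have h3 : ∀ h : Fin H, Measurable fun p : History H S A k × Seed H S A =>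
      invVisits p.1 h (rollout M.init (greedy sel p.1 p.2.1) p.2.2 h).state
        (rollout M.init (greedy sel p.1 p.2.1) p.2.2 h).action := fun h => by
    have h0 := measurable_eval_comp (h2 h) (measurable_state.comp (h1 h))
    exact h0
  have h4 := (Finset.measurable_sum Finset.univ fun h _ => h3 h).div_const (H : ℝ)
  unfold episodeInvVisits
  exact h4

lemma episodeRegret_bounds (hA : 0 < A) (hH : 0 < H) (k : ℕ) (D : History H S A k)
    (ξ : Seed H S A) : 0 ≤ episodeRegret M sel k D ξ ∧ episodeRegret M sel k D ξ ≤ 1 := by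
  have : Nonempty (Fin A) := ⟨⟨0, hA⟩⟩
  have hH0 : (0 : ℝ) < H := by exact_mod_cast hH
  have h1 := M.value_le_optValue (greedy sel D ξ.1) 0 M.init
  have h2 := M.optValue_le 0 M.init
  have h3 := value_nonneg (M := M) (greedy sel D ξ.1)
  exact ⟨div_nonneg (by linarith) hH0.le, (div_le_one hH0).2 (by linarith)⟩

lemma episodeInvVisits_bounds (hH : 0 < H) (k : ℕ) (D : History H S A k) (ξ : Seed H S A) :
    0 ≤ episodeInvVisits M sel k D ξ ∧ episodeInvVisits M sel k D ξ ≤ 1 := by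
  have hH0 : (0 : ℝ) < H := by exact_mod_cast hH
  refine ⟨div_nonneg (Finset.sum_nonneg fun h _ => (invVisits_pos D _ _ _).le) hH0.le,
    (div_le_one hH0).2 ?_⟩
  refine (Finset.sum_le_sum fun h _ => invVisits_le_one D _ _ _).trans_eq ?_
  simp

lemma integral_episodeRegret (k : ℕ) (D : History H S A k) :
    ∫ ξ, episodeRegret M sel k D ξ ∂(seedLaw M)
      = (∫ z, (M.optValue 0 M.init - M.value (greedy sel D z) 0 M.init) ∂(gaussianReal 0 1)) / H := by
  rw [seedLaw_eq, ← integral_div]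
  have := integral_fun_fst (μ := gaussianReal 0 1) (ν := tableLaw M)
    fun z => (M.optValue 0 M.init - M.value (greedy sel D z) 0 M.init) / H
  simpa [episodeRegret] using this

lemma integral_episodeInvVisits (hsel : sel.IsArgmax) (hH : 0 < H) (k : ℕ)
    (D : History H S A k) :
    ∫ ξ, episodeInvVisits M sel k D ξ ∂(seedLaw M)
      = (∫ z, M.expSum (greedy sel D z) (invVisits D) ∂(gaussianReal 0 1)) / H := by
  have hm : Measurable (episodeInvVisits M sel k D) := by
    have h0 := (measurable_episodeInvVisits (M := M) hsel k).comp
      (measurable_prodMk_left (x := D))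
    exact h0
  have hi : Integrable (episodeInvVisits M sel k D) (seedLaw M) :=
    integrable_of_bounds hm (Filter.Eventually.of_forall fun ξ => episodeInvVisits_bounds hH k D ξ)
  rw [seedLaw_eq] at hi ⊢
  rw [integral_prod _ hi, ← integral_div]
  refine integral_congr_ae (Filter.Eventually.of_forall fun z => ?_)
  simp only [episodeInvVisits]
  rw [integral_div, ← integral_sum_path]
  rfl

lemma regret_eq (hH : 0 < H) (K : ℕ) (ω : ℕ → Seed H S A) :
    regret M sel K ω
      = H * ∑ k ∈ Finset.range K, episodeRegret M sel k (history M sel ω k) (ω k) := by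
  have hH0 : (H : ℝ) ≠ 0 := by exact_mod_cast hH.ne'
  simp only [regret, playedPolicy, episodeRegret, ← Finset.sum_div]
  field_simp

end Episodes

/-! ### Logarithmic factors -/

section Logarithms

variable {H S A K : ℕ} {δ : ℝ}

lemma polylogBase_eq (H S A K : ℕ) (δ : ℝ) : polylogBase H S A K δ
    = 1 + Real.log ((H : ℝ) * S * A * (H * K) / δ) := rfl

lemma one_le_size (hH : 0 < H) (hS : 0 < S) (hA : 0 < A) (hK : 0 < K) :
    (1 : ℝ) ≤ (H : ℝ) * S * A * (H * K) := by
  have : 1 ≤ H * S * A * (H * K) := Nat.one_le_iff_ne_zero.2 (by positivity)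
  exact_mod_cast this

lemma exp_neg_polylogBase (hH : 0 < H) (hS : 0 < S) (hA : 0 < A) (hK : 0 < K) (hδ : 0 < δ) :
    Real.exp (-polylogBase H S A K δ)
      = Real.exp (-1) * (δ / ((H : ℝ) * S * A * (H * K))) := by
  have h1 := one_le_size hH hS hA hK
  rw [polylogBase_eq, neg_add, Real.exp_add, Real.exp_neg (Real.log _),
    Real.exp_log (div_pos (by linarith) hδ), inv_div]

lemma le_size_div (hH : 0 < H) (hS : 0 < S) (hA : 0 < A) (hK : 0 < K) (hδ : 0 < δ) (hδ1 : δ < 1) :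
    (H : ℝ) * S * A * (H * K) ≤ (H : ℝ) * S * A * (H * K) / δ := by
  have h1 := one_le_size hH hS hA hK
  rw [le_div_iff₀ hδ]
  nlinarith

lemma one_le_polylogBase (hH : 0 < H) (hS : 0 < S) (hA : 0 < A) (hK : 0 < K) (hδ : 0 < δ)
    (hδ1 : δ < 1) : 1 ≤ polylogBase H S A K δ := by
  have h1 := one_le_size hH hS hA hK
  have h2 := le_size_div hH hS hA hK hδ hδ1
  rw [polylogBase_eq]
  linarith [Real.log_nonneg (h1.trans h2)]

lemma one_add_log_le_polylogBase (hH : 0 < H) (hS : 0 < S) (hA : 0 < A) (hK : 0 < K)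
    (hδ : 0 < δ) (hδ1 : δ < 1) : 1 + Real.log K ≤ polylogBase H S A K δ := by
  have h2 := le_size_div hH hS hA hK hδ hδ1
  rw [polylogBase_eq]
  have hK0 : (0 : ℝ) < K := by exact_mod_cast hK
  have h3 : (K : ℝ) ≤ (H : ℝ) * S * A * (H * K) := by
    have : 1 * K ≤ (H * S * A * H) * K :=
      Nat.mul_le_mul_right K (Nat.one_le_iff_ne_zero.2 (by positivity))
    have h4 : ((1 * K : ℕ) : ℝ) ≤ ((H * S * A * H) * K : ℕ) := by exact_mod_cast this
    push_cast at h4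
    linarith
  linarith [Real.log_le_log hK0 (h3.trans h2)]

lemma mul_exp_neg_polylogBase_le (hH : 0 < H) (hS : 0 < S) (hA : 0 < A) (hK : 0 < K)
    (hδ : 0 < δ) (hδ1 : δ < 1) : K * Real.exp (-polylogBase H S A K δ) ≤ 1 := by
  have h1 := one_add_log_le_polylogBase hH hS hA hK hδ hδ1
  have hK0 : (0 : ℝ) < K := by exact_mod_cast hK
  calc K * Real.exp (-polylogBase H S A K δ) ≤ K * Real.exp (-Real.log K) := by
        gcongr; linarith
    _ = 1 := by rw [Real.exp_neg, Real.exp_log hK0, mul_inv_cancel₀ hK0.ne']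

/-- With `X = H S A T`, the level `4 l` gives `exp (-4 l) = exp (-4) (δ / X) ^ 4`, and `X ^ 4`
covers the cardinality of the union bound. -/
lemma failure_probability_le (hH : 0 < H) (hS : 0 < S) (hA : 0 < A) (hK : 0 < K)
    (hδ : 0 < δ) (hδ1 : δ < 1) :
    8 * ((H : ℝ) * S * A * S) * K ^ 2 * Real.exp (-(4 * polylogBase H S A K δ))
      + 2 * Real.exp (-(4 * polylogBase H S A K δ)) ≤ δ := by
  have hH1 : (1 : ℝ) ≤ H := by exact_mod_cast hH
  have hS1 : (1 : ℝ) ≤ S := by exact_mod_cast hS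
  have hA1 : (1 : ℝ) ≤ A := by exact_mod_cast hA
  have hK1 : (1 : ℝ) ≤ K := by exact_mod_cast hK
  set X := (H : ℝ) * S * A * (H * K) with hX
  have hX1 : 1 ≤ X := one_le_size hH hS hA hK
  have hX0 : 0 < X := by linarith
  have e : Real.exp (-(4 * polylogBase H S A K δ)) = Real.exp (-1) ^ 4 * (δ / X) ^ 4 := by
    rw [← mul_pow, ← exp_neg_polylogBase hH hS hA hK hδ, ← Real.exp_nat_mul]
    congr 1; push_cast; ring
  have he : Real.exp (-1) ^ 4 ≤ 1 / 16 := by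
    have h1 : Real.exp (-1) ≤ 1 / 2 := by
      rw [Real.exp_neg, ← one_div]
      exact one_div_le_one_div_of_le (by norm_num) (by linarith [Real.add_one_le_exp 1])
    calc Real.exp (-1) ^ 4 ≤ (1 / 2) ^ 4 := by gcongr
      _ = 1 / 16 := by norm_num
  have hcount : (H : ℝ) * S * A * S * K ^ 2 ≤ X ^ 4 := by
    have g1 : (1 : ℝ) ≤ H * A := one_le_mul_of_one_le_of_one_le hH1 hA1
    have h2 : X ^ 2 = ((H : ℝ) * S * A * S * K ^ 2) * ((H : ℝ) * A * (H * H)) := by rw [hX]; ring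
    have h3 : (1 : ℝ) ≤ (H : ℝ) * A * (H * H) :=
      one_le_mul_of_one_le_of_one_le g1 (one_le_mul_of_one_le_of_one_le hH1 hH1)
    calc (H : ℝ) * S * A * S * K ^ 2 ≤ X ^ 2 := by
          rw [h2]; exact le_mul_of_one_le_right (by positivity) h3
      _ ≤ X ^ 4 := pow_le_pow_right₀ hX1 (by norm_num)
  have h1X : 1 ≤ X ^ 4 := one_le_pow₀ hX1
  have hδ4 : δ ^ 4 ≤ δ := pow_le_of_le_one hδ.le hδ1.le (by norm_num)
  rw [e, div_pow]
  have h5 : (8 * ((H : ℝ) * S * A * S) * K ^ 2 + 2) ≤ 10 * X ^ 4 := by linarith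
  calc 8 * ((H : ℝ) * S * A * S) * K ^ 2 * (Real.exp (-1) ^ 4 * (δ ^ 4 / X ^ 4))
        + 2 * (Real.exp (-1) ^ 4 * (δ ^ 4 / X ^ 4))
      = (8 * ((H : ℝ) * S * A * S) * K ^ 2 + 2) * (Real.exp (-1) ^ 4 * (δ ^ 4 / X ^ 4)) := by ring
    _ ≤ 10 * X ^ 4 * (1 / 16 * (δ / X ^ 4)) := by gcongr
    _ = 10 / 16 * δ := by field_simp
    _ ≤ δ := by linarith

lemma half_le_logFactor (hH : 0 < H) (hS : 0 < S) (hA : 0 < A) (k : ℕ) :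
    1 / 2 ≤ logFactor H S A k := by
  have h1 : (1 : ℝ) ≤ (H : ℝ) * S * A * ((k : ℝ) + 1) ^ 2 := by
    have : 1 ≤ H * S * A * (k + 1) ^ 2 := Nat.one_le_iff_ne_zero.2 (by positivity)
    exact_mod_cast this
  have h2 : Real.log 2 ≤ logFactor H S A k := Real.log_le_log (by norm_num) (by linarith)
  linarith [Real.log_two_gt_d9]

lemma logFactor_le (hH : 0 < H) (hS : 0 < S) (hA : 0 < A) (hδ : 0 < δ) (hδ1 : δ < 1) {k : ℕ}
    (hk : k < K) : logFactor H S A k ≤ 4 * polylogBase H S A K δ := by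
  have hK : 0 < K := by omega
  have hH1 : (1 : ℝ) ≤ H := by exact_mod_cast hH
  have hHSA : (1 : ℝ) ≤ (H : ℝ) * S * A := by
    have : 1 ≤ H * S * A := Nat.one_le_iff_ne_zero.2 (by positivity)
    exact_mod_cast this
  have hkK : (k : ℝ) + 1 ≤ K := by exact_mod_cast hk
  set X := (H : ℝ) * S * A * (H * K) with hX
  have hX1 : 1 ≤ X := one_le_size hH hS hA hK
  have h1 : 2 * (H : ℝ) * S * A * ((k : ℝ) + 1) ^ 2 ≤ 2 * X ^ 2 := by
    have h3 : ((k : ℝ) + 1) ^ 2 ≤ ((H : ℝ) * K) ^ 2 := by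
      gcongr
      nlinarith
    have h4 : (H : ℝ) * S * A ≤ (H * S * A) ^ 2 := by nlinarith
    calc 2 * (H : ℝ) * S * A * ((k : ℝ) + 1) ^ 2 = 2 * ((H * S * A) * ((k : ℝ) + 1) ^ 2) := by ring
      _ ≤ 2 * ((H * S * A) ^ 2 * ((H : ℝ) * K) ^ 2) := by gcongr
      _ = 2 * X ^ 2 := by rw [hX]; ring
  have h2 : 0 < 2 * (H : ℝ) * S * A * ((k : ℝ) + 1) ^ 2 := by
    have : 0 < (H : ℝ) * S * A := by linarith
    have h5 : 0 < (H : ℝ) * S * A * ((k : ℝ) + 1) ^ 2 := by positivity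
    linarith
  have h6 := Real.log_le_log h2 h1
  have e : Real.log (2 * X ^ 2) = Real.log 2 + 2 * Real.log X := by
    rw [Real.log_mul (by norm_num) (by positivity), Real.log_pow]
    push_cast
    ring
  rw [e] at h6
  have h7 := Real.log_le_log (by linarith) (le_size_div hH hS hA hK hδ hδ1)
  have h8 := Real.log_nonneg hX1
  have h9 := Real.log_two_lt_d9
  rw [polylogBase_eq]
  unfold logFactor
  linarith

/-- The noise does not know `δ` or `K`. Polynomial smallness of `1 / δ` in `T` and `K ≤ (k + 1) ^ 2`
bound `H S A T / δ` by a power of `H S A K`, whose logarithm the noise contains. -/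
lemma polylogBase_le (hH : 0 < H) (hS : 0 < S) (hA : 0 < A) (hK : 0 < K) (hδ : 0 < δ) {m k : ℕ}
    (hm : 1 / δ ≤ ((H : ℝ) * K) ^ m) (hk : K ≤ (k + 1) ^ 2) :
    polylogBase H S A K δ ≤ (m + 4) * logFactor H S A k := by
  have hH1 : (1 : ℝ) ≤ H := by exact_mod_cast hH
  have hK1 : (1 : ℝ) ≤ K := by exact_mod_cast hK
  have hSA : (1 : ℝ) ≤ (S : ℝ) * A := by
    have : 1 ≤ S * A := Nat.one_le_iff_ne_zero.2 (by positivity)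
    exact_mod_cast this
  have hkK : (K : ℝ) ≤ ((k : ℝ) + 1) ^ 2 := by exact_mod_cast hk
  set Y := (H : ℝ) * S * A * K with hY
  have hHK : (H : ℝ) * K ≤ Y := by
    have : (H : ℝ) * K * 1 ≤ H * K * (S * A) := by gcongr
    calc (H : ℝ) * K = H * K * 1 := by ring
      _ ≤ H * K * (S * A) := this
      _ = Y := by rw [hY]; ring
  have hHK1 : (1 : ℝ) ≤ (H : ℝ) * K := one_le_mul_of_one_le_of_one_le hH1 hK1
  have hY1 : 1 ≤ Y := hHK1.trans hHK
  have h1 : (H : ℝ) * S * A * (H * K) / δ ≤ Y ^ (m + 2) := by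
    have h2 : (H : ℝ) * S * A * (H * K) ≤ Y ^ 2 := by
      have h3 : (H : ℝ) * S * A * (H * K) = Y * H := by rw [hY]; ring
      have h4 : (H : ℝ) ≤ Y := le_trans (le_mul_of_one_le_right (by linarith) hK1) hHK
      rw [h3, sq]
      gcongr
    rw [div_eq_mul_one_div, pow_add, mul_comm (Y ^ m)]
    have h5 : 1 / δ ≤ Y ^ m := hm.trans (by gcongr)
    exact mul_le_mul h2 h5 (by positivity) (by positivity)
  have h6 : 0 < (H : ℝ) * S * A * (H * K) / δ :=
    div_pos (by linarith [one_le_size hH hS hA hK]) hδ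
  have h7 := Real.log_le_log h6 h1
  rw [Real.log_pow] at h7
  have h8 : Real.log 2 + Real.log Y ≤ logFactor H S A k := by
    rw [← Real.log_mul (by norm_num) (by positivity)]
    refine Real.log_le_log (by positivity) ?_
    calc 2 * Y = 2 * (H : ℝ) * S * A * K := by rw [hY]; ring
      _ ≤ _ := by gcongr
  have h9 := Real.log_two_gt_d9
  have h10 := Real.log_nonneg hY1
  have h11 := mul_le_mul_of_nonneg_left h8 (show (0 : ℝ) ≤ m + 4 by positivity)
  have h12 : (0 : ℝ) ≤ m * Real.log 2 := by positivity
  rw [polylogBase_eq]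
  push_cast at h7
  linarith

end Logarithms

/-! ### The regret bound -/

section Regret

lemma card_small_episodes_le (K : ℕ) :
    ∑ k ∈ Finset.range K, (if (k + 1) ^ 2 < K then (1 : ℝ) else 0) ≤ Real.sqrt K := by
  rw [← Finset.sum_filter, Finset.sum_const, nsmul_eq_mul, mul_one]
  refine le_trans ?_ (Real.nat_sqrt_le_real_sqrt (a := K))
  have h : (Finset.range K).filter (fun k => (k + 1) ^ 2 < K) ⊆ Finset.range (Nat.sqrt K) := by
    intro k hk
    have h1 := (Finset.mem_filter.1 hk).2
    have h2 : k + 1 ≤ Nat.sqrt K := Nat.le_sqrt'.2 h1.le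
    exact Finset.mem_range.2 (by omega)
  exact_mod_cast (Finset.card_le_card h).trans (by simp)

/-- The leading constant, in terms of the relative size `d` of the truncation level and of the
probability `q` of an optimistic seed. -/
def regretConst (d q : ℝ) : ℝ := 4654080 * d ^ 2 * (1 + 1 / q)

/-- The choice `θ = W / T` balances the two leading terms: `K θ H ^ 2 = H W` and `S A / θ = W`. The
remaining `S H` part of the bonus times `N` gives `H ^ 2 S ^ 2 A`. -/
lemma regret_arithmetic {H S A K T W θ l d q N R : ℝ} (hH : 1 ≤ H) (hS : 1 ≤ S) (hA : 1 ≤ A)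
    (hK : 0 < K) (hT : T = H * K) (hW : W = Real.sqrt (S * A * T)) (hθ : θ = W / T) (hl : 1 ≤ l)
    (hd : 1 ≤ d) (hq : 0 < q) (hW1 : 1 ≤ W) (hKW : Real.sqrt K ≤ W)
    (hN : N ≤ 2 * (H * S * A * l) + 2 * (4 * l) * H)
    (hR : R ≤ 2 * (H * Real.sqrt K + K * (288 * (d * l) * (4 * l) * θ * H ^ 2)
        + 4 * (24 * (d * l) / θ + 14544 * (d * l) ^ 2 * (4 * l) * S * H) * (1 + 1 / q) * N
        + 4 * H) + 4 * l * H) :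
    R ≤ regretConst d q * l ^ 4 * (H * W + H ^ 2 * S ^ 2 * A) := by
  have hT0 : 0 < T := by rw [hT]; positivity
  have hW0 : 0 < W := by linarith
  have hθ0 : 0 < θ := by rw [hθ]; positivity
  have hWW : W ^ 2 = S * A * T := by rw [hW]; exact Real.sq_sqrt (by positivity)
  have hSAθ : S * A / θ = W := by
    rw [hθ]; field_simp; linarith
  have hKθ : K * θ * H ^ 2 = H * W := by
    rw [hθ, hT]; field_simp
  have hN' : N ≤ 10 * (H * S * A * l) := by
    have : 1 ≤ S * A := one_le_mul_of_one_le_of_one_le hS hA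
    have h1 : H * l * 1 ≤ H * l * (S * A) := by gcongr
    linarith
  set Q := 1 + 1 / q with hQ
  have hQ1 : 1 ≤ Q := by rw [hQ]; linarith [one_div_pos.2 hq]
  have h1 : 4 * (24 * (d * l) / θ + 14544 * (d * l) ^ 2 * (4 * l) * S * H) * Q * N
      ≤ 4 * (24 * (d * l) / θ + 14544 * (d * l) ^ 2 * (4 * l) * S * H) * Q
        * (10 * (H * S * A * l)) := by gcongr
  have h2 : 4 * (24 * (d * l) / θ + 14544 * (d * l) ^ 2 * (4 * l) * S * H) * Q
        * (10 * (H * S * A * l))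
      = 960 * d * Q * l ^ 2 * (H * (S * A / θ))
        + 2327040 * d ^ 2 * Q * l ^ 4 * (H ^ 2 * S ^ 2 * A) := by
    field_simp
    ring
  rw [hSAθ] at h2
  have h3 : K * (288 * (d * l) * (4 * l) * θ * H ^ 2) = 1152 * d * l ^ 2 * (H * W) := by
    rw [← hKθ]; ring
  have hHW : 0 ≤ H * W := by positivity
  have h4 : H * Real.sqrt K ≤ H * W := by gcongr
  have h5 : H ≤ H * W := le_mul_of_one_le_right (by linarith) hW1
  have hl2 : l ^ 2 ≤ l ^ 4 := pow_le_pow_right₀ hl (by norm_num)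
  have hl1 : l ≤ l ^ 4 := le_self_pow₀ hl (by norm_num)
  have hl0 : 1 ≤ l ^ 4 := one_le_pow₀ hl
  have hdd : d ≤ d ^ 2 := le_self_pow₀ hd (by norm_num)
  have hd2 : 1 ≤ d ^ 2 := one_le_pow₀ hd
  have hdQ : 1 ≤ d ^ 2 * Q := one_le_mul_of_one_le_of_one_le hd2 hQ1
  have hdQ1 : d ^ 2 * 1 ≤ d ^ 2 * Q := by gcongr
  have g1 : d * Q * l ^ 2 * (H * W) ≤ d ^ 2 * Q * l ^ 4 * (H * W) := by gcongr
  have g2 : d * 1 * l ^ 2 * (H * W) ≤ d ^ 2 * Q * l ^ 4 * (H * W) := by gcongr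
  have g3 : 1 * 1 * (H * W) ≤ d ^ 2 * Q * l ^ 4 * (H * W) := by gcongr
  have g4 : l * H ≤ d ^ 2 * Q * l ^ 4 * (H * W) := by
    calc l * H = 1 * l * H := by ring
      _ ≤ d ^ 2 * Q * l ^ 4 * (H * W) := by gcongr
  unfold regretConst
  rw [← hQ]
  linarith

variable {H S A : ℕ} {M : MDP H S A} {sel : Selector H S A}

/-- The pathwise regret bound on the event that all estimates are accurate and that the two
sums over episodes are close to their conditional means. -/
lemma regret_le_of_event (hsel : sel.IsArgmax) (hH : 0 < H) (hS : 0 < S) (hA : 0 < A) {K : ℕ}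
    (hK : 0 < K) {δ : ℝ} (hδ : 0 < δ) (hδ1 : δ < 1) {m : ℕ} (hm : 1 / δ ≤ ((H : ℝ) * K) ^ m)
    {ω : ℕ → Seed H S A}
    (hacc : ∀ k < K, Accurate M (history M sel ω k) (4 * polylogBase H S A K δ))
    (hreg : ∑ k ∈ Finset.range K, episodeRegret M sel k (history M sel ω k) (ω k)
      ≤ 2 * (∑ k ∈ Finset.range K,
          ∫ ξ, episodeRegret M sel k (history M sel ω k) ξ ∂(seedLaw M))
        + 4 * polylogBase H S A K δ)
    (hvis : ∑ k ∈ Finset.range K, ∫ ξ, episodeInvVisits M sel k (history M sel ω k) ξ ∂(seedLaw M)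
      ≤ 2 * (∑ k ∈ Finset.range K, episodeInvVisits M sel k (history M sel ω k) (ω k))
        + 2 * (4 * polylogBase H S A K δ)) :
    regret M sel K ω ≤ regretConst (16 * (m + 4) + 1)
        ((gaussianReal 0 1).real (Set.Icc (4 * (4 * (m + 4))) (4 * (4 * ((m : ℝ) + 4)) + 1)))
      * polylogBase H S A K δ ^ 4
      * (H * Real.sqrt (S * A * (H * K)) + (H : ℝ) ^ 2 * (S : ℝ) ^ 2 * A) := by
  have : Nonempty (Fin A) := ⟨⟨0, hA⟩⟩
  have hH1 : (1 : ℝ) ≤ H := by exact_mod_cast hH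
  have hH0 : (0 : ℝ) < H := by linarith
  have hS1 : (1 : ℝ) ≤ S := by exact_mod_cast hS
  have hA1 : (1 : ℝ) ≤ A := by exact_mod_cast hA
  have hK1 : (1 : ℝ) ≤ K := by exact_mod_cast hK
  set l := polylogBase H S A K δ with hl
  have hl1 : 1 ≤ l := one_le_polylogBase hH hS hA hK hδ hδ1
  -- Ratio of the accuracy level `4 l` to the noise logarithm, from `polylogBase_le`.
  set c : ℝ := 4 * (m + 4) with hc
  have hc1 : 1 ≤ c := by rw [hc]; linarith [Nat.cast_nonneg (α := ℝ) m]
  set q := (gaussianReal 0 1).real (Set.Icc (4 * c) (4 * c + 1)) with hq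
  have hq0 : 0 < q := gaussianReal_Icc_pos _
  -- The truncation level is `B = d * l`; since `d = 4 c + 1`, it contains the optimistic interval.
  set d : ℝ := 16 * (m + 4) + 1 with hd
  have hdc : d = 4 * c + 1 := by rw [hd, hc]; ring
  have hd1 : 1 ≤ d := by linarith
  set T : ℝ := H * K with hT
  set W := Real.sqrt (S * A * T) with hW
  set θ := W / T with hθ
  have hSA : (1 : ℝ) ≤ S * A := one_le_mul_of_one_le_of_one_le hS1 hA1
  have hT1 : 1 ≤ T := one_le_mul_of_one_le_of_one_le hH1 hK1
  have hKT : (K : ℝ) ≤ S * A * T :=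
    calc (K : ℝ) = 1 * (1 * K) := by ring
      _ ≤ (S : ℝ) * A * (H * K) := by gcongr
  have hKW : Real.sqrt K ≤ W := Real.sqrt_le_sqrt hKT
  have hW1 : 1 ≤ W := (Real.one_le_sqrt.2 hK1).trans hKW
  have hθ0 : 0 < θ := by positivity
  set r : ℕ → ℝ := fun k => ∫ z, (M.optValue 0 M.init
    - M.value (greedy sel (history M sel ω k) z) 0 M.init) ∂(gaussianReal 0 1) with hr
  set n : ℕ → ℝ := fun k => ∫ z, M.expSum (greedy sel (history M sel ω k) z)
    (invVisits (history M sel ω k)) ∂(gaussianReal 0 1) with hn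
  have hrH : ∀ k, r k ≤ H := by
    intro k
    have h1 : r k ≤ ∫ _, (H : ℝ) ∂(gaussianReal 0 1) := by
      refine integral_mono (integrable_greedy hsel fun π =>
        M.optValue 0 M.init - M.value π 0 M.init) (integrable_const _) fun z => ?_
      have := M.optValue_le 0 M.init
      have := value_nonneg (M := M) (greedy sel (history M sel ω k) z)
      simp only
      linarith
    simpa using h1
  have hn0 : ∀ k, 0 ≤ n k := fun k => integral_nonneg fun z => expSum_invVisits_nonneg _
  set β : ℝ := 4 * (24 * (d * l) / θ + 14544 * (d * l) ^ 2 * (4 * l) * S * H) * (1 + 1 / q) with hβ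
  have hβ0 : 0 ≤ β := by positivity
  set α : ℝ := 288 * (d * l) * (4 * l) * θ * H ^ 2 with hα
  have hα0 : 0 ≤ α := by positivity
  -- In an early episode the noise logarithm may be too small for optimism, so the trivial bound `H`
  -- is charged there.
  have hrk : ∀ k ∈ Finset.range K, r k ≤ α + β * n k + 4 * H * Real.exp (-l)
      + H * (if (k + 1) ^ 2 < K then (1 : ℝ) else 0) := by
    intro k hk
    have hkK : k < K := Finset.mem_range.1 hk
    have he : 0 ≤ 4 * H * Real.exp (-l) := by positivity
    have hb := mul_nonneg hβ0 (hn0 k)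
    split_ifs with hsmall
    · linarith [hrH k]
    · have hlogk := half_le_logFactor hH hS hA k
      have h1 : WidthValid M (history M sel ω k) (4 * l) (d * l) θ :=
        ⟨hacc k hkK, by linarith, logFactor_le hH hS hA hδ hδ1 hkK, by linarith,
          one_le_mul_of_one_le_of_one_le hd1 hl1, hθ0⟩
      have h2 : 4 * l ≤ c * logFactor H S A k := by
        have := polylogBase_le hH hS hA hK hδ hm (not_lt.1 hsmall)
        rw [hc]; linarith
      have h3 := integral_regret_le hsel hH hA h1 hc1 h2 hlogk (by
        rw [← hdc]; exact le_mul_of_one_le_right (by linarith) hl1)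
      have h4 : Real.exp (-(d * l)) ≤ Real.exp (-l) :=
        Real.exp_le_exp.2 (neg_le_neg (le_mul_of_one_le_left (by linarith) hd1))
      have h5 : 4 * H * Real.exp (-(d * l)) ≤ 4 * H * Real.exp (-l) := by gcongr
      change r k ≤ α + β * n k + 4 * H * Real.exp (-(d * l)) at h3
      linarith
  have hsumr : ∑ k ∈ Finset.range K, r k
      ≤ H * Real.sqrt K + K * α + β * (∑ k ∈ Finset.range K, n k) + 4 * H := by
    refine (Finset.sum_le_sum hrk).trans ?_
    simp only [Finset.sum_add_distrib, ← Finset.mul_sum, Finset.sum_const, Finset.card_range,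
      nsmul_eq_mul]
    have h1 := mul_le_mul_of_nonneg_left (card_small_episodes_le K) hH0.le
    have h2 := mul_le_mul_of_nonneg_left (mul_exp_neg_polylogBase_le hH hS hA hK hδ hδ1)
      (show (0 : ℝ) ≤ 4 * H by positivity)
    rw [← hl] at h2
    linarith
  -- The conditional means `n k` are traded for realized reciprocals, whose sum is harmonic.
  have hsumn : ∑ k ∈ Finset.range K, n k ≤ 2 * (H * S * A * l) + 2 * (4 * l) * H := by
    simp only [integral_episodeInvVisits hsel hH, ← Finset.sum_div] at hvis
    have h1 := sum_invVisits_le (M := M) (sel := sel) ω K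
    have h2 : ∑ k ∈ Finset.range K, episodeInvVisits M sel k (history M sel ω k) (ω k)
        ≤ (H * S * A * l) / H := by
      simp only [episodeInvVisits, ← Finset.sum_div]
      have h3 := one_add_log_le_polylogBase hH hS hA hK hδ hδ1
      gcongr
      refine h1.trans ?_
      gcongr
    have h4 : (∑ k ∈ Finset.range K, n k) / H
        ≤ 2 * ((H * S * A * l) / H) + 2 * (4 * l) := by linarith
    rw [div_le_iff₀ hH0] at h4
    refine h4.trans_eq ?_
    field_simp
  refine regret_arithmetic hH1 hS1 hA1 (by linarith) hT hW hθ hl1 hd1 hq0 hW1 hKW hsumn ?_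
  rw [regret_eq hH]
  simp only [integral_episodeRegret, ← Finset.sum_div] at hreg
  have h5 := mul_le_mul_of_nonneg_left hreg hH0.le
  refine h5.trans ?_
  have h6 : H * (2 * ((∑ k ∈ Finset.range K, r k) / H) + 4 * l)
      = 2 * (∑ k ∈ Finset.range K, r k) + 4 * l * H := by
    field_simp
  refine h6.le.trans ?_
  linarith

lemma high_probability_regret (hsel : sel.IsArgmax) (hH : 0 < H) (hS : 0 < S) (hA : 0 < A) {K : ℕ}
    (hK : 0 < K) {δ : ℝ} (hδ : 0 < δ) (hδ1 : δ < 1) {m : ℕ} (hm : 1 / δ ≤ ((H : ℝ) * K) ^ m) :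
    1 - δ ≤ (runLaw M).real {ω | regret M sel K ω ≤ regretConst (16 * (m + 4) + 1)
        ((gaussianReal 0 1).real (Set.Icc (4 * (4 * (m + 4))) (4 * (4 * ((m : ℝ) + 4)) + 1)))
      * polylogBase H S A K δ ^ 4
      * (H * Real.sqrt (S * A * (H * K)) + (H : ℝ) ^ 2 * (S : ℝ) ^ 2 * A)} := by
  set G := {ω | regret M sel K ω ≤ regretConst (16 * (m + 4) + 1)
        ((gaussianReal 0 1).real (Set.Icc (4 * (4 * (m + 4))) (4 * (4 * ((m : ℝ) + 4)) + 1)))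
      * polylogBase H S A K δ ^ 4
      * (H * Real.sqrt (S * A * (H * K)) + (H : ℝ) ^ 2 * (S : ℝ) ^ 2 * A)} with hG
  set L := 4 * polylogBase H S A K δ with hL
  have hL1 : 1 ≤ L := by linarith [one_le_polylogBase hH hS hA hK hδ hδ1]
  have b₁ := measure_not_accurate_le (M := M) hsel hH hS hA hL1 K
  have b₂ := measure_sum_gt_le (M := M) hsel (measurable_episodeRegret (M := M) hsel)
    (fun k D ξ => (episodeRegret_bounds (M := M) (sel := sel) hA hH k D ξ).1)
    (fun k D ξ => (episodeRegret_bounds (M := M) (sel := sel) hA hH k D ξ).2) K L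
  have b₃ := measure_sum_mean_gt_le (M := M) hsel (measurable_episodeInvVisits (M := M) hsel)
    (fun k D ξ => (episodeInvVisits_bounds (M := M) (sel := sel) hH k D ξ).1)
    (fun k D ξ => (episodeInvVisits_bounds (M := M) (sel := sel) hH k D ξ).2) K L
  have hGc : runLaw M Gᶜ ≤ ENNReal.ofReal δ := by
    refine (measure_mono fun ω hω => ?_).trans ((measure_union_le _ _).trans
      (add_le_add ((measure_union_le _ _).trans (add_le_add b₁ b₂)) b₃)) |>.trans ?_
    · by_contra hc
      simp only [Set.mem_union, not_or, Set.mem_ofPred_eq, not_exists, not_and, not_lt,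
        not_not] at hc
      exact hω (regret_le_of_event hsel hH hS hA hK hδ hδ1 hm hc.1.1 hc.1.2 hc.2)
    · rw [← ENNReal.ofReal_add (by positivity) (by positivity),
        ← ENNReal.ofReal_add (by positivity) (by positivity)]
      refine ENNReal.ofReal_le_ofReal ?_
      linarith [failure_probability_le hH hS hA hK hδ hδ1]
  have h1 : (runLaw M).real Gᶜ ≤ δ := by
    rw [measureReal_def]
    exact ENNReal.toReal_le_of_le_ofReal hδ.le hGc
  have h2 := measureReal_union_le (μ := runLaw M) G Gᶜ
  rw [Set.union_compl_self, probReal_univ] at h2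
  linarith

end Regret

end SSR

end

/-! ### The two stated forms of the bound -/

theorem theorem2 (m : ℕ) :
    ∃ (C : ℝ) (p : ℕ), 0 < C ∧
      ∀ (H S A K : ℕ), 0 < H → 0 < S → 0 < A → 0 < K →
      ∀ (T : ℝ), T = (H : ℝ) * (K : ℝ) →
      ∀ (δ : ℝ), 0 < δ → δ < 1 → 1 / δ ≤ T ^ m →
      C * SSR.polylogBase H S A K δ ^ p * ((H : ℝ) ^ 5 * (S : ℝ) ^ 2 * (A : ℝ)) ≤ T →
      ∀ (M : SSR.MDP H S A) (sel : SSR.Selector H S A), sel.IsArgmax →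
        1 - δ ≤ (SSR.runLaw M).real {ω | SSR.regret M sel K ω ≤
            C * SSR.polylogBase H S A K δ ^ p *
              ((H : ℝ) * Real.sqrt ((S : ℝ) * (A : ℝ) * T)
                + (H : ℝ) ^ 4 * (S : ℝ) ^ 2 * (A : ℝ))} ∧
        (C * SSR.polylogBase H S A K δ ^ p * ((H : ℝ) ^ 6 * (S : ℝ) ^ 3 * (A : ℝ)) ≤ T →
          1 - δ ≤ (SSR.runLaw M).real {ω | SSR.regret M sel K ω ≤
            C * SSR.polylogBase H S A K δ ^ p *
              ((H : ℝ) * Real.sqrt ((S : ℝ) * (A : ℝ) * T))}) := by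
  set q := (gaussianReal 0 1).real
    (Set.Icc (4 * (4 * (m + 4))) (4 * (4 * ((m : ℝ) + 4)) + 1)) with hq
  have hq0 : 0 < q := SSR.gaussianReal_Icc_pos _
  set C₀ := SSR.regretConst (16 * (m + 4) + 1) q with hC₀
  have hC₀1 : 1 ≤ C₀ := by
    rw [hC₀, SSR.regretConst]
    have h1 : (1 : ℝ) ≤ 16 * (m + 4) + 1 := by linarith [Nat.cast_nonneg (α := ℝ) m]
    have h2 : 1 ≤ 1 + 1 / q := by linarith [one_div_pos.2 hq0]
    have h3 := one_le_mul_of_one_le_of_one_le (one_le_pow₀ h1 (n := 2)) h2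
    linarith
  refine ⟨2 * C₀, 4, by linarith, ?_⟩
  rintro H S A K hH hS hA hK T rfl δ hδ hδ1 hm - M sel hsel
  have hH1 : (1 : ℝ) ≤ H := by exact_mod_cast hH
  have hmain := SSR.high_probability_regret (M := M) hsel hH hS hA hK hδ hδ1 hm
  rw [← hq, ← hC₀] at hmain
  have hl1 : 1 ≤ SSR.polylogBase H S A K δ ^ 4 :=
    one_le_pow₀ (SSR.one_le_polylogBase hH hS hA hK hδ hδ1)
  set l := SSR.polylogBase H S A K δ ^ 4
  set W := Real.sqrt ((S : ℝ) * A * (H * K)) with hW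
  have hW0 : 0 ≤ W := Real.sqrt_nonneg _
  have hpow : (H : ℝ) ^ 2 * (S : ℝ) ^ 2 * A ≤ (H : ℝ) ^ 4 * (S : ℝ) ^ 2 * A := by
    gcongr
    norm_num
  have hCl : 0 ≤ C₀ * l := by positivity
  constructor
  · refine hmain.trans (measureReal_mono fun ω hω => ?_)
    rw [Set.mem_ofPred_eq] at hω ⊢
    refine le_trans hω ?_
    have h1 : C₀ * l * (H * W + (H : ℝ) ^ 2 * (S : ℝ) ^ 2 * A)
        ≤ C₀ * l * (H * W + (H : ℝ) ^ 4 * (S : ℝ) ^ 2 * A) := by gcongr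
    have h2 : 0 ≤ C₀ * l * (H * W + (H : ℝ) ^ 4 * (S : ℝ) ^ 2 * A) := by positivity
    linarith
  · intro hT
    have hT' : (H : ℝ) ^ 6 * (S : ℝ) ^ 3 * A ≤ H * K := by
      refine le_trans (le_mul_of_one_le_left (by positivity) ?_) hT
      exact one_le_mul_of_one_le_of_one_le (by linarith) hl1
    -- After dividing by `H` and squaring, this is `H ^ 6 S ^ 4 A ^ 2 ≤ S A T`, which is the assumed
    -- lower bound on `T` times `S A`. The lower-order term then doubles the main one, hence the
    -- constant `2 * C₀`.
    have hlow : (H : ℝ) ^ 4 * (S : ℝ) ^ 2 * A ≤ H * W := by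
      have h1 : (H : ℝ) ^ 3 * (S : ℝ) ^ 2 * A ≤ W := by
        refine Real.le_sqrt_of_sq_le ?_
        calc ((H : ℝ) ^ 3 * (S : ℝ) ^ 2 * A) ^ 2
            = (S : ℝ) * A * ((H : ℝ) ^ 6 * (S : ℝ) ^ 3 * A) := by ring
          _ ≤ (S : ℝ) * A * (H * K) := by gcongr
      calc (H : ℝ) ^ 4 * (S : ℝ) ^ 2 * A = H * ((H : ℝ) ^ 3 * (S : ℝ) ^ 2 * A) := by ring
        _ ≤ H * W := by gcongr
    refine hmain.trans (measureReal_mono fun ω hω => ?_)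
    rw [Set.mem_ofPred_eq] at hω ⊢
    refine le_trans hω ?_
    have h1 : C₀ * l * (H * W + (H : ℝ) ^ 2 * (S : ℝ) ^ 2 * A) ≤ C₀ * l * (H * W + H * W) :=
      mul_le_mul_of_nonneg_left (by linarith) hCl
    linarith
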